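/- **Conventions.** Inputs are pairs $\langle x,0^{k}\rangle$ with $x\in\{0,1\}^{*}$, $k\ge 1$; the unary integer $k$ stands for $1/\varepsilon$ or $1/\delta$, and $n=|x|$. $\|\cdot\|$ is variation distance, $\|\mathcal C-\mathcal D\|=\frac12\sum_y|\mathcal C(y)-\mathcal D(y)|$; the event that a machine does not halt (or an oracle does not answer) counts as an additional outcome, of probability $0$ under $\mathcal D_x$. A *sampling problem* is a family $S=(\mathcal D_x)_{x\in\{0,1\}^*}$ of probability distributions, $\mathcal D_x$ on $\{0,1\}^{m}$ with $m=m(n)$, for a fixed polynomial $m$ with natural coefficients. A *search problem* is a family $R=(A_{x,\delta})$ of nonempty sets of strings, one for each input $\langle x,0^{1/\delta}\rangle$, $1/\delta\in\{1,2,\dots\}$, the elements of $A_{x,\delta}$ having a common length that depends only on $n$ and $1/\delta$ and is bounded by a polynomial in $n+1/\delta$. An oracle may be randomized: each query $w$ is answered by a fresh independent sample from a distribution depending on $w$ (deterministic oracles are a special case). A probabilistic Turing machine $M$ *solves* $R$ if for all $x$ and all $\delta$, on input $\langle x,0^{1/\delta}\rangle$, it outputs an element of $A_{x,\delta}$ with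 probability at least $1-\delta$. $R\in\mathsf{FBPP}^{\mathcal O}$ means that some probabilistic oracle Turing machine with oracle $\mathcal O$, running in time polynomial in $n+1/\delta$, solves $R$. $S\in\mathsf{SampP}^{\mathcal O}$ means that some probabilistic oracle Turing machine with oracle $\mathcal O$, on input $\langle x,0^{1/\varepsilon}\rangle$, runs in time polynomial in $n+1/\varepsilon$ and outputs a sample from a distribution within variation distance $\varepsilon$ of $\mathcal D_x$, for all $x$ and all $\varepsilon$. Running times are worst case over all coins and oracle answers (a query costs one step; a computation whose query is never answered is exempt). For a probabilistic Turing machine $B$ (with no bound on its running time), $\mathsf{SampP}^{B}$ refers to the oracle that answers a query $w$ by the output of $B$ on $w$ with fresh coins. Fix a universal prefix-free machine $U$, i.e. a partial computable $U(p,z)$ such that for each condition $z$ the set of valid programs $p$ is prefix-free, and such that for every other machine $V$ of this kind there is a constant $c$ so that every output of $V$ from a program $p$ and a condition $z$ is an output of $U$ from some program of length at most $|p|+c$ and the same $z$. Let $K(y\mid z)$ be the least length of a program $p$ with $U(p,z)=y$. **Theorem (Sampling/Searching Equivalence).** Let $S=(\mathcal D_x)$ be a sampling problem. For $\delta=1/k$,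 put $N=\lceil m/\delta^{2.1}\rceil$, $\beta=1+\log_2(1/\delta)$, and let $A_{x,\delta}$ be the set of all $N$-tuples $Y=\langle y_1,\dots,y_N\rangle$ of $m$-bit strings (encoded by concatenation) such that, with $p_y=\Pr_{\mathcal D_x}[y]$, $$\log_2\frac1{p_{y_1}\cdots p_{y_N}}\le K(Y\mid x,\delta)+\beta,$$ where $K(Y\mid x,\delta)$ means $K(Y\mid\langle x,0^{1/\delta}\rangle)$ and the left side is $+\infty$ if the product vanishes. Then $R_S=(A_{x,\delta})$ is a search problem (in particular all $A_{x,\delta}$ are nonempty), and: 1. Let $\mathcal O$ be any oracle that samples from $S$ approximately: for some polynomial $\rho$ and all $x$ and $\varepsilon=1/k$, its answer to $\langle x,0^{1/\varepsilon},r\rangle$, with $r$ uniform in $\{0,1\}^{\rho(n+1/\varepsilon)}$, has a distribution within variation distance $\varepsilon$ of $\mathcal D_x$. Then $R_S\in\mathsf{FBPP}^{\mathcal O}$. 2. Let $B$ be any probabilistic Turing machine solving $R_S$. Then $S\in\mathsf{SampP}^{B}$. Moreover, a uniformly random coordinate of $B$'s output samples from $S$: there is a constant $c_B$ such that for all $x$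 and all $\delta=1/k\le 1/c_B$, if $Y=\langle y_1,\dots,y_N\rangle$ is the output of $B$ on $\langle x,0^{1/\delta}\rangle$ and $i\in[N]$ is uniform and independent, then the distribution of $y_i$ is within variation distance $2\delta$ of $\mathcal D_x$. (An output of $B$ that is not a concatenation of $N$ $m$-bit strings is cut into blocks of $m$ bits from the left, missing bits being omitted; for $N=0$, i.e. $m=0$, $y_i$ is the empty string.) -/

import Mathlib

open scoped ENNReal

namespace SampSearch

/-! ### Strings and pairing -/

/-- The pairing `⟨u, v⟩` of two bit strings: every bit of `u` is preceded by the flag `1`, the flag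
`0` ends `u`, and `v` follows. -/
def pair (u v : List Bool) : List Bool :=
  u.flatMap (fun b => [true, b]) ++ false :: v

/-- The string `0 ^ k`. -/
def zeros (k : ℕ) : List Bool := List.replicate k false

/-- The input `⟨x, 0 ^ k⟩`, where `k = 1 / ε` is an error parameter in unary. -/
def inst (x : List Bool) (k : ℕ) : List Bool := pair x (zeros k)

/-- The query `⟨x, 0 ^ k, r⟩`. -/
def instR (x : List Bool) (k : ℕ) (r : List Bool) : List Bool := pair x (pair (zeros k) r)

/-! ### Variation distance -/

/-- The variation distance `‖p - q‖ = (1 / 2) ∑ |p a - q a|`. -/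
noncomputable def tvDist {α : Type} (p q : PMF α) : ℝ :=
  (1 / 2) * ∑' a, |(p a).toReal - (q a).toReal|

/-! ### Probabilistic oracle Turing machines -/

/-- A (possibly randomized) oracle. A query `w` is answered by a fresh sample from `O w`;
the outcome `none` means that the oracle never answers. A deterministic oracle `f` is
`fun w => PMF.pure (some (f w))`. -/
abbrev Oracle : Type := List Bool → PMF (Option (List Bool))

/-- The oracle that never answers; machines without oracle are run with it. -/
noncomputable def noOracle : Oracle := fun _ => PMF.pure none

/-- What a machine does with one of its tapes in one step. -/
inductive TapeAct where
  | keep : TapeAct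
  | pop : TapeAct
  | push : Bool → TapeAct

/-- The effect of a `TapeAct` on a tape. -/
def TapeAct.apply : TapeAct → List Bool → List Bool
  | .keep, l => l
  | .pop, l => l.tail
  | .push b, l => b :: l

/-- A probabilistic oracle Turing machine with a finite control and finitely many tapes. As in
Mathlib's model `Turing.TM2`, each tape is a stack whose top is the scanned symbol (a two-way
infinite tape is a pair of stacks). In each ordinary step the machine reads all scanned symbols
(`none` on an empty stack) and a fresh fair coin, changes its state and acts on each tape.
In the state `ask` the content of the tape `query` is submitted to the oracle. -/
structure PTM where
  /-- the states -/
  Q : Type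
  [finQ : Fintype Q]
  /-- the number of tapes -/
  tapes : ℕ
  start : Q
  halt : Q
  ask : Q
  answer : Q
  input : Fin tapes
  output : Fin tapes
  query : Fin tapes
  reply : Fin tapes
  /-- the transition function; the last argument is the coin -/
  δ : Q → (Fin tapes → Option Bool) → Bool → Q × (Fin tapes → TapeAct)

namespace PTM

/-- A configuration: the state and the contents of the tapes. -/
abbrev Cfg (M : PTM) : Type := M.Q × (Fin M.tapes → List Bool)

/-- The initial configuration on input `w`. -/
def init (M : PTM) (w : List Bool) : M.Cfg :=
  (M.start, Function.update (fun _ => []) M.input w)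

open Classical in
/-- One step. A halted machine stays as it is. In the state `ask` the oracle's answer overwrites
the tape `reply`, the tape `query` is erased, and the next state is `answer`; if the oracle does
not answer, then the computation gets stuck (`none`). -/
noncomputable def step (M : PTM) (O : Oracle) (c : M.Cfg) : PMF (Option M.Cfg) :=
  if c.1 = M.halt then PMF.pure (some c)
  else if c.1 = M.ask then
    (O (c.2 M.query)).map (Option.map fun a =>
      (M.answer, Function.update (Function.update c.2 M.query []) M.reply a))
  else
    (PMF.uniformOfFintype Bool).map fun coin =>
      let d := M.δ c.1 (fun i => (c.2 i).head?) coin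
      some (d.1, fun i => (d.2 i).apply (c.2 i))

/-- `step`, where a stuck computation stays stuck. -/
noncomputable def stepOpt (M : PTM) (O : Oracle) : Option M.Cfg → PMF (Option M.Cfg)
  | none => PMF.pure none
  | some c => M.step O c

/-- The distribution of the configuration after `t` steps on input `w`. -/
noncomputable def run (M : PTM) (O : Oracle) (w : List Bool) : ℕ → PMF (Option M.Cfg)
  | 0 => PMF.pure (some (M.init w))
  | t + 1 => (run M O w t).bind (M.stepOpt O)

open Classical in
/-- The output in a configuration; `none` unless the machine has halted. -/
noncomputable def result (M : PTM) : Option M.Cfg → Option (List Bool)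
  | none => none
  | some c => if c.1 = M.halt then some (c.2 M.output) else none

/-- The probability that on input `w` the machine halts with output `y` (at any time). -/
noncomputable def outProb (M : PTM) (O : Oracle) (w y : List Bool) : ℝ≥0∞ :=
  ⨆ t, ((M.run O w t).map M.result) (some y)

theorem monotone_result (M : PTM) (O : Oracle) (w y : List Bool) :
    Monotone fun t => ((M.run O w t).map M.result) (some y) := by
  classical
  refine monotone_nat_of_le_succ fun t => ?_
  have h : (M.run O w (t + 1)).map M.result =
      (M.run O w t).bind fun o => (M.stepOpt O o).map M.result := by
    simp only [run, PMF.map_bind]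
  rw [h, PMF.map_apply, PMF.bind_apply]
  refine ENNReal.tsum_le_tsum fun o => ?_
  split_ifs with ho
  · cases o with
    | none => simp [result] at ho
    | some c =>
      by_cases hc : c.1 = M.halt
      · have h2 : M.stepOpt O (some c) = PMF.pure (some c) := by simp [stepOpt, step, hc]
        simp [h2, PMF.pure_map, ← ho]
      · simp [result, hc] at ho
  · exact zero_le

theorem tsum_outProb_le (M : PTM) (O : Oracle) (w : List Bool) :
    ∑' y, M.outProb O w y ≤ 1 := by
  rw [ENNReal.tsum_eq_iSup_sum]
  refine iSup_le fun s => ?_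
  simp only [outProb]
  rw [ENNReal.finsetSum_iSup_of_monotone fun y => M.monotone_result O w y]
  refine iSup_le fun t => ?_
  calc ∑ y ∈ s, ((M.run O w t).map M.result) (some y)
      = ∑ o ∈ s.map Function.Embedding.some, ((M.run O w t).map M.result) o := by
        rw [Finset.sum_map]; rfl
    _ ≤ ∑' o, ((M.run O w t).map M.result) o := ENNReal.sum_le_tsum _
    _ = 1 := PMF.tsum_coe _

/-- The distribution of the output on input `w`, with no bound on the running time. The outcome
`none` means that the machine does not halt. -/
noncomputable def outLaw (M : PTM) (O : Oracle) (w : List Bool) : PMF (Option (List Bool)) :=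
  ⟨fun o => o.elim (1 - ∑' y, M.outProb O w y) (M.outProb O w), by
    rw [ENNReal.summable.hasSum_iff, ← (Equiv.optionEquivSumPUnit.{0, 0} (List Bool)).symm.tsum_eq,
      Summable.tsum_sum ENNReal.summable ENNReal.summable, add_comm]
    simp only [Equiv.optionEquivSumPUnit_symm_inl, Equiv.optionEquivSumPUnit_symm_inr,
      Option.elim_some, Option.elim_none, tsum_fintype, Finset.univ_unique, Finset.sum_const,
      Finset.card_singleton, one_smul]
    exact tsub_add_cancel_of_le (M.tsum_outProb_le O w)⟩

/-- On all inputs `⟨x, 0 ^ k⟩` with `k ≥ 1`, for all coins and all answers of the oracle, the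
machine halts within `T (|x| + k)` steps (unless it waits for an answer that never comes). -/
def RunsInTime (M : PTM) (O : Oracle) (T : ℕ → ℕ) : Prop :=
  ∀ (x : List Bool) (k : ℕ), 1 ≤ k →
    ∀ c, some c ∈ (M.run O (inst x k) (T (x.length + k))).support → c.1 = M.halt

end PTM

/-! ### Sampling problems and search problems -/

/-- A sampling problem: distributions `D x` over strings of length `len |x|`. -/
structure SamplingProblem where
  len : Polynomial ℕ
  D : List Bool → PMF (List Bool)
  length_eq : ∀ x, ∀ y ∈ (D x).support, y.length = len.eval x.length

/-- A search problem: for each input `⟨x, 0 ^ k⟩`, `k ≥ 1`, a nonempty set of solutions of a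
polynomially bounded length. (The solutions may depend on the error parameter `δ = 1 / k`.) -/
structure SearchProblem where
  sol : List Bool → ℕ → Set (List Bool)
  len : ℕ → ℕ → ℕ
  len_le : ∃ p : Polynomial ℕ, ∀ n k, 1 ≤ k → len n k ≤ p.eval (n + k)
  length_eq : ∀ x k, 1 ≤ k → ∀ y ∈ sol x k, y.length = len x.length k
  nonempty : ∀ x k, 1 ≤ k → (sol x k).Nonempty

/-- The oracle samples from `S` approximately: for a polynomial `ρ`, the answer to
`⟨x, 0 ^ k, r⟩` with `r` uniform in `{0,1} ^ ρ(|x| + k)` has a distribution within `1 / k` of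
`D x`. -/
def SamplesFrom (O : Oracle) (S : SamplingProblem) : Prop :=
  ∃ ρ : Polynomial ℕ, ∀ (x : List Bool) (k : ℕ), 1 ≤ k →
    tvDist
      ((PMF.uniformOfFintype (Fin (ρ.eval (x.length + k)) → Bool)).bind fun r =>
        O (instR x k (List.ofFn r)))
      ((S.D x).map some) ≤ 1 / (k : ℝ)

/-- With the oracle `O`, on each input `⟨x, 0 ^ k⟩` with `k ≥ 1`, the machine outputs a solution
with probability at least `1 - 1 / k`. -/
def Solves (M : PTM) (O : Oracle) (R : SearchProblem) : Prop :=
  ∀ (x : List Bool) (k : ℕ), 1 ≤ k →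
    1 - (k : ℝ≥0∞)⁻¹ ≤ (M.outLaw O (inst x k)).toOuterMeasure (some '' R.sol x k)

/-- `R ∈ FBPP ^ O`. -/
def InFBPP (O : Oracle) (R : SearchProblem) : Prop :=
  ∃ (M : PTM) (T : Polynomial ℕ), M.RunsInTime O (fun n => T.eval n) ∧ Solves M O R

/-- `S ∈ SampP ^ O`. -/
def InSampP (O : Oracle) (S : SamplingProblem) : Prop :=
  ∃ (M : PTM) (T : Polynomial ℕ), M.RunsInTime O (fun n => T.eval n) ∧
    ∀ (x : List Bool) (k : ℕ), 1 ≤ k →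
      tvDist (M.outLaw O (inst x k)) ((S.D x).map some) ≤ 1 / (k : ℝ)

/-- A probabilistic Turing machine `B` as an oracle: a query `w` is answered by the output of a
run of `B` on `w` with fresh coins. -/
noncomputable def oracleOf (B : PTM) : Oracle := B.outLaw noOracle

/-! ### Prefix-free Kolmogorov complexity -/

/-- A partial computable `V` (program `p`, condition `z`) such that for every condition the set of
valid programs is prefix-free. -/
structure IsPrefixMachine (V : List Bool → List Bool →. List Bool) : Prop where
  partrec : Partrec₂ V
  prefix_free : ∀ z p q, (V p z).Dom → (V q z).Dom → p <+: q → p = q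

/-- A universal prefix-free machine: it produces whatever another prefix-free machine produces
from programs that are longer by at most a constant. -/
structure IsUniversal (U : List Bool → List Bool →. List Bool) : Prop
    extends IsPrefixMachine U where
  universal : ∀ V, IsPrefixMachine V →
    ∃ c : ℕ, ∀ p z y, y ∈ V p z → ∃ q, y ∈ U q z ∧ q.length ≤ p.length + c

/-! Universal prefix-free machines exist. -/

section Existence

open Nat.Partrec (Code)
open Encodable Denumerable

/-- The code `c` as a controller of a machine that reads its program bit by bit: having read `q`,
it asks for a further bit (value `0`) or halts (positive values). -/
def ctrl (c : Code) (q z : List Bool) : Part ℕ := c.eval (encode (q, z))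

/-- The controller asks for a further bit after each of the first `n` prefixes of `q`. -/
def readsOn (c : Code) (q z : List Bool) (n : ℕ) : Part ℕ :=
  n.rec (Part.some 0) fun i ih => ih.bind fun _ =>
    (ctrl c (q.take i) z).bind fun v => Part.ofOption (if v = 0 then some 0 else none)

/-- The output of the self-delimiting machine with controller `c` on program `q`. -/
def selfDelim (c : Code) (q z : List Bool) : Part (List Bool) :=
  (readsOn c q z q.length).bind fun _ =>
    (ctrl c q z).bind fun v => Part.ofOption (Nat.casesOn v none fun n => decode n)

/-- A concrete universal prefix-free machine: the program `1 ^ e 0 q` runs the `e`-th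
self-delimiting machine on `q`. -/
def stdMachine (p z : List Bool) : Part (List Bool) :=
  (Part.ofOption p[p.idxOf false]?).bind fun _ =>
    selfDelim (ofNat Code (p.idxOf false)) (p.drop (p.idxOf false + 1)) z

theorem dom_readsOn (c : Code) (q z : List Bool) (n : ℕ) :
    (readsOn c q z n).Dom ↔ ∀ i < n, 0 ∈ ctrl c (q.take i) z := by
  induction n with
  | zero => simp [readsOn]
  | succ n ih =>
    have h : readsOn c q z (n + 1) = (readsOn c q z n).bind fun _ =>
      (ctrl c (q.take n) z).bind fun v => Part.ofOption (if v = 0 then some 0 else none) := rfl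
    rw [h, Nat.forall_lt_succ_right, ← ih]
    simp only [Part.bind_dom, exists_prop]
    refine and_congr_right fun _ => ⟨?_, ?_⟩
    · rintro ⟨h1, h2⟩
      by_cases h0 : (ctrl c (q.take n) z).get h1 = 0
      · exact h0 ▸ Part.get_mem h1
      · simp [h0] at h2
    · rintro ⟨h1, h2⟩
      exact ⟨h1, by simp [h2]⟩

theorem mem_selfDelim (c : Code) (q z y : List Bool) : y ∈ selfDelim c q z ↔
    (∀ i < q.length, 0 ∈ ctrl c (q.take i) z) ∧ ∃ n, n + 1 ∈ ctrl c q z ∧ decode n = some y := by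
  rw [← dom_readsOn, selfDelim]
  simp only [Part.mem_bind_iff, Part.mem_ofOption, Part.dom_iff_mem]
  constructor
  · rintro ⟨a, ha, v, hv, hy⟩
    refine ⟨⟨a, ha⟩, ?_⟩
    cases v with
    | zero => simp at hy
    | succ n => exact ⟨n, hv, hy⟩
  · rintro ⟨⟨a, ha⟩, n, hv, hy⟩
    exact ⟨a, ha, n + 1, hv, hy⟩

theorem selfDelim_prefix_free (c : Code) (z p q : List Bool) (hp : (selfDelim c p z).Dom)
    (hq : (selfDelim c q z).Dom) (h : p <+: q) : p = q := by
  by_contra hne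
  obtain ⟨y, hy⟩ := Part.dom_iff_mem.1 hp
  obtain ⟨y', hy'⟩ := Part.dom_iff_mem.1 hq
  obtain ⟨-, n, hn, -⟩ := (mem_selfDelim ..).1 hy
  have hl : p.length < q.length :=
    lt_of_le_of_ne h.length_le fun e => hne (h.eq_of_length e)
  have h0 := ((mem_selfDelim ..).1 hy').1 _ hl
  rw [← List.prefix_iff_eq_take.1 h] at h0
  exact absurd (Part.mem_unique hn h0) (Nat.succ_ne_zero n)

theorem partrec_ctrl :
    Partrec fun a : Code × List Bool × List Bool => ctrl a.1 a.2.1 a.2.2 :=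
  Nat.Partrec.Code.eval_part.comp Computable.fst (Computable.encode.comp Computable.snd)

theorem partrec_test {α : Type} [Primcodable α] {g : α → Part ℕ} (hg : Partrec g) :
    Partrec fun a => (g a).bind fun v =>
      Part.ofOption (if v = 0 then some 0 else none : Option ℕ) := by
  have h : Primrec fun v : ℕ => (if v = 0 then some 0 else none : Option ℕ) :=
    Primrec.ite (Primrec.eq.comp Primrec.id (Primrec.const 0))
      (Primrec.const (some 0)) (Primrec.const none)
  exact Partrec.bind hg (Computable.ofOption (h.to_comp.comp Computable.snd))

theorem partrec_readsOn :
    Partrec fun a : Code × List Bool × List Bool => readsOn a.1 a.2.1 a.2.2 a.2.1.length := by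
  have hg : Computable fun a : (Code × List Bool × List Bool) × ℕ × ℕ =>
      (a.1.1, a.1.2.1.take a.2.1, a.1.2.2) :=
    (Computable.fst.comp Computable.fst).pair
      ((Primrec.list_take.to_comp.comp (Computable.fst.comp Computable.snd)
        (Computable.fst.comp (Computable.snd.comp Computable.fst))).pair
        (Computable.snd.comp (Computable.snd.comp Computable.fst)))
  have hc := Partrec.comp partrec_ctrl hg
  have hc' := (partrec_test hc).to₂
  have := Partrec.nat_rec (f := fun a : Code × List Bool × List Bool => a.2.1.length)
    (g := fun _ => Part.some 0)
    (h := fun a p => (ctrl a.1 (a.2.1.take p.1) a.2.2).bind fun v =>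
      Part.ofOption (if v = 0 then some 0 else none))
    (Computable.list_length.comp (Computable.fst.comp Computable.snd))
    (Computable.const 0).partrec hc'
  exact this

theorem partrec_out {α : Type} [Primcodable α] {g : α → Part ℕ} (hg : Partrec g) :
    Partrec fun a => (g a).bind fun v =>
      Part.ofOption (Nat.casesOn v none fun n => decode n : Option (List Bool)) := by
  refine Partrec.bind hg (Computable.ofOption ?_)
  exact Computable.nat_casesOn Computable.snd (Computable.const none)
    (Computable.decode.comp Computable.snd).to₂

theorem partrec_selfDelim :
    Partrec fun a : Code × List Bool × List Bool => selfDelim a.1 a.2.1 a.2.2 :=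
  Partrec.bind partrec_readsOn (Partrec.comp (partrec_out partrec_ctrl) Computable.fst)

theorem isPrefixMachine_stdMachine : IsPrefixMachine stdMachine where
  partrec := by
    have hi : Computable fun a : List Bool × List Bool => a.1.idxOf false :=
      (Primrec.list_idxOf.comp (Primrec.const false) Primrec.fst).to_comp
    refine Partrec.bind (f := fun a : List Bool × List Bool =>
      (Part.ofOption a.1[a.1.idxOf false]? : Part Bool)) ?_ ?_
    · exact Computable.ofOption (Computable.list_getElem?.comp Computable.fst hi)
    · have hg : Computable fun a : List Bool × List Bool =>
          (ofNat Code (a.1.idxOf false), a.1.drop (a.1.idxOf false + 1), a.2) :=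
        ((Computable.ofNat Code).comp hi).pair
          ((Primrec.list_drop.to_comp.comp (Computable.succ.comp hi) Computable.fst).pair
            Computable.snd)
      have h : Partrec fun a : List Bool × List Bool =>
          selfDelim (ofNat Code (a.1.idxOf false)) (a.1.drop (a.1.idxOf false + 1)) a.2 :=
        Partrec.comp partrec_selfDelim hg
      exact h.comp Computable.fst
  prefix_free := by
    intro z p q hp hq h
    obtain ⟨t, rfl⟩ := h
    obtain ⟨hp1, hp2⟩ := hp
    obtain ⟨hq1, hq2⟩ := hq
    have hlt : p.idxOf false < p.length := by
      by_contra hge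
      simp [List.getElem?_eq_none (not_lt.1 hge)] at hp1
    have hmem : false ∈ p := List.idxOf_lt_length_iff.1 hlt
    have hidx : (p ++ t).idxOf false = p.idxOf false := List.idxOf_append_of_mem hmem
    have hdrop : (p ++ t).drop (p.idxOf false + 1) = p.drop (p.idxOf false + 1) ++ t :=
      List.drop_append_of_le_length hlt
    simp only [hidx, hdrop] at hq2
    have := selfDelim_prefix_free _ _ _ _ hp2 hq2 (List.prefix_append _ _)
    simpa using this

theorem isUniversal_stdMachine : IsUniversal stdMachine where
  toIsPrefixMachine := isPrefixMachine_stdMachine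
  universal := by
    intro V hV
    obtain ⟨cV, hcV⟩ := Nat.Partrec.Code.exists_code.1 hV.partrec
    have hcV' : ∀ q z n, n ∈ cV.eval (encode (q, z)) ↔ ∃ y, y ∈ V q z ∧ encode y = n := by
      intro q z n
      rw [hcV]
      simp [Part.mem_map_iff, encodek]
    -- search all extensions of the bits read so far, for all numbers of steps
    let f : List Bool × List Bool → ℕ → Option ℕ := fun a n =>
      (decode (α := ℕ × List Bool) n).bind fun se =>
        (Nat.Partrec.Code.evaln se.1 cV (encode (a.1 ++ se.2, a.2))).map fun v =>
          if se.2 = [] then v + 1 else 0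
    have hite : Primrec fun a : List Bool × ℕ => if a.1 = [] then a.2 + 1 else 0 :=
      Primrec.ite (Primrec.eq.comp Primrec.fst (Primrec.const []))
        (Primrec.succ.comp Primrec.snd) (Primrec.const 0)
    have hev : Computable fun a : (List Bool × List Bool) × ℕ × List Bool =>
        Nat.Partrec.Code.evaln a.2.1 cV (encode (a.1.1 ++ a.2.2, a.1.2)) := by
      have h1 : Computable fun a : (List Bool × List Bool) × ℕ × List Bool =>
          encode (a.1.1 ++ a.2.2, a.1.2) := by
        refine Computable.encode.comp (Computable.pair ?_ ?_)
        · exact Computable.list_append.comp (Computable.fst.comp Computable.fst)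
            (Computable.snd.comp Computable.snd)
        · exact Computable.snd.comp Computable.fst
      exact Nat.Partrec.Code.primrec_evaln.to_comp.comp
        (((Computable.fst.comp Computable.snd).pair (Computable.const cV)).pair h1)
    have key : ∀ g : (List Bool × List Bool) × ℕ × List Bool → Option ℕ, Computable g →
        Computable fun a : ((List Bool × List Bool) × ℕ) × ℕ × List Bool => g (a.1.1, a.2) :=
      fun g hg => hg.comp ((Computable.fst.comp Computable.fst).pair Computable.snd)
    have hf : Computable₂ f := by
      have h2 := key _ hev
      have h3 := hite.to_comp.comp ((Computable.snd.comp (Computable.snd.comp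
        (Computable.fst (α := ((List Bool × List Bool) × ℕ) × ℕ × List Bool) (β := ℕ)))).pair
        Computable.snd)
      have h4 := Computable.option_map h2 h3.to₂
      have h5 : Computable fun a : (List Bool × List Bool) × ℕ =>
          (decode a.2 : Option (ℕ × List Bool)) := Computable.decode.comp Computable.snd
      have h6 := Computable.option_bind h5 h4.to₂
      exact h6
    obtain ⟨c, hc⟩ := Nat.Partrec.Code.exists_code.1 (Partrec.rfindOpt hf)
    have hctrl : ∀ q z, ctrl c q z = Nat.rfindOpt (f (q, z)) := by
      intro q z
      rw [ctrl, hc]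
      simp [encodek, Part.map_id']
    -- if an extension of `q` is valid, then the search ends, and with a valid extension
    have hmem : ∀ q e z, (V (q ++ e) z).Dom → ∃ e' v, v ∈ V (q ++ e') z ∧
        (if e' = [] then encode v + 1 else 0) ∈ ctrl c q z := by
      intro q e z hd
      obtain ⟨y, hy⟩ := Part.dom_iff_mem.1 hd
      obtain ⟨s, hs⟩ := Nat.Partrec.Code.evaln_complete.1 ((hcV' _ _ _).2 ⟨y, hy, rfl⟩)
      have hdom : (Nat.rfindOpt (f (q, z))).Dom := by
        refine Nat.rfindOpt_dom.2 ⟨encode (s, e), if e = [] then encode y + 1 else 0, ?_⟩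
        rw [Option.mem_def] at hs ⊢
        simp only [f, encodek, Option.bind_some, hs, Option.map_some]
      obtain ⟨a, ha⟩ := Part.dom_iff_mem.1 hdom
      obtain ⟨n, hn⟩ := Nat.rfindOpt_spec ha
      simp only [f, Option.mem_def, Option.bind_eq_some_iff, Option.map_eq_some_iff] at hn
      obtain ⟨⟨s', e'⟩, -, w, hw, rfl⟩ := hn
      obtain ⟨v, hv, rfl⟩ := (hcV' _ _ _).1 (Nat.Partrec.Code.evaln_sound hw)
      exact ⟨e', v, hv, by rw [hctrl]; exact ha⟩
    refine ⟨encode c + 1, fun p z y hy => ?_⟩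
    have hdom : (V p z).Dom := Part.dom_iff_mem.2 ⟨y, hy⟩
    have hsd : y ∈ selfDelim c p z := by
      refine (mem_selfDelim ..).2 ⟨fun i hi => ?_, ?_⟩
      · obtain ⟨e', v, hv, h⟩ := hmem (p.take i) (p.drop i) z (by rwa [List.take_append_drop])
        by_cases he : e' = []
        · subst he
          have := hV.prefix_free z (p.take i) p
            (by simpa using Part.dom_iff_mem.2 ⟨v, hv⟩) hdom (List.take_prefix _ _)
          have := congrArg List.length this
          simp at this
          omega
        · simpa [he] using h
      · obtain ⟨e', v, hv, h⟩ := hmem p [] z (by simpa using hdom)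
        have he : e' = [] := by
          have := hV.prefix_free z p (p ++ e') hdom (Part.dom_iff_mem.2 ⟨v, hv⟩)
            (List.prefix_append _ _)
          simpa using this
        subst he
        have hvy : v = y := Part.mem_unique (by simpa using hv) hy
        exact ⟨encode v, by simpa using h, by rw [encodek, hvy]⟩
    refine ⟨List.replicate (encode c) true ++ false :: p, ?_, by simp; omega⟩
    have hidx : (List.replicate (encode c) true ++ false :: p).idxOf false = encode c := by
      rw [List.idxOf_append_of_notMem (by simp)]
      simp
    simp only [stdMachine, hidx]
    simpa [List.drop_append] using hsd

end Existence

/-- The conditional prefix-free Kolmogorov complexity `K (y | z)` with respect to `U`. -/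
noncomputable def kolm (U : List Bool → List Bool →. List Bool) (y z : List Bool) : ℕ :=
  sInf {l | ∃ p : List Bool, y ∈ U p z ∧ p.length = l}

/-! ### The search problem attached to a sampling problem -/

/-- The number `N = m / δ ^ 2.1`, rounded up, of samples, with `δ = 1 / k`. -/
noncomputable def numSamples (m k : ℕ) : ℕ :=
  ⌈(m : ℝ) / (1 / (k : ℝ)) ^ (2.1 : ℝ)⌉₊

/-- The slack `β = 1 + log₂ (1 / δ)`, with `δ = 1 / k`. -/
noncomputable def slack (k : ℕ) : ℝ := 1 + Real.logb 2 (1 / (1 / (k : ℝ)))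

/-- The `i`-th of the `m`-bit strings whose concatenation is `Y`. -/
def block (m : ℕ) (Y : List Bool) (i : ℕ) : List Bool := (Y.drop (i * m)).take m

/-- The set `A` of solutions on input `⟨x, 0 ^ k⟩`: tuples `Y = (y 0, …, y (N - 1))` of `m`-bit
strings (stored as their concatenation) such that
`log₂ (1 / (p (y 0) ⋯ p (y (N - 1)))) ≤ K (Y | x, δ) + β`, where `p` is the mass function
of `D x`. The logarithm is infinite if the product vanishes. -/
def solSet (U : List Bool → List Bool →. List Bool) (S : SamplingProblem)
    (x : List Bool) (k : ℕ) : Set (List Bool) :=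
  {Y | let m := S.len.eval x.length
       let N := numSamples m k
       let P : ℝ := ∏ i ∈ Finset.range N, (S.D x (block m Y i)).toReal
       Y.length = N * m ∧ 0 < P ∧
         Real.logb 2 (1 / P) ≤ (kolm U Y (inst x k) : ℝ) + slack k}

/-- The distribution obtained by running `B` on `⟨x, 0 ^ k⟩` and choosing one of the `N`
coordinates of its output uniformly at random. (`N - 1 + 1` is `N`, except that for `N = 0`, which
happens only if `m = 0`, the empty string is chosen.) -/
noncomputable def coordLaw (B : PTM) (S : SamplingProblem) (x : List Bool) (k : ℕ) :
    PMF (Option (List Bool)) :=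
  (B.outLaw noOracle (inst x k)).bind fun o =>
    (PMF.uniformOfFintype
        (Fin (numSamples (S.len.eval x.length) k - 1 + 1))).map fun i =>
      o.map fun Y => block (S.len.eval x.length) Y i

end SampSearch

open SampSearch

/-!
# Sampling and searching are equivalent

Let `P` be the law of `N` independent samples from `D x`. A tuple `Y` is a solution if its
log-probability `log₂ (1 / P Y)` exceeds its complexity `K (Y | x, δ)` by at most `β`.

*Independent samples are solutions.* A tuple `Y` that is not a solution has
`P Y < 2 ^ (-K Y) * 2 ^ (-β)`, and `∑ 2 ^ (-K Y) ≤ 1` by the Kraft inequality. Hence `P` gives mass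
at most `2 ^ (-β) = δ / 2` to these tuples (`one_sub_le_sum_solSet`). In particular there are
solutions, and a machine that asks a sampler for `N` samples, each with an error of order `δ / N`,
solves the search problem (`one_sub_le_sum_prod`, `inFBPP_of_samplesFrom`).

*A coordinate of a solution is a sample.* Let `Q` be the law of the output of a machine `B` that
solves the search problem. Simulating `B` on all sequences of coins enumerates the outputs of
probability at least `2 ^ (-j)`, of which there are at most `2 ^ j`; so such an output is described
by its number, and `K Y ≤ log₂ (1 / Q Y) + O(log |Y|)` (`exists_kolm_le_logb`, where the constant
depends on `B`, but no bound on the running time of `B` is needed). For a solution `Y` this gives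
`Q Y ≤ e ^ κ * P Y` with `κ = O(log m + log k)` (`toReal_outProb_le`). For an event `T` let `H Y` be
the number of coordinates of `Y` in `T`, centered. Since `E_P [e ^ (l * H)] ≤ e ^ (l ^ 2 * N)`, it
follows that `E_Q [H] / N` is at most `(κ + 1) / (l * N) + l` over the solutions; with `N ≥ m * k ^
2.1` and `l = δ / 2` this is at most `δ` for large `k` (`coordOf_close`). The exponent `2.1 > 2` is
used here, to absorb the logarithms. This bounds the variation distance of a random coordinate from
`D x` by `2 * δ` (`exists_tvDist_coordLaw_le`), and a machine that asks `B` for a solution and outputs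
a coordinate, whose index is drawn with sufficiently many coins, is a sampler (`inSampP_of_solves`).

*The machines.* The two reductions have to be carried out by Turing machines with a polynomial
time bound. Their oracle-free parts are written in a small language `Cmd` of structured programs on
stacks; `Sem` describes the law of the final tape contents and the running time of a program inside
any machine that contains it. Numbers are in unary, and all numerical parameters (such as `N`, which
is found by comparing tenth powers) are values of expressions with bounded sums, which are evaluated
in polynomial time (`Expr.runs_eval`). The resulting machines are those of `exists_sampling_machine`
and `exists_block_machine`, whose output laws are given exactly.
-/


namespace SampSearch

/-! ### The Kraft inequality -/

/-- The Kraft inequality for prefix-free codes. -/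
theorem kraft_prefix_free (F : Finset (List Bool)) (hF : ∀ p ∈ F, ∀ q ∈ F, p <+: q → p = q) :
    ∑ p ∈ F, (1 / 2 : ℝ) ^ p.length ≤ 1 := by
  by_cases h0 : [] ∈ F
  · have : F = {[]} := by
      ext p
      rw [Finset.mem_singleton]
      exact ⟨fun hp => (hF _ h0 _ hp List.nil_prefix).symm, fun hp => hp ▸ h0⟩
    simp [this]
  · have hud : InformationTheory.UniquelyDecodable (F : Set (List Bool)) := by
      intro L₁
      induction L₁ with
      | nil =>
        intro L₂ _ h2 h
        cases L₂ with
        | nil => rfl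
        | cons q L₂ =>
          have hq : q = [] := by simpa using (List.append_eq_nil_iff.1 h.symm).1
          exact absurd (hq ▸ h2 q (by simp)) h0
      | cons p L₁ ih =>
        intro L₂ h1 h2 h
        cases L₂ with
        | nil =>
          have hp : p = [] := by simpa using (List.append_eq_nil_iff.1 h).1
          exact absurd (hp ▸ h1 p (by simp)) h0
        | cons q L₂ =>
          have hpq : p = q := by
            have e : p ++ L₁.flatten = q ++ L₂.flatten := h
            rcases List.prefix_or_prefix_of_prefix (List.prefix_append p _)
              (e ▸ List.prefix_append q _) with h' | h'
            · exact hF _ (h1 p (by simp)) _ (h2 q (by simp)) h'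
            · exact (hF _ (h2 q (by simp)) _ (h1 p (by simp)) h').symm
          subst hpq
          rw [ih L₂ (fun w hw => h1 w (by simp [hw])) (fun w hw => h2 w (by simp [hw]))
            (by simpa using h)]
    simpa using InformationTheory.kraft_mcmillan_inequality hud

/-! ### Self-delimiting codes -/

/-- Add `1` to a number written in binary, the least significant bit first. -/
def increment (l : List Bool) : List Bool :=
  List.recOn l [true] fun b l ih => if b then false :: ih else true :: l

/-- The binary representation of a number, the least significant bit first. -/
def binary (n : ℕ) : List Bool := Nat.rec [] (fun _ l => increment l) n

/-- The value of a binary representation, the least significant bit first. -/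
def binVal (l : List Bool) : ℕ := l.foldr (fun b v => 2 * v + b.toNat) 0

theorem binVal_increment (l : List Bool) : binVal (increment l) = binVal l + 1 := by
  induction l with
  | nil => rfl
  | cons b l ih =>
    cases b
    · simp [increment, binVal]
    · have h : increment (true :: l) = false :: increment l := rfl
      have h2 : ∀ b l, binVal (b :: l) = 2 * binVal l + b.toNat := fun _ _ => rfl
      rw [h, h2, h2, ih]
      simp
      ring

theorem binVal_binary (n : ℕ) : binVal (binary n) = n := by
  induction n with
  | zero => rfl
  | succ n ih => rw [show binary (n + 1) = increment (binary n) from rfl, binVal_increment, ih]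

/-- The hypothesis is slightly weaker than the conclusion, so that it holds also for `[]`. -/
theorem two_pow_length_increment (l : List Bool) (h : 2 ^ l.length ≤ 2 * binVal l + 1) :
    2 ^ (increment l).length ≤ 2 * binVal (increment l) := by
  induction l with
  | nil => decide
  | cons b l ih =>
    have h2 : ∀ b l, binVal (b :: l) = 2 * binVal l + b.toNat := fun _ _ => rfl
    rw [h2, List.length_cons, pow_succ] at h
    cases b
    · have h3 : increment (false :: l) = true :: l := rfl
      rw [h3, h2, List.length_cons, pow_succ]
      simp only [Bool.toNat_false, Bool.toNat_true] at h ⊢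
      omega
    · have h3 : increment (true :: l) = false :: increment l := rfl
      simp only [Bool.toNat_true] at h
      have := ih (by omega)
      rw [h3, h2, List.length_cons, pow_succ]
      simp only [Bool.toNat_false]
      omega

theorem two_pow_length_binary (n : ℕ) : 2 ^ (binary n).length ≤ 2 * n + 1 := by
  induction n with
  | zero => decide
  | succ n ih =>
    have h := two_pow_length_increment (binary n) (by rw [binVal_binary]; exact ih)
    rw [binVal_increment, binVal_binary] at h
    exact h.trans (by omega)

theorem primrec_increment : Primrec increment := by
  have h : Primrec₂ fun (_ : List Bool) (p : Bool × List Bool × List Bool) =>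
      if p.1 = true then false :: p.2.2 else true :: p.2.1 := by
    refine Primrec.ite (Primrec.eq.comp (Primrec.fst.comp Primrec.snd) (Primrec.const true)) ?_ ?_
    · exact Primrec.list_cons.comp (Primrec.const false)
        (Primrec.snd.comp (Primrec.snd.comp Primrec.snd))
    · exact Primrec.list_cons.comp (Primrec.const true)
        (Primrec.fst.comp (Primrec.snd.comp Primrec.snd))
  exact Primrec.list_rec Primrec.id (Primrec.const [true]) h

theorem primrec_binary : Primrec binary :=
  Primrec.nat_rec₁ _ (primrec_increment.comp Primrec.snd).to₂

/-- A self-delimiting code of `w`, longer than `w` by a logarithmic term only. -/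
def selfCode (w : List Bool) : List Bool := pair (binary w.length) w

theorem length_pair (u v : List Bool) : (pair u v).length = 2 * u.length + v.length + 1 := by
  induction u with
  | nil => simp [pair]
  | cons b u ih =>
    have : pair (b :: u) v = true :: b :: pair u v := by simp [pair]
    rw [this]
    simp only [List.length_cons, ih]
    ring

theorem pair_prefix {u v u' v' : List Bool} (h : pair u v <+: pair u' v') :
    u = u' ∧ v <+: v' := by
  have hc : ∀ b u v, pair (b :: u) v = true :: b :: pair u v := by intro b u v; simp [pair]
  have hn : ∀ v, pair [] v = false :: v := by intro v; simp [pair]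
  induction u generalizing u' with
  | nil =>
    cases u' with
    | nil => simpa [hn] using h
    | cons b u' => simp [hn, hc] at h
  | cons b u ih =>
    cases u' with
    | nil => simp [hn, hc] at h
    | cons b' u' =>
      simp only [hc, List.cons_prefix_cons, true_and] at h
      obtain ⟨h1, h2⟩ := ih h.2
      exact ⟨by rw [h.1, h1], h2⟩

theorem selfCode_prefix {w w' : List Bool} (h : selfCode w <+: selfCode w') : w = w' := by
  obtain ⟨h1, h2⟩ := pair_prefix h
  refine h2.eq_of_length ?_
  rw [← binVal_binary w.length, h1, binVal_binary]

theorem primrec_selfCode : Primrec selfCode := by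
  have h : Primrec fun w : List Bool => (binary w.length).flatMap fun b => [true, b] :=
    Primrec.list_flatMap (primrec_binary.comp Primrec.list_length)
      (Primrec.list_cons.comp (Primrec.const true)
        (Primrec.list_cons.comp Primrec.snd (Primrec.const []))).to₂
  exact Primrec.list_append.comp h (Primrec.list_cons.comp (Primrec.const false) Primrec.id)

/-- The string with a given self-delimiting code, found by exhaustive search. -/
def selfDecode (p : List Bool) : Part (List Bool) :=
  Nat.rfindOpt fun n => (Encodable.decode (α := List Bool) n).bind fun w =>
    if selfCode w = p then some w else none

theorem mem_selfDecode {p w : List Bool} : w ∈ selfDecode p ↔ selfCode w = p := by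
  constructor
  · intro h
    obtain ⟨n, hn⟩ := Nat.rfindOpt_spec h
    rw [Option.mem_def, Option.bind_eq_some_iff] at hn
    obtain ⟨w', -, hw'⟩ := hn
    split_ifs at hw' with hc
    simpa [← Option.some_injective _ hw'] using hc
  · rintro rfl
    have hd : (selfDecode (selfCode w)).Dom :=
      Nat.rfindOpt_dom.2 ⟨Encodable.encode w, w, by simp [Encodable.encodek]⟩
    obtain ⟨a, ha⟩ := Part.dom_iff_mem.1 hd
    obtain ⟨n, hn⟩ := Nat.rfindOpt_spec ha
    rw [Option.mem_def, Option.bind_eq_some_iff] at hn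
    obtain ⟨w', -, hw'⟩ := hn
    split_ifs at hw' with hc
    have e : w' = w := selfCode_prefix (hc ▸ List.prefix_rfl)
    rw [← Option.some_injective _ hw', e] at ha
    exact ha

theorem partrec_selfDecode : Partrec selfDecode := by
  refine Partrec.rfindOpt ?_
  have h : Primrec₂ fun (p : List Bool × ℕ) (w : List Bool) =>
      if selfCode w = p.1 then some w else none :=
    Primrec.ite (Primrec.eq.comp (primrec_selfCode.comp Primrec.snd)
      (Primrec.fst.comp Primrec.fst)) (Primrec.option_some.comp Primrec.snd) (Primrec.const none)
  exact (Primrec.option_bind (Primrec.decode.comp Primrec.snd) h).to_comp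

/-! ### Kolmogorov complexity -/

variable {U : List Bool → List Bool →. List Bool}

theorem kolm_le {p y z : List Bool} (h : y ∈ U p z) : kolm U y z ≤ p.length :=
  Nat.sInf_le ⟨p, h, rfl⟩

/-- A partial computable function of `w` and of the condition yields a bound on complexities. -/
theorem exists_program (hU : IsUniversal U) {g : List Bool → List Bool →. List Bool}
    (hg : Partrec₂ g) : ∃ c : ℕ, ∀ w z y, y ∈ g w z →
      ∃ q, y ∈ U q z ∧ q.length ≤ w.length + 2 * (binary w.length).length + c := by
  have hV : IsPrefixMachine fun p z => (selfDecode p).bind fun w => g w z := by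
    refine ⟨?_, ?_⟩
    · refine Partrec.bind (partrec_selfDecode.comp Computable.fst) ?_
      exact Partrec.comp hg (Computable.snd.pair (Computable.snd.comp Computable.fst))
    · intro z p q hp hq hpq
      obtain ⟨w, hw⟩ := Part.dom_iff_mem.1 hp.1
      obtain ⟨w', hw'⟩ := Part.dom_iff_mem.1 hq.1
      rw [mem_selfDecode] at hw hw'
      subst hw hw'
      rw [selfCode_prefix hpq]
  obtain ⟨c, hc⟩ := hU.universal _ hV
  refine ⟨c + 1, fun w z y hy => ?_⟩
  obtain ⟨q, hq, hl⟩ := hc (selfCode w) z y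
    (Part.mem_bind_iff.2 ⟨w, mem_selfDecode.2 rfl, hy⟩)
  refine ⟨q, hq, hl.trans (le_of_eq ?_)⟩
  rw [selfCode, length_pair]
  ring

/-- A string describes itself. -/
theorem exists_program_self (hU : IsUniversal U) : ∃ c : ℕ, ∀ y z,
    ∃ q, y ∈ U q z ∧ q.length ≤ y.length + 2 * (binary y.length).length + c := by
  obtain ⟨c, hc⟩ := exists_program hU (g := fun w _ => Part.some w)
    (Computable.fst (α := List Bool) (β := List Bool)).partrec
  exact ⟨c, fun y z => hc y z y (Part.mem_some y)⟩

theorem exists_shortest_program (hU : IsUniversal U) (y z : List Bool) :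
    ∃ q, y ∈ U q z ∧ q.length = kolm U y z := by
  obtain ⟨c, hc⟩ := exists_program_self hU
  obtain ⟨q, hq, -⟩ := hc y z
  exact Nat.sInf_mem (s := {l | ∃ p : List Bool, y ∈ U p z ∧ p.length = l}) ⟨_, q, hq, rfl⟩

/-- Shortest programs of distinct strings are distinct, and form a prefix-free code. -/
theorem sum_two_pow_neg_kolm_le (hU : IsUniversal U) (z : List Bool) (F : Finset (List Bool)) :
    ∑ y ∈ F, (1 / 2 : ℝ) ^ kolm U y z ≤ 1 := by
  choose q hq hl using fun y => exists_shortest_program hU y z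
  have hinj : Function.Injective q := fun y y' h => Part.mem_unique (hq y) (h ▸ hq y')
  have h := kraft_prefix_free (F.image q) fun p hp p' hp' h => by
    obtain ⟨y, -, rfl⟩ := Finset.mem_image.1 hp
    obtain ⟨y', -, rfl⟩ := Finset.mem_image.1 hp'
    exact hU.prefix_free z _ _ (Part.dom_iff_mem.2 ⟨_, hq y⟩) (Part.dom_iff_mem.2 ⟨_, hq y'⟩) h
  rw [Finset.sum_image fun _ _ _ _ h => hinj h] at h
  simpa only [hl] using h

theorem eval_poly_mono (p : Polynomial ℕ) : Monotone fun n => p.eval n := by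
  intro a b hab
  simp only [Polynomial.eval_eq_sum_range]
  exact Finset.sum_le_sum fun i _ => Nat.mul_le_mul_left _ (Nat.pow_le_pow_left hab i)

/-! ### Tuples of strings -/

/-- The set of all strings of length `n`. -/
def strings (n : ℕ) : Finset (List Bool) :=
  (Finset.univ : Finset (Fin n → Bool)).map ⟨List.ofFn, List.ofFn_injective⟩

@[simp]
theorem mem_strings {n : ℕ} {y : List Bool} : y ∈ strings n ↔ y.length = n := by
  rw [strings, Finset.mem_map]
  constructor
  · rintro ⟨v, -, rfl⟩
    exact List.length_ofFn
  · rintro rfl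
    exact ⟨y.get, Finset.mem_univ _, List.ofFn_get y⟩

theorem sum_strings_add {M : Type*} [AddCommMonoid M] (a b : ℕ) (f : List Bool → M) :
    ∑ Y ∈ strings (a + b), f Y = ∑ Y ∈ strings a, ∑ y ∈ strings b, f (Y ++ y) := by
  rw [← Finset.sum_product']
  refine Finset.sum_nbij' (fun Y => (Y.take a, Y.drop a)) (fun p => p.1 ++ p.2) ?_ ?_ ?_ ?_ ?_
  · intro Y hY
    simp only [mem_strings] at hY
    simp [hY]
  · rintro ⟨Y, y⟩ h
    simp only [Finset.mem_product, mem_strings] at h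
    simp [h]
  · intro Y _
    simp
  · rintro ⟨Y, y⟩ h
    simp only [Finset.mem_product, mem_strings] at h
    simp [← h.1]
  · intro Y _
    simp

theorem block_append_of_lt {m N i : ℕ} {Y y : List Bool} (hY : Y.length = N * m) (hi : i < N) :
    block m (Y ++ y) i = block m Y i := by
  have h : i * m + m ≤ N * m := by
    calc i * m + m = (i + 1) * m := by ring
      _ ≤ N * m := Nat.mul_le_mul_right _ hi
  rw [block, block, List.drop_append_of_le_length (by omega),
    List.take_append_of_le_length (by rw [List.length_drop]; omega)]

theorem block_append_self {m N : ℕ} {Y y : List Bool} (hY : Y.length = N * m)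
    (hy : y.length = m) : block m (Y ++ y) N = y := by
  rw [block, ← hY, List.drop_left, ← hy, List.take_length]

theorem prod_block_append {M : Type*} [CommMonoid M] {m N : ℕ} {Y y : List Bool}
    (hY : Y.length = N * m) (hy : y.length = m) (f : List Bool → M) :
    ∏ i ∈ Finset.range (N + 1), f (block m (Y ++ y) i) =
      (∏ i ∈ Finset.range N, f (block m Y i)) * f y := by
  rw [Finset.prod_range_succ, block_append_self hY hy]
  congr 1
  exact Finset.prod_congr rfl fun i hi => by
    rw [block_append_of_lt hY (Finset.mem_range.1 hi)]

/-- The expectation of a product over independent coordinates. -/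
theorem sum_prod_block {R : Type*} [CommSemiring R] (m N : ℕ) (f : List Bool → R) :
    ∑ Y ∈ strings (N * m), ∏ i ∈ Finset.range N, f (block m Y i) =
      (∑ y ∈ strings m, f y) ^ N := by
  induction N with
  | zero =>
    have h : strings 0 = {[]} := by ext; simp
    simp [h]
  | succ N ih =>
    rw [Nat.succ_mul, sum_strings_add, pow_succ, ← ih, Finset.sum_mul]
    refine Finset.sum_congr rfl fun Y hY => ?_
    rw [Finset.mul_sum]
    exact Finset.sum_congr rfl fun y hy =>
      prod_block_append (mem_strings.1 hY) (mem_strings.1 hy) f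

/-! ### The search problem -/

/-- The probability of `y` in a sampling problem. -/
noncomputable def SamplingProblem.prob (S : SamplingProblem) (x y : List Bool) : ℝ :=
  (S.D x y).toReal

/-- The probability of the `N`-tuple `Y` under independent sampling. -/
noncomputable def SamplingProblem.tupleProb (S : SamplingProblem) (x : List Bool) (N : ℕ)
    (Y : List Bool) : ℝ :=
  ∏ i ∈ Finset.range N, S.prob x (block (S.len.eval x.length) Y i)

variable {U : List Bool → List Bool →. List Bool} {S : SamplingProblem}

theorem SamplingProblem.prob_nonneg (x y : List Bool) : 0 ≤ S.prob x y := ENNReal.toReal_nonneg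

theorem SamplingProblem.tupleProb_nonneg (x : List Bool) (N : ℕ) (Y : List Bool) :
    0 ≤ S.tupleProb x N Y := Finset.prod_nonneg fun _ _ => SamplingProblem.prob_nonneg _ _

theorem SamplingProblem.apply_eq_zero {x y : List Bool} (h : y ∉ strings (S.len.eval x.length)) :
    S.D x y = 0 := by
  by_contra h0
  exact h (mem_strings.2 (S.length_eq x y ((PMF.mem_support_iff _ _).2 h0)))

theorem SamplingProblem.sum_apply (x : List Bool) :
    ∑ y ∈ strings (S.len.eval x.length), S.D x y = 1 := by
  rw [← (S.D x).tsum_coe, tsum_eq_sum fun y hy => SamplingProblem.apply_eq_zero hy]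

theorem SamplingProblem.sum_prob (x : List Bool) :
    ∑ y ∈ strings (S.len.eval x.length), S.prob x y = 1 := by
  simp only [SamplingProblem.prob]
  rw [← ENNReal.toReal_sum fun y _ => PMF.apply_ne_top _ _, SamplingProblem.sum_apply,
    ENNReal.toReal_one]

theorem SamplingProblem.sum_tupleProb (x : List Bool) (N : ℕ) :
    ∑ Y ∈ strings (N * S.len.eval x.length), S.tupleProb x N Y = 1 := by
  simp only [SamplingProblem.tupleProb]
  rw [sum_prod_block, SamplingProblem.sum_prob, one_pow]

theorem mem_solSet {x Y : List Bool} {k : ℕ} : Y ∈ solSet U S x k ↔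
    Y ∈ strings (numSamples (S.len.eval x.length) k * S.len.eval x.length) ∧
      0 < S.tupleProb x (numSamples (S.len.eval x.length) k) Y ∧
      Real.logb 2 (1 / S.tupleProb x (numSamples (S.len.eval x.length) k) Y) ≤
        (kolm U Y (inst x k) : ℝ) + slack k := by
  rw [mem_strings]
  rfl

theorem two_rpow_neg_slack {k : ℕ} (hk : 1 ≤ k) : (2 : ℝ) ^ (-slack k) = 1 / (2 * k) := by
  have hk0 : (0 : ℝ) < k := by exact_mod_cast hk
  rw [slack, one_div_one_div, neg_add, Real.rpow_add two_pos, Real.rpow_neg two_pos.le,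
    Real.rpow_neg two_pos.le, Real.rpow_logb two_pos (by norm_num) hk0, Real.rpow_one]
  field_simp

open Classical in
/-- Independent samples form a solution with high probability: by the Kraft inequality, at most a
fraction `2 ^ (-β)` of the mass is on tuples that have a description shorter by `β` than their
log-probability. -/
theorem one_sub_le_sum_solSet (hU : IsUniversal U) (S : SamplingProblem) (x : List Bool) {k : ℕ}
    (hk : 1 ≤ k) :
    1 - 1 / (2 * (k : ℝ)) ≤
      ∑ Y ∈ strings (numSamples (S.len.eval x.length) k * S.len.eval x.length) with
        Y ∈ solSet U S x k, S.tupleProb x (numSamples (S.len.eval x.length) k) Y := by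
  set m := S.len.eval x.length
  set N := numSamples m k
  have h1 := SamplingProblem.sum_tupleProb (S := S) x N
  rw [← Finset.sum_filter_add_sum_filter_not _ fun Y => Y ∈ solSet U S x k] at h1
  have h2 : ∑ Y ∈ strings (N * m) with Y ∉ solSet U S x k, S.tupleProb x N Y ≤
      1 / (2 * k) * ∑ Y ∈ strings (N * m) with Y ∉ solSet U S x k,
        (1 / 2 : ℝ) ^ kolm U Y (inst x k) := by
    rw [Finset.mul_sum]
    refine Finset.sum_le_sum fun Y hY => ?_
    rw [Finset.mem_filter, mem_solSet] at hY
    rcases (SamplingProblem.tupleProb_nonneg (S := S) x N Y).eq_or_lt with h0 | h0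
    · rw [← h0]
      positivity
    · -- `Y` is no solution, hence `P Y < 2 ^ (-K Y) * 2 ^ (-β)`
      have h3 : (kolm U Y (inst x k) : ℝ) + slack k < Real.logb 2 (1 / S.tupleProb x N Y) := by
        by_contra! h
        exact hY.2 ⟨hY.1, h0, h⟩
      rw [one_div, Real.logb_inv, lt_neg, Real.logb_lt_iff_lt_rpow one_lt_two h0, neg_add,
        Real.rpow_add two_pos, two_rpow_neg_slack hk, Real.rpow_neg two_pos.le,
        Real.rpow_natCast] at h3
      rw [one_div_pow, mul_comm]
      simpa using h3.le
  have h3 := sum_two_pow_neg_kolm_le hU (inst x k)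
    ((strings (N * m)).filter fun Y => Y ∉ solSet U S x k)
  have h4 : (0 : ℝ) ≤ 1 / (2 * k) := by positivity
  have h5 := mul_le_mul_of_nonneg_left h3 h4
  linarith

theorem solSet_nonempty (hU : IsUniversal U) (S : SamplingProblem) (x : List Bool) {k : ℕ}
    (hk : 1 ≤ k) : (solSet U S x k).Nonempty := by
  classical
  have h := one_sub_le_sum_solSet hU S x hk
  have hk1 : (1 : ℝ) ≤ k := by exact_mod_cast hk
  have h1 : 1 / (2 * (k : ℝ)) < 1 := by
    rw [div_lt_one (by positivity)]
    linarith
  by_contra hne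
  rw [Set.not_nonempty_iff_eq_empty] at hne
  simp only [hne, Set.mem_empty_iff_false, Finset.filter_false, Finset.sum_empty] at h
  linarith

theorem le_numSamples {m k : ℕ} (hk : 1 ≤ k) : (m : ℝ) * (k : ℝ) ^ (2.1 : ℝ) ≤ numSamples m k := by
  refine le_trans (le_of_eq ?_) (Nat.le_ceil _)
  have hk0 : (0 : ℝ) < k := by exact_mod_cast hk
  rw [one_div, Real.inv_rpow hk0.le, div_inv_eq_mul]

theorem numSamples_le {m k : ℕ} (hk : 1 ≤ k) : numSamples m k ≤ m * k ^ 3 := by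
  have hk1 : (1 : ℝ) ≤ k := by exact_mod_cast hk
  have hk0 : (0 : ℝ) < k := by positivity
  rw [numSamples, Nat.ceil_le, one_div, Real.inv_rpow hk0.le, div_inv_eq_mul]
  push_cast
  rw [← Real.rpow_natCast (k : ℝ) 3]
  gcongr
  norm_num

/-- The search problem whose solutions are the tuples that look like independent samples. -/
noncomputable def searchProblem (hU : IsUniversal U) (S : SamplingProblem) : SearchProblem where
  sol := solSet U S
  len n k := numSamples (S.len.eval n) k * S.len.eval n
  len_le := by
    refine ⟨S.len ^ 2 * Polynomial.X ^ 3, fun n k hk => ?_⟩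
    have h1 : S.len.eval n ≤ S.len.eval (n + k) := eval_poly_mono _ (Nat.le_add_right _ _)
    simp only [Polynomial.eval_mul, Polynomial.eval_pow, Polynomial.eval_X]
    calc numSamples (S.len.eval n) k * S.len.eval n
        ≤ S.len.eval n * k ^ 3 * S.len.eval n := Nat.mul_le_mul_right _ (numSamples_le hk)
      _ = S.len.eval n ^ 2 * k ^ 3 := by ring
      _ ≤ S.len.eval (n + k) ^ 2 * (n + k) ^ 3 := by gcongr; omega
  length_eq := fun _ _ _ _ h => h.1
  nonempty := fun x _ hk => solSet_nonempty hU S x hk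

/-! ### Enumerations and complexity -/

/-- The distinct values among the first `n` terms of `f`, in the order of appearance. -/
def distinct {α : Type*} [DecidableEq α] (f : ℕ → Option α) (n : ℕ) : List α :=
  Nat.rec [] (fun i L => Option.casesOn (f i) L fun y => if y ∈ L then L else L ++ [y]) n

section Distinct

variable {α : Type*} [DecidableEq α] (f : ℕ → Option α)

theorem distinct_succ (n : ℕ) : distinct f (n + 1) = distinct f n ∨
    ∃ y, f n = some y ∧ y ∉ distinct f n ∧ distinct f (n + 1) = distinct f n ++ [y] := by
  have h : distinct f (n + 1) = Option.casesOn (f n) (distinct f n) fun y =>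
    if y ∈ distinct f n then distinct f n else distinct f n ++ [y] := rfl
  rw [h]
  rcases f n with - | y
  · exact Or.inl rfl
  · by_cases hy : y ∈ distinct f n
    · exact Or.inl (if_pos hy)
    · exact Or.inr ⟨y, rfl, hy, if_neg hy⟩

theorem nodup_distinct (n : ℕ) : (distinct f n).Nodup := by
  induction n with
  | zero => exact List.nodup_nil
  | succ n ih =>
    rcases distinct_succ f n with h | ⟨y, -, hy, h⟩
    · rwa [h]
    · rw [h, List.nodup_append_comm]
      exact List.nodup_cons.2 ⟨by simpa using hy, by simpa using ih⟩

theorem exists_of_mem_distinct {n : ℕ} {y : α} (h : y ∈ distinct f n) : ∃ i, f i = some y := by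
  induction n with
  | zero => exact absurd h List.not_mem_nil
  | succ n ih =>
    rcases distinct_succ f n with h' | ⟨y', hf, -, h'⟩
    · exact ih (h' ▸ h)
    · rw [h', List.mem_append, List.mem_singleton] at h
      rcases h with h | rfl
      · exact ih h
      · exact ⟨n, hf⟩

theorem distinct_prefix {n n' : ℕ} (h : n ≤ n') : distinct f n <+: distinct f n' := by
  induction h with
  | refl => exact List.prefix_rfl
  | step _ ih =>
    refine ih.trans ?_
    rcases distinct_succ f _ with h | ⟨y, -, -, h⟩
    · rw [h]
    · rw [h]
      exact List.prefix_append _ _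

theorem mem_distinct_succ {n : ℕ} {y : α} (h : f n = some y) : y ∈ distinct f (n + 1) := by
  have h' : distinct f (n + 1) = Option.casesOn (f n) (distinct f n) fun y =>
    if y ∈ distinct f n then distinct f n else distinct f n ++ [y] := rfl
  rw [h', h]
  by_cases hy : y ∈ distinct f n
  · simp [hy]
  · simp [hy]

end Distinct

theorem primrec_distinct {α β : Type*} [Primcodable α] [Primcodable β] [DecidableEq α]
    {f : β → ℕ → Option α} (hf : Primrec₂ f) : Primrec₂ fun b n => distinct (f b) n := by
  have hmem : PrimrecPred fun q : (β × ℕ × List α) × α => q.2 ∈ q.1.2.2 := by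
    have h := (PrimrecRel.exists_mem_list (Primrec.eq (α := α))).comp
      (Primrec.snd.comp (Primrec.snd.comp (Primrec.fst (α := β × ℕ × List α) (β := α))))
      Primrec.snd
    exact h.of_eq fun q => by simp
  have hL : Primrec fun q : (β × ℕ × List α) × α => q.1.2.2 :=
    Primrec.snd.comp (Primrec.snd.comp Primrec.fst)
  have hs : Primrec₂ fun (p : β × ℕ × List α) (y : α) =>
      if y ∈ p.2.2 then p.2.2 else p.2.2 ++ [y] :=
    Primrec.ite hmem hL (Primrec.list_append.comp hL
      (Primrec.list_cons.comp Primrec.snd (Primrec.const [])))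
  have hg : Primrec₂ fun (b : β) (p : ℕ × List α) => (Option.casesOn (f b p.1) p.2
      fun y => if y ∈ p.2 then p.2 else p.2 ++ [y] : List α) :=
    Primrec.option_casesOn (hf.comp Primrec.fst (Primrec.fst.comp Primrec.snd))
      (Primrec.snd.comp Primrec.snd) hs
  exact Primrec.nat_rec (Primrec.const []) hg

theorem primrec_binVal : Primrec binVal := by
  have hb : Primrec fun b : Bool => b.toNat := Primrec.dom_finite _
  have h : Primrec₂ fun (_ : List Bool) (p : Bool × ℕ) => 2 * p.2 + p.1.toNat :=
    Primrec.nat_add.comp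
      (Primrec.nat_mul.comp (Primrec.const 2) (Primrec.snd.comp Primrec.snd))
      (hb.comp (Primrec.fst.comp Primrec.snd))
  exact Primrec.list_foldr Primrec.id (Primrec.const 0) h

/-- Every position below `2 ^ j` has a name of exactly `j` bits. -/
theorem exists_binVal_eq {j i : ℕ} (h : i < 2 ^ j) : ∃ w, w.length = j ∧ binVal w = i := by
  induction j generalizing i with
  | zero =>
    refine ⟨[], rfl, ?_⟩
    have : i = 0 := by simpa using h
    rw [this]
    rfl
  | succ j ih =>
    obtain ⟨w, hw, hi⟩ := ih (show i / 2 < 2 ^ j by rw [pow_succ] at h; omega)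
    refine ⟨decide (i % 2 = 1) :: w, by simp [hw], ?_⟩
    have h2 : binVal (decide (i % 2 = 1) :: w) =
      2 * binVal w + (decide (i % 2 = 1)).toNat := rfl
    rw [h2, hi]
    rcases Nat.mod_two_eq_zero_or_one i with h' | h' <;> simp [h'] <;> omega

variable {U : List Bool → List Bool →. List Bool}

/-- The elements of uniformly enumerable sets of size at most `2 ^ j` have complexity little more
than `j`: an element is described by its position in the enumeration, written with `j` bits. -/
theorem exists_kolm_le_of_card_le (hU : IsUniversal U)
    {f : List Bool × ℕ → ℕ → Option (List Bool)} (hf : Primrec₂ f)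
    (hcard : ∀ z j (F : Finset (List Bool)), (∀ y ∈ F, ∃ n, f (z, j) n = some y) →
      F.card ≤ 2 ^ j) :
    ∃ c : ℕ, ∀ z j n y, f (z, j) n = some y →
      kolm U y z ≤ j + 2 * (binary j).length + c := by
  have hd := primrec_distinct hf
  have hp : Primrec fun q : (List Bool × List Bool) × ℕ =>
      (distinct (f (q.1.2, q.1.1.length)) q.2)[binVal q.1.1]? :=
    Primrec.list_getElem?.comp
      (hd.comp ((Primrec.snd.comp Primrec.fst).pair
        (Primrec.list_length.comp (Primrec.fst.comp Primrec.fst))) Primrec.snd)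
      (primrec_binVal.comp (Primrec.fst.comp Primrec.fst))
  have hg : Partrec₂ fun w z : List Bool => Nat.rfindOpt fun n =>
      (distinct (f (z, w.length)) n)[binVal w]? := Partrec.rfindOpt hp.to_comp
  obtain ⟨c, hc⟩ := exists_program hU hg
  refine ⟨c, fun z j n y hy => ?_⟩
  have hmem := mem_distinct_succ (f (z, j)) hy
  set L := distinct (f (z, j)) (n + 1) with hL
  have hlen : L.length ≤ 2 ^ j := by
    rw [← List.toFinset_card_of_nodup (nodup_distinct _ _)]
    exact hcard z j _ fun y hy => exists_of_mem_distinct _ (List.mem_toFinset.1 hy)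
  obtain ⟨i, hi, hiy⟩ := List.mem_iff_getElem.1 hmem
  obtain ⟨w, hw, hwi⟩ := exists_binVal_eq (hi.trans_le hlen)
  obtain ⟨q, hq, hql⟩ := hc w z y ((Nat.rfindOpt_mono fun {a m n} hmn ha => by
    obtain ⟨t, ht⟩ := distinct_prefix (f (z, w.length)) hmn
    rw [Option.mem_def] at ha ⊢
    rw [← ht, List.getElem?_append_left (List.getElem?_eq_some_iff.1 ha).1, ha]).2
      ⟨n + 1, by rw [hw, hwi, Option.mem_def, ← hL, List.getElem?_eq_getElem hi, hiy]⟩)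
  exact (kolm_le hq).trans (hw ▸ hql)

/-! ### Simulation of a machine on all coin sequences -/

/-- The number of symbols popped from a tape, and the symbols pushed. -/
def TapeAct.code : TapeAct → ℕ × List Bool
  | .keep => (0, [])
  | .pop => (1, [])
  | .push b => (0, [b])

theorem TapeAct.apply_eq (a : TapeAct) (l : List Bool) :
    a.apply l = a.code.2 ++ l.drop a.code.1 := by
  cases a <;> simp [TapeAct.apply, TapeAct.code]

namespace PTM

open Classical in
/-- One step with a given coin, in the absence of an oracle. -/
noncomputable def coinStep (M : PTM) (c : M.Cfg) (coin : Bool) : Option M.Cfg :=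
  if c.1 = M.halt then some c
  else if c.1 = M.ask then none
  else some ((M.δ c.1 (fun i => (c.2 i).head?) coin).1,
    fun i => ((M.δ c.1 (fun i => (c.2 i).head?) coin).2 i).apply (c.2 i))

/-- The configurations after `t` steps on input `w`, for all sequences of coins. -/
noncomputable def front (M : PTM) (w : List Bool) (t : ℕ) : List M.Cfg :=
  Nat.rec [M.init w]
    (fun _ L => L.flatMap fun c => [true, false].filterMap fun b => M.coinStep c b) t

/-- The outputs after `t` steps on input `w`, for all sequences of coins. -/
noncomputable def outs (M : PTM) (w : List Bool) (t : ℕ) : List (List Bool) :=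
  (M.front w t).filterMap fun c => M.result (some c)

theorem step_noOracle (M : PTM) (c : M.Cfg) :
    M.step noOracle c = (PMF.uniformOfFintype Bool).map (M.coinStep c) := by
  unfold step coinStep
  split_ifs with h1 h2
  · exact (PMF.map_const _ _).symm
  · simp only [noOracle, PMF.pure_map, Option.map_none]
    exact (PMF.map_const _ _).symm
  · rfl

/-- The law of the configuration after `t` steps is the uniform law on the `2 ^ t` sequences of
coins, of which `front` omits those that get stuck. -/
theorem tsum_run_mul (M : PTM) (w : List Bool) (t : ℕ) (f : Option M.Cfg → ℝ≥0∞)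
    (hf : f none = 0) :
    ∑' o, M.run noOracle w t o * f o =
      ((M.front w t).map fun c => f (some c)).sum / 2 ^ t := by
  induction t generalizing f with
  | zero =>
    rw [run, tsum_eq_single (some (M.init w)) fun o ho => by
      rw [PMF.pure_apply_of_ne _ _ ho, zero_mul]]
    simp [front]
  | succ t ih =>
    have h1 : ∑' o, M.run noOracle w (t + 1) o * f o =
        ∑' o, M.run noOracle w t o * ∑' o', M.stepOpt noOracle o o' * f o' := by
      simp only [run, PMF.bind_apply, ← ENNReal.tsum_mul_right, ← ENNReal.tsum_mul_left]
      rw [ENNReal.tsum_comm]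
      simp only [mul_assoc]
    have h2 : ∑' o', M.stepOpt noOracle none o' * f o' = 0 := by
      rw [ENNReal.tsum_eq_zero]
      rintro (- | c)
      · rw [hf, mul_zero]
      · simp [stepOpt]
    have h3 : ∀ c, ∑' o', M.stepOpt noOracle (some c) o' * f o' =
        (f (M.coinStep c true) + f (M.coinStep c false)) / 2 := by
      intro c
      have e : M.stepOpt noOracle (some c) =
          (PMF.uniformOfFintype Bool).bind fun b => PMF.pure (M.coinStep c b) := by
        rw [stepOpt, step_noOracle]
        rfl
      simp only [e, PMF.bind_apply, ← ENNReal.tsum_mul_right]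
      rw [ENNReal.tsum_comm, tsum_bool]
      have e2 : ∀ b, ∑' o', PMF.uniformOfFintype Bool b * PMF.pure (M.coinStep c b) o' * f o' =
          f (M.coinStep c b) / 2 := by
        intro b
        rw [tsum_eq_single (M.coinStep c b) fun o ho => by
          rw [PMF.pure_apply_of_ne _ _ ho, mul_zero, zero_mul]]
        simp [mul_comm, div_eq_mul_inv]
      rw [e2, e2, ENNReal.div_add_div_same, add_comm]
    rw [h1, ih _ h2]
    have h4 : (M.front w (t + 1)) =
      (M.front w t).flatMap fun c => [true, false].filterMap fun b => M.coinStep c b := rfl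
    rw [h4, List.map_flatMap, List.flatMap_def, List.sum_flatten, List.map_map, pow_succ]
    simp only [h3, Function.comp_def]
    have h5 : ∀ c, (([true, false].filterMap fun b => M.coinStep c b).map
        fun c => f (some c)).sum = f (M.coinStep c true) + f (M.coinStep c false) := by
      intro c
      rcases h : M.coinStep c true with - | a <;> rcases h' : M.coinStep c false with - | b <;>
        simp [h, h', hf]
    simp only [h5, div_eq_mul_inv, List.sum_map_mul_right]
    rw [mul_assoc, ENNReal.mul_inv (by simp) (by simp), mul_comm (2⁻¹ : ℝ≥0∞)]

theorem map_result_apply (M : PTM) (w y : List Bool) (t : ℕ) :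
    ((M.run noOracle w t).map M.result) (some y) =
      (((M.outs w t).filter fun y' => y' = y).length : ℝ≥0∞) / 2 ^ t := by
  classical
  have h := M.tsum_run_mul w t (fun o => if some y = M.result o then 1 else 0) (by simp [result])
  have h' : ((M.run noOracle w t).map M.result) (some y) =
      ∑' o, M.run noOracle w t o * if some y = M.result o then 1 else 0 := by
    rw [PMF.map_apply]
    exact tsum_congr fun o => by split_ifs <;> simp
  rw [h', h]
  congr 1
  unfold outs
  generalize M.front w t = L
  induction L with
  | nil => simp
  | cons c L ih =>
    rw [List.map_cons, List.sum_cons, ih, List.filterMap_cons]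
    rcases hc : M.result (some c) with - | y'
    · simp
    · by_cases hy : y' = y
      · simp [hy, add_comm]
      · simp [hy, Ne.symm hy]

theorem primrec_coinStep (M : PTM) [Primcodable M.Q] :
    Primrec₂ M.coinStep := by
  classical
  have := M.finQ
  have hq : ∀ q : M.Q, PrimrecPred fun p : M.Cfg × Bool => p.1.1 = q := fun q => by
    have h := PrimrecPred.comp (f := fun p : M.Cfg × Bool => p.1.1) (p := fun q' => q' = q)
      ⟨inferInstance, Primrec.dom_finite _⟩ (Primrec.fst.comp Primrec.fst)
    exact h
  have hread : Primrec fun p : M.Cfg × Bool => (p.1.1, (fun i => (p.1.2 i).head?), p.2) := by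
    refine (Primrec.fst.comp Primrec.fst).pair (Primrec.pair ?_ Primrec.snd)
    rw [Primrec.fin_curry]
    exact Primrec.list_head?.comp (Primrec.fin_app.comp
      (Primrec.snd.comp (Primrec.fst.comp Primrec.fst)) Primrec.snd)
  have hst : Primrec fun p : M.Cfg × Bool => (M.δ p.1.1 (fun i => (p.1.2 i).head?) p.2).1 :=
    (Primrec.dom_finite fun a : M.Q × (Fin M.tapes → Option Bool) × Bool =>
      (M.δ a.1 a.2.1 a.2.2).1).comp hread
  have hact : Primrec fun p : M.Cfg × Bool =>
      fun i => ((M.δ p.1.1 (fun i => (p.1.2 i).head?) p.2).2 i).code :=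
    (Primrec.dom_finite fun a : M.Q × (Fin M.tapes → Option Bool) × Bool =>
      fun i => ((M.δ a.1 a.2.1 a.2.2).2 i).code).comp hread
  have htape : Primrec fun p : M.Cfg × Bool =>
      fun i => ((M.δ p.1.1 (fun i => (p.1.2 i).head?) p.2).2 i).apply (p.1.2 i) := by
    simp only [TapeAct.apply_eq]
    rw [Primrec.fin_curry]
    have h1 : Primrec fun a : (M.Cfg × Bool) × Fin M.tapes =>
        ((M.δ a.1.1.1 (fun i => (a.1.1.2 i).head?) a.1.2).2 a.2).code :=
      Primrec.fin_app.comp (hact.comp Primrec.fst) Primrec.snd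
    have h2 : Primrec fun a : (M.Cfg × Bool) × Fin M.tapes => a.1.1.2 a.2 :=
      Primrec.fin_app.comp (Primrec.snd.comp (Primrec.fst.comp Primrec.fst)) Primrec.snd
    exact Primrec.list_append.comp (Primrec.snd.comp h1)
      (Primrec.list_drop.comp (Primrec.fst.comp h1) h2)
  exact Primrec.ite (hq _) (Primrec.option_some.comp Primrec.fst)
    (Primrec.ite (hq _) (Primrec.const none) (Primrec.option_some.comp (hst.pair htape)))

theorem primrec_outs (M : PTM) : Primrec₂ M.outs := by
  classical
  have := M.finQ
  let e := Fintype.equivFin M.Q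
  let : Primcodable M.Q := Primcodable.ofEquiv _ e
  have hinit : Primrec M.init := by
    refine (Primrec.const M.start).pair ?_
    rw [Primrec.fin_curry]
    refine Primrec₂.swap (Primrec.fin_curry₁.2 fun i => ?_)
    by_cases hi : i = M.input
    · subst hi
      exact Primrec.id.of_eq fun y => by simp
    · simpa [Function.update_of_ne hi] using Primrec.const []
  have hfront : Primrec₂ M.front := by
    have hs : Primrec₂ fun (_ : List Bool × ℕ × List M.Cfg) (c : M.Cfg) =>
        [true, false].filterMap fun b => M.coinStep c b :=
      Primrec.listFilterMap (Primrec.const _)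
        (M.primrec_coinStep.comp (Primrec.snd.comp Primrec.fst) Primrec.snd)
    have hg : Primrec₂ fun (_ : List Bool) (p : ℕ × List M.Cfg) =>
        p.2.flatMap fun c => [true, false].filterMap fun b => M.coinStep c b :=
      Primrec.list_flatMap (Primrec.snd.comp Primrec.snd) hs
    exact Primrec.nat_rec (f := fun w => [M.init w])
      (Primrec.list_cons.comp hinit (Primrec.const [])) hg
  have hq : PrimrecPred fun c : M.Cfg => c.1 = M.halt :=
    PrimrecPred.comp (f := fun c : M.Cfg => c.1) (p := fun q' => q' = M.halt)
      ⟨inferInstance, Primrec.dom_finite _⟩ Primrec.fst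
  have hres : Primrec fun c : M.Cfg => M.result (some c) :=
    Primrec.ite hq (Primrec.option_some.comp
      (Primrec.fin_app.comp Primrec.snd (Primrec.const _))) (Primrec.const none)
  exact Primrec.listFilterMap hfront (hres.comp Primrec.snd)

end PTM

/-! ### Probable outputs are simple -/

/-- The `n`-th candidate: `n` encodes a time `t` and a string `y`, which is accepted if its
probability as an output within `t` steps is at least `2 ^ (-j)`. -/
noncomputable def probableOutput (B : PTM) (p : List Bool × ℕ) (n : ℕ) : Option (List Bool) :=
  (Encodable.decode (α := ℕ × List Bool) n).bind fun q =>
    if 2 ^ q.1 ≤ 2 ^ p.2 * ((B.outs p.1 q.1).filter fun y' => y' = q.2).length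
    then some q.2 else none

theorem primrec_two_pow : Primrec fun n : ℕ => 2 ^ n :=
  (Primrec.nat_rec₁ 1 (f := fun _ m => 2 * m)
    (Primrec.nat_mul.comp (Primrec.const 2) Primrec.snd).to₂).of_eq fun n => by
      induction n with
      | zero => rfl
      | succ n ih => rw [pow_succ', ← ih]

theorem primrec_probableOutput (B : PTM) : Primrec₂ (probableOutput B) := by
  have hl : Primrec fun a : ((List Bool × ℕ) × ℕ) × ℕ × List Bool =>
      ((B.outs a.1.1.1 a.2.1).filter fun y' => y' = a.2.2).length :=
    Primrec.list_length.comp ((PrimrecRel.listFilter (Primrec.eq (α := List Bool))).comp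
      (B.primrec_outs.comp (Primrec.fst.comp (Primrec.fst.comp Primrec.fst))
        (Primrec.fst.comp Primrec.snd)) (Primrec.snd.comp Primrec.snd))
  have h : Primrec₂ fun (p : (List Bool × ℕ) × ℕ) (q : ℕ × List Bool) =>
      if 2 ^ q.1 ≤ 2 ^ p.1.2 * ((B.outs p.1.1 q.1).filter fun y' => y' = q.2).length
      then some q.2 else none :=
    Primrec.ite (Primrec.nat_le.comp
        (primrec_two_pow.comp (Primrec.fst.comp Primrec.snd))
        (Primrec.nat_mul.comp
          (primrec_two_pow.comp (Primrec.snd.comp (Primrec.fst.comp Primrec.fst))) hl))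
      (Primrec.option_some.comp (Primrec.snd.comp Primrec.snd)) (Primrec.const none)
  exact Primrec.option_bind (Primrec.decode.comp Primrec.snd) h

/-- Accepted candidates have probability at least `2 ^ (-j)`; hence there are at most `2 ^ j`. -/
theorem two_pow_neg_le_outProb {B : PTM} {z y : List Bool} {j n : ℕ}
    (h : probableOutput B (z, j) n = some y) : ((2 : ℝ≥0∞) ^ j)⁻¹ ≤ B.outProb noOracle z y := by
  obtain ⟨⟨t, y'⟩, -, hq⟩ := Option.bind_eq_some_iff.1 h
  split_ifs at hq with hle
  obtain rfl := Option.some_injective _ hq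
  refine le_trans ?_ (le_iSup _ t)
  rw [PTM.map_result_apply, ENNReal.le_div_iff_mul_le (by simp) (by simp), mul_comm,
    ← div_eq_mul_inv]
  refine ENNReal.div_le_of_le_mul ?_
  rw [mul_comm]
  exact_mod_cast hle

theorem exists_probableOutput {B : PTM} {z y : List Bool} {j : ℕ}
    (h : ((2 : ℝ≥0∞) ^ j)⁻¹ < B.outProb noOracle z y) :
    ∃ n, probableOutput B (z, j) n = some y := by
  obtain ⟨t, ht⟩ := lt_iSup_iff.1 h
  refine ⟨Encodable.encode (t, y), ?_⟩
  rw [PTM.map_result_apply] at ht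
  have h1 := ht.le
  rw [ENNReal.le_div_iff_mul_le (by simp) (by simp), mul_comm, ← div_eq_mul_inv,
    ENNReal.div_le_iff_le_mul (by simp) (by simp), mul_comm] at h1
  simp only [probableOutput, Encodable.encodek, Option.bind_some]
  exact if_pos (by exact_mod_cast h1)

variable {U : List Bool → List Bool →. List Bool}

/-- The conditional coding theorem, with a logarithmic loss: the complexity of an output `y` of a
probabilistic machine is little more than the logarithm of its inverse probability. -/
theorem exists_kolm_le_logb (hU : IsUniversal U) (B : PTM) : ∃ c : ℝ, ∀ z y,
    B.outProb noOracle z y ≠ 0 → (kolm U y z : ℝ) ≤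
      Real.logb 2 (1 / (B.outProb noOracle z y).toReal) +
        2 * Real.logb 2 (2 * y.length + 1) + c := by
  have hcard : ∀ z j (F : Finset (List Bool)),
      (∀ y ∈ F, ∃ n, probableOutput B (z, j) n = some y) → F.card ≤ 2 ^ j := by
    intro z j F hF
    have h1 : (F.card : ℝ≥0∞) * (2 ^ j)⁻¹ ≤ 1 := by
      rw [← nsmul_eq_mul, ← Finset.sum_const]
      refine le_trans (Finset.sum_le_sum fun y hy => ?_)
        ((ENNReal.sum_le_tsum F).trans (B.tsum_outProb_le noOracle z))
      obtain ⟨n, hn⟩ := hF y hy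
      exact two_pow_neg_le_outProb hn
    rw [← div_eq_mul_inv, ENNReal.div_le_iff_le_mul (by simp) (by simp), one_mul] at h1
    exact_mod_cast h1
  obtain ⟨c₁, hc₁⟩ := exists_kolm_le_of_card_le hU (primrec_probableOutput B) hcard
  obtain ⟨c₂, hc₂⟩ := exists_program_self hU
  have hbin : ∀ a b : ℕ, a ≤ b →
      ((binary a).length : ℝ) ≤ Real.logb 2 (2 * b + 1) := by
    intro a b hab
    rw [Real.le_logb_iff_rpow_le one_lt_two (by positivity), Real.rpow_natCast]
    exact_mod_cast (two_pow_length_binary a).trans (by omega)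
  refine ⟨1 + c₁ + c₂, fun z y h0 => ?_⟩
  have htop : B.outProb noOracle z y ≠ ⊤ :=
    ((ENNReal.le_tsum y).trans (B.tsum_outProb_le noOracle z)).trans_lt ENNReal.one_lt_top |>.ne
  set p := (B.outProb noOracle z y).toReal with hp
  have hp0 : 0 < p := ENNReal.toReal_pos h0 htop
  have hp1 : p ≤ 1 := ENNReal.toReal_le_of_le_ofReal zero_le_one
    (by simpa using (ENNReal.le_tsum y).trans (B.tsum_outProb_le noOracle z))
  have hlog : 0 ≤ Real.logb 2 (1 / p) :=
    Real.logb_nonneg one_lt_two (by rw [le_div_iff₀ hp0]; linarith)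
  set j := ⌊Real.logb 2 (1 / p)⌋₊ + 1 with hj
  have hjle : (j : ℝ) ≤ Real.logb 2 (1 / p) + 1 := by
    rw [hj]
    push_cast
    linarith [Nat.floor_le hlog]
  have hlt : Real.logb 2 (1 / p) < j := by
    rw [hj]
    push_cast
    exact Nat.lt_floor_add_one _
  have hprob : ((2 : ℝ≥0∞) ^ j)⁻¹ < B.outProb noOracle z y := by
    rw [Real.logb_lt_iff_lt_rpow one_lt_two (by positivity), Real.rpow_natCast, one_div,
      inv_lt_comm₀ hp0 (by positivity)] at hlt
    rw [← ENNReal.ofReal_toReal htop, ← hp,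
      show ((2 : ℝ≥0∞) ^ j)⁻¹ = ENNReal.ofReal ((2 ^ j)⁻¹) by
        rw [ENNReal.ofReal_inv_of_pos (by positivity), ENNReal.ofReal_pow two_pos.le]
        simp]
    exact (ENNReal.ofReal_lt_ofReal_iff hp0).2 hlt
  have hc₁' : (0 : ℝ) ≤ c₁ := c₁.cast_nonneg
  have hc₂' : (0 : ℝ) ≤ c₂ := c₂.cast_nonneg
  rcases le_total j y.length with hjy | hjy
  · obtain ⟨n, hn⟩ := exists_probableOutput hprob
    have h := hc₁ z j n y hn
    have h' : (kolm U y z : ℝ) ≤ j + 2 * (binary j).length + c₁ := by exact_mod_cast h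
    linarith [hbin j y.length hjy]
  · -- the description of `y` by itself is shorter
    obtain ⟨q, hq, hql⟩ := hc₂ y z
    have h := (kolm_le hq).trans hql
    have h' : (kolm U y z : ℝ) ≤ y.length + 2 * (binary y.length).length + c₂ := by
      exact_mod_cast h
    have hjy' : (y.length : ℝ) ≤ j := by exact_mod_cast hjy
    linarith [hbin y.length y.length le_rfl]

/-! ### Estimates of the variation distance -/

theorem PMF.sum_toReal_le_one {α : Type} (p : PMF α) (F : Finset α) :
    ∑ a ∈ F, (p a).toReal ≤ 1 := by
  rw [← ENNReal.toReal_sum fun a _ => p.apply_ne_top a]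
  exact ENNReal.toReal_le_of_le_ofReal zero_le_one
    (by simpa using (ENNReal.sum_le_tsum F).trans_eq p.tsum_coe)

theorem PMF.hasSum_toReal {α : Type} (p : PMF α) : HasSum (fun a => (p a).toReal) 1 := by
  have h : Summable fun a => (p a).toReal := ENNReal.summable_toReal p.tsum_coe_ne_top
  rw [h.hasSum_iff, ← ENNReal.tsum_toReal_eq fun a => p.apply_ne_top a, p.tsum_coe,
    ENNReal.toReal_one]

/-- The variation distance is the total excess of `q` over `p`. -/
theorem hasSum_max_tvDist {α : Type} (p q : PMF α) :
    HasSum (fun a => max ((q a).toReal - (p a).toReal) 0) (tvDist p q) := by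
  have hp := PMF.hasSum_toReal p
  have hq := PMF.hasSum_toReal q
  have h1 : Summable fun a => max ((q a).toReal - (p a).toReal) 0 :=
    hq.summable.of_nonneg_of_le (fun _ => le_max_right _ _) fun a =>
      max_le (sub_le_self _ ENNReal.toReal_nonneg) ENNReal.toReal_nonneg
  have h3 := (hp.sub hq).add (h1.hasSum.mul_left 2)
  have h4 : ∀ a, |(p a).toReal - (q a).toReal| =
      (p a).toReal - (q a).toReal + 2 * max ((q a).toReal - (p a).toReal) 0 := by
    intro a
    rcases le_total (p a).toReal (q a).toReal with h | h
    · rw [max_eq_left (by linarith), abs_of_nonpos (by linarith)]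
      ring
    · rw [max_eq_right (by linarith), abs_of_nonneg (by linarith)]
      ring
  have h5 : tvDist p q = ∑' a, max ((q a).toReal - (p a).toReal) 0 := by
    rw [tvDist, tsum_congr h4, h3.tsum_eq]
    ring
  rw [h5]
  exact h1.hasSum

/-- The variation distance is the largest excess of the probability of an event. -/
theorem tvDist_le_of_forall {α : Type} {p q : PMF α} {ε : ℝ} (F : Finset α)
    (hF : ∀ a ∉ F, q a = 0)
    (h : ∀ T ⊆ F, ∑ a ∈ T, ((q a).toReal - (p a).toReal) ≤ ε) : tvDist p q ≤ ε := by
  classical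
  have h1 : ∀ a ∉ F, max ((q a).toReal - (p a).toReal) 0 = 0 := by
    intro a ha
    rw [hF a ha]
    simp
  rw [(hasSum_max_tvDist p q).unique (hasSum_sum_of_ne_finset_zero h1)]
  have h5 : ∑ a ∈ F, max ((q a).toReal - (p a).toReal) 0 =
      ∑ a ∈ F with (p a).toReal < (q a).toReal, ((q a).toReal - (p a).toReal) := by
    rw [Finset.sum_filter]
    refine Finset.sum_congr rfl fun a _ => ?_
    split_ifs with hlt
    · exact max_eq_left (by linarith)
    · exact max_eq_right (by linarith)
  rw [h5]
  exact h _ (Finset.filter_subset _ F)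

theorem SamplingProblem.map_some_apply (S : SamplingProblem) (x y : List Bool) :
    (S.D x).map some (some y) = S.D x y := by
  rw [PMF.map_apply, tsum_eq_single y fun y' hy => by
    rw [if_neg (by simpa using Ne.symm hy)], if_pos rfl]

/-- For a target distribution on strings of a fixed length, events are sets of such strings. -/
theorem tvDist_map_some_le {S : SamplingProblem} {x : List Bool} {p : PMF (Option (List Bool))}
    {ε : ℝ} (h : ∀ T ⊆ strings (S.len.eval x.length),
      ∑ y ∈ T, (S.prob x y - (p (some y)).toReal) ≤ ε) :
    tvDist p ((S.D x).map some) ≤ ε := by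
  classical
  refine tvDist_le_of_forall ((strings (S.len.eval x.length)).map Function.Embedding.some) ?_ ?_
  · rintro (- | y) hy
    · simp [PMF.map_apply]
    · rw [S.map_some_apply]
      exact SamplingProblem.apply_eq_zero fun hy' => hy (Finset.mem_map_of_mem _ hy')
  · intro T hT
    obtain ⟨T, hT', rfl⟩ := Finset.subset_map_iff.1 hT
    rw [Finset.sum_map]
    simp only [Function.Embedding.some_apply, S.map_some_apply]
    exact h T hT'

/-! ### A random coordinate of a solution -/

/-- A random coordinate of a random tuple (with law `q`) of `n` strings of length `m`. -/
noncomputable def coordOf (q : PMF (Option (List Bool))) (m n : ℕ) [NeZero n] :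
    PMF (Option (List Bool)) :=
  q.bind fun o => (PMF.uniformOfFintype (Fin n)).map fun i : Fin n => o.map fun Y => block m Y i

theorem le_sum_coordOf (q : PMF (Option (List Bool))) (m n : ℕ) [NeZero n]
    (A T : Finset (List Bool)) :
    ∑ Y ∈ A, (q (some Y)).toReal *
        ((∑ i ∈ Finset.range n, if block m Y i ∈ T then (1 : ℝ) else 0) / n) ≤
      ∑ y ∈ T, (coordOf q m n (some y)).toReal := by
  classical
  have h1 : ∀ Y, ∑ y ∈ T, ((PMF.uniformOfFintype (Fin n)).map
      fun i : Fin n => (some Y).map fun Y => block m Y i) (some y) =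
      ∑ i ∈ Finset.range n, if block m Y i ∈ T then (n : ℝ≥0∞)⁻¹ else 0 := by
    intro Y
    simp only [PMF.map_apply, tsum_fintype, PMF.uniformOfFintype_apply, Fintype.card_fin,
      Option.map_some, Option.some.injEq]
    rw [Finset.sum_comm, Finset.sum_range]
    refine Finset.sum_congr rfl fun i _ => ?_
    rw [Finset.sum_ite_eq' T (block m Y i) fun _ => (n : ℝ≥0∞)⁻¹]
  have h2 : ∑ Y ∈ A, q (some Y) *
      (∑ i ∈ Finset.range n, if block m Y i ∈ T then (n : ℝ≥0∞)⁻¹ else 0) ≤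
      ∑ y ∈ T, coordOf q m n (some y) := by
    simp only [coordOf, PMF.bind_apply]
    rw [← Summable.tsum_finsetSum fun _ _ => ENNReal.summable]
    simp only [← Finset.mul_sum]
    refine le_trans (le_of_eq ?_) (ENNReal.sum_le_tsum (A.map Function.Embedding.some))
    rw [Finset.sum_map]
    exact Finset.sum_congr rfl fun Y _ => by rw [← h1 Y]; rfl
  have h3 := ENNReal.toReal_mono (ENNReal.sum_ne_top.2 fun y _ => PMF.apply_ne_top _ _) h2
  rw [ENNReal.toReal_sum fun y _ => PMF.apply_ne_top _ _, ENNReal.toReal_sum] at h3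
  · refine le_trans (le_of_eq (Finset.sum_congr rfl fun Y _ => ?_)) h3
    rw [ENNReal.toReal_mul, ENNReal.toReal_sum, Finset.sum_div]
    · congr 1
      refine Finset.sum_congr rfl fun i _ => ?_
      split_ifs <;> simp
    · intro i _
      split_ifs <;> simp [NeZero.ne n]
  · intro Y _
    refine ENNReal.mul_ne_top (PMF.apply_ne_top _ _) (ENNReal.sum_ne_top.2 fun i _ => ?_)
    split_ifs <;> simp [NeZero.ne n]

/-- The moment generating function of a centered variable bounded by `1`. -/
theorem sum_mul_exp_le {ι : Type*} (F : Finset ι) (p h : ι → ℝ) (hp : ∀ y ∈ F, 0 ≤ p y)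
    (hp1 : ∑ y ∈ F, p y = 1) (h0 : ∑ y ∈ F, p y * h y = 0) (hh : ∀ y ∈ F, |h y| ≤ 1) {l : ℝ}
    (hl0 : 0 ≤ l) (hl1 : l ≤ 1) : ∑ y ∈ F, p y * Real.exp (l * h y) ≤ Real.exp (l ^ 2) := by
  have h1 : ∀ y ∈ F, p y * Real.exp (l * h y) ≤ p y * (1 + l ^ 2) + l * (p y * h y) := by
    intro y hy
    have ha : |l * h y| ≤ 1 := by
      rw [abs_mul, abs_of_nonneg hl0]
      exact mul_le_one₀ hl1 (abs_nonneg _) (hh y hy)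
    have hb := (abs_le.1 (Real.abs_exp_sub_one_sub_id_le ha)).2
    have hc : (l * h y) ^ 2 ≤ l ^ 2 := by
      rw [mul_pow]
      exact mul_le_of_le_one_right (sq_nonneg l) (by rw [sq_le_one_iff_abs_le_one]; exact hh y hy)
    calc p y * Real.exp (l * h y) ≤ p y * (1 + l * h y + l ^ 2) :=
          mul_le_mul_of_nonneg_left (by linarith) (hp y hy)
      _ = _ := by ring
  refine (Finset.sum_le_sum h1).trans ?_
  rw [Finset.sum_add_distrib, ← Finset.sum_mul, ← Finset.mul_sum, hp1, h0]
  linarith [Real.add_one_le_exp (l ^ 2)]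

/-- If the law `q` of a tuple exceeds, on a set `A` of probability at least `1 - δ`, the law of
independent samples by a factor of `e ^ κ` at most, then the law of a random coordinate is close to
the law of a sample. (The exponential moment replaces the chain rule for relative entropy.) -/
theorem coordOf_close {S : SamplingProblem} {x : List Bool} {N : ℕ} [NeZero N]
    {q : PMF (Option (List Bool))} {A : Finset (List Bool)}
    (hA : A ⊆ strings (N * S.len.eval x.length)) {δ κ l : ℝ} (hκ : 0 ≤ κ) (hl : 0 < l)
    (hl1 : l ≤ 1) (hδ : 1 - δ ≤ ∑ Y ∈ A, (q (some Y)).toReal)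
    (hle : ∀ Y ∈ A, (q (some Y)).toReal ≤ Real.exp κ * S.tupleProb x N Y) :
    tvDist (coordOf q (S.len.eval x.length) N) ((S.D x).map some) ≤
      δ + (κ + 1) / (l * N) + l := by
  classical
  set m := S.len.eval x.length
  have hN0 : (0 : ℝ) < N := by exact_mod_cast Nat.pos_of_ne_zero (NeZero.ne N)
  refine tvDist_map_some_le fun T hT => ?_
  set d := ∑ y ∈ T, S.prob x y with hd
  have hd0 : 0 ≤ d := Finset.sum_nonneg fun y _ => SamplingProblem.prob_nonneg _ _
  have hd1 : d ≤ 1 := PMF.sum_toReal_le_one _ _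
  let h : List Bool → ℝ := fun y => d - if y ∈ T then 1 else 0
  let H : List Bool → ℝ := fun Y => ∑ i ∈ Finset.range N, h (block m Y i)
  have hh0 : ∑ y ∈ strings m, S.prob x y * h y = 0 := by
    simp only [h, mul_sub, Finset.sum_sub_distrib, ← Finset.sum_mul, mul_ite, mul_one, mul_zero]
    rw [SamplingProblem.sum_prob, ← Finset.sum_filter, Finset.filter_mem_eq_inter,
      Finset.inter_eq_right.2 hT, ← hd]
    ring
  have hh1 : ∀ y ∈ strings m, |h y| ≤ 1 := by
    intro y _
    simp only [h]
    split_ifs <;> rw [abs_le] <;> constructor <;> linarith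
  have hmgf := sum_mul_exp_le (strings m) (S.prob x) h
    (fun _ _ => SamplingProblem.prob_nonneg _ _) (SamplingProblem.sum_prob x) hh0 hh1 hl.le hl1
  have hexp : ∑ Y ∈ strings (N * m), S.tupleProb x N Y * Real.exp (l * H Y) ≤
      Real.exp (N * l ^ 2) := by
    have e : ∀ Y, S.tupleProb x N Y * Real.exp (l * H Y) =
        ∏ i ∈ Finset.range N, S.prob x (block m Y i) * Real.exp (l * h (block m Y i)) := by
      intro Y
      rw [Finset.prod_mul_distrib, ← Real.exp_sum, ← Finset.mul_sum]
      rfl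
    rw [Finset.sum_congr rfl fun Y _ => e Y, sum_prod_block m N fun y =>
      S.prob x y * Real.exp (l * h y), Real.exp_nat_mul]
    exact pow_le_pow_left₀ (Finset.sum_nonneg fun y _ =>
      mul_nonneg (SamplingProblem.prob_nonneg _ _) (Real.exp_pos _).le) hmgf N
  set κ' := κ + N * l ^ 2 with hκ'
  have hκ'0 : 0 ≤ κ' := by positivity
  have hqA : ∑ Y ∈ A, (q (some Y)).toReal ≤ 1 := by
    have := PMF.sum_toReal_le_one q (A.map Function.Embedding.some)
    rwa [Finset.sum_map] at this
  have hsum : l * ∑ Y ∈ A, (q (some Y)).toReal * H Y ≤ κ' + 1 := by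
    have h1 : ∀ Y ∈ A, l * ((q (some Y)).toReal * H Y) ≤ (q (some Y)).toReal * κ' +
        Real.exp (-(N * l ^ 2)) * (S.tupleProb x N Y * Real.exp (l * H Y)) := by
      intro Y hY
      have h2 : l * H Y ≤ κ' + Real.exp (l * H Y - κ') := by
        linarith [Real.add_one_le_exp (l * H Y - κ')]
      have h3 : (q (some Y)).toReal * Real.exp (l * H Y - κ') ≤
          Real.exp (-(N * l ^ 2)) * (S.tupleProb x N Y * Real.exp (l * H Y)) := by
        calc (q (some Y)).toReal * Real.exp (l * H Y - κ')
            ≤ Real.exp κ * S.tupleProb x N Y * Real.exp (l * H Y - κ') :=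
              mul_le_mul_of_nonneg_right (hle Y hY) (Real.exp_pos _).le
          _ = _ := by
              rw [hκ', show l * H Y - (κ + N * l ^ 2) = -κ + (-(N * l ^ 2) + l * H Y) by ring,
                Real.exp_add, Real.exp_add, Real.exp_neg κ]
              field_simp
      have h4 := mul_le_mul_of_nonneg_left h2 (ENNReal.toReal_nonneg (a := q (some Y)))
      linarith
    rw [Finset.mul_sum]
    refine (Finset.sum_le_sum h1).trans ?_
    rw [Finset.sum_add_distrib, ← Finset.sum_mul, ← Finset.mul_sum]
    have h5 : ∑ Y ∈ A, S.tupleProb x N Y * Real.exp (l * H Y) ≤ Real.exp (N * l ^ 2) :=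
      (Finset.sum_le_sum_of_subset_of_nonneg hA fun Y _ _ =>
        mul_nonneg (SamplingProblem.tupleProb_nonneg _ _ _) (Real.exp_pos _).le).trans hexp
    have h6 := mul_le_mul_of_nonneg_left h5 (Real.exp_pos (-(N * l ^ 2))).le
    rw [← Real.exp_add, neg_add_cancel, Real.exp_zero] at h6
    linarith [mul_le_mul_of_nonneg_right hqA hκ'0]
  have hcoord := le_sum_coordOf q m N A T
  have hH : ∀ Y, (∑ i ∈ Finset.range N, if block m Y i ∈ T then (1 : ℝ) else 0) / N =
      d - H Y / N := by
    intro Y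
    simp only [H, h, Finset.sum_sub_distrib, Finset.sum_const, Finset.card_range, nsmul_eq_mul]
    field_simp
    ring
  simp only [hH, mul_sub, Finset.sum_sub_distrib, ← Finset.sum_mul] at hcoord
  have hdiv : ∑ Y ∈ A, (q (some Y)).toReal * (H Y / N) ≤ (κ + 1) / (l * N) + l := by
    have e1 : ∑ Y ∈ A, (q (some Y)).toReal * (H Y / N) =
        (l * ∑ Y ∈ A, (q (some Y)).toReal * H Y) / (l * N) := by
      rw [mul_div_mul_left _ _ hl.ne', Finset.sum_div]
      exact Finset.sum_congr rfl fun Y _ => (mul_div_assoc _ _ _).symm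
    have e2 : (κ + 1) / (l * N) + l = (κ' + 1) / (l * N) := by
      rw [hκ']
      field_simp
      ring
    rw [e1, e2]
    gcongr
  rw [Finset.sum_sub_distrib, ← hd]
  have hδ' : d * (1 - ∑ Y ∈ A, (q (some Y)).toReal) ≤ δ := by
    have : d * (1 - ∑ Y ∈ A, (q (some Y)).toReal) ≤ 1 * (1 - ∑ Y ∈ A, (q (some Y)).toReal) :=
      mul_le_mul_of_nonneg_right hd1 (by linarith)
    linarith
  linarith

/-! ### The output of a solver -/

theorem exists_log_le (C : ℝ) : ∃ c : ℕ, ∀ k : ℕ, c ≤ k →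
    C + 7 * Real.log k ≤ (k : ℝ) ^ (0.1 : ℝ) / 4 := by
  have h1 : (fun x : ℝ => C + 7 * Real.log x) =o[Filter.atTop] fun x : ℝ => x ^ (0.1 : ℝ) :=
    (Asymptotics.isLittleO_const_left.2 (Or.inr (tendsto_norm_atTop_atTop.comp
      (tendsto_rpow_atTop (by norm_num))))).add
      ((isLittleO_log_rpow_atTop (by norm_num)).const_mul_left 7)
  have h2 := h1.bound (show (0 : ℝ) < 1 / 4 by norm_num)
  obtain ⟨c, hc⟩ := Filter.eventually_atTop.1
    (tendsto_natCast_atTop_atTop.eventually h2)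
  refine ⟨c, fun k hk => ?_⟩
  have h3 := hc k hk
  rw [Real.norm_of_nonneg (by positivity : (0 : ℝ) ≤ (k : ℝ) ^ (0.1 : ℝ))] at h3
  linarith [(le_abs_self _).trans h3]

theorem coordOf_congr {q : PMF (Option (List Bool))} {m n n' : ℕ} [NeZero n] [NeZero n']
    (h : n = n') : coordOf q m n = coordOf q m n' := by
  subst h
  rfl

variable {U : List Bool → List Bool →. List Bool} {S : SamplingProblem}

theorem coordLaw_eq (B : PTM) (S : SamplingProblem) (x : List Bool) (k : ℕ) :
    coordLaw B S x k = coordOf (B.outLaw noOracle (inst x k)) (S.len.eval x.length)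
      (numSamples (S.len.eval x.length) k - 1 + 1) := by
  rw [coordLaw, coordOf]
  congr 1
  funext o
  exact PMF.map_comp (fun i : Fin _ => (i : ℕ)) _
    fun i => o.map fun Y => block (S.len.eval x.length) Y i

open Classical in
/-- The solutions, as a finite set. -/
noncomputable def solFinset (U : List Bool → List Bool →. List Bool) (S : SamplingProblem)
    (x : List Bool) (k : ℕ) : Finset (List Bool) :=
  {Y ∈ strings (numSamples (S.len.eval x.length) k * S.len.eval x.length) | Y ∈ solSet U S x k}

theorem mem_solFinset {x Y : List Bool} {k : ℕ} :
    Y ∈ solFinset U S x k ↔ Y ∈ solSet U S x k := by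
  classical
  rw [solFinset, Finset.mem_filter, and_iff_right_iff_imp]
  exact fun h => (mem_solSet.1 h).1

theorem toOuterMeasure_solSet (q : PMF (Option (List Bool))) (x : List Bool) (k : ℕ) :
    q.toOuterMeasure (some '' solSet U S x k) = ∑ Y ∈ solFinset U S x k, q (some Y) := by
  have h : (some '' solSet U S x k : Set (Option (List Bool))) =
      ((solFinset U S x k).map Function.Embedding.some : Finset _) := by
    ext o
    simp [mem_solFinset]
  rw [h, PMF.toOuterMeasure_apply_finset, Finset.sum_map]
  rfl

theorem one_sub_le_sum_toReal {q : PMF (Option (List Bool))} {x : List Bool} {k : ℕ}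
    (hk : 1 ≤ k) (h : 1 - (k : ℝ≥0∞)⁻¹ ≤ q.toOuterMeasure (some '' solSet U S x k)) :
    1 - 1 / (k : ℝ) ≤ ∑ Y ∈ solFinset U S x k, (q (some Y)).toReal := by
  rw [toOuterMeasure_solSet] at h
  rw [← ENNReal.toReal_sum fun Y _ => PMF.apply_ne_top _ _]
  have hne : ∑ Y ∈ solFinset U S x k, q (some Y) ≠ ⊤ :=
    ENNReal.sum_ne_top.2 fun Y _ => PMF.apply_ne_top _ _
  have h2 : (1 : ℝ≥0∞) ≤ ∑ Y ∈ solFinset U S x k, q (some Y) + (k : ℝ≥0∞)⁻¹ :=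
    tsub_le_iff_right.1 h
  have hk' : ((k : ℝ≥0∞)⁻¹) ≠ ⊤ := by simp [Nat.one_le_iff_ne_zero.1 hk]
  have h3 := ENNReal.toReal_mono (ENNReal.add_ne_top.2 ⟨hne, hk'⟩) h2
  rw [ENNReal.toReal_add hne hk', ENNReal.toReal_one, ENNReal.toReal_inv,
    ENNReal.toReal_natCast, ← one_div] at h3
  linarith

/-- A solution is at most as probable as an output of `B` as its complexity permits, hence, up to
a small factor, at most as probable as under independent sampling. -/
theorem toReal_outProb_le {B : PTM} {x Y : List Bool} {k : ℕ} {c κ : ℝ}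
    (hc : ∀ z y, B.outProb noOracle z y ≠ 0 → (kolm U y z : ℝ) ≤
      Real.logb 2 (1 / (B.outProb noOracle z y).toReal) +
        2 * Real.logb 2 (2 * y.length + 1) + c)
    (hY : Y ∈ solSet U S x k)
    (hκ : (2 * Real.logb 2 (2 * Y.length + 1) + c + slack k) * Real.log 2 ≤ κ) :
    (B.outLaw noOracle (inst x k) (some Y)).toReal ≤
      Real.exp κ * S.tupleProb x (numSamples (S.len.eval x.length) k) Y := by
  have e : B.outLaw noOracle (inst x k) (some Y) = B.outProb noOracle (inst x k) Y := rfl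
  obtain ⟨-, hP, hlog⟩ := mem_solSet.1 hY
  set P := S.tupleProb x (numSamples (S.len.eval x.length) k) Y
  by_cases h0 : B.outProb noOracle (inst x k) Y = 0
  · rw [e, h0, ENNReal.toReal_zero]
    positivity
  · have hq : 0 < (B.outLaw noOracle (inst x k) (some Y)).toReal :=
      ENNReal.toReal_pos h0 (PMF.apply_ne_top _ _)
    have h1 := hlog.trans (add_le_add_left (hc _ _ h0) _)
    rw [← e] at h1
    set q := (B.outLaw noOracle (inst x k) (some Y)).toReal
    have hl2 : 0 < Real.log 2 := Real.log_pos one_lt_two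
    have h2 : Real.log q ≤ κ + Real.log P := by
      have h3 := mul_le_mul_of_nonneg_right h1 hl2.le
      rw [one_div, one_div, Real.logb_inv, Real.logb_inv] at h3
      have h4 : Real.logb 2 P * Real.log 2 = Real.log P := div_mul_cancel₀ _ hl2.ne'
      have h5 : Real.logb 2 q * Real.log 2 = Real.log q := div_mul_cancel₀ _ hl2.ne'
      nlinarith
    rw [← Real.exp_log hq, ← Real.exp_log hP, ← Real.exp_add]
    exact Real.exp_le_exp.2 h2

/-- The number of samples exceeds the loss in the coding theorem by a factor of order `k ^ 2`. -/
theorem exists_loss_le (c : ℝ) (hc : 0 ≤ c) : ∃ c' : ℕ, ∀ m k : ℕ, 1 ≤ m → 1 ≤ k → c' ≤ k →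
    (2 * Real.logb 2 (2 * (numSamples m k * m : ℕ) + 1) + c + slack k) * Real.log 2 ≤
      numSamples m k / (4 * (k : ℝ) ^ 2) - 1 := by
  obtain ⟨c', hc'⟩ := exists_log_le (2 * Real.log 3 + 5 + c + 1)
  refine ⟨c', fun m k hm hk hck => ?_⟩
  have hk1 : (1 : ℝ) ≤ k := by exact_mod_cast hk
  have hm1 : (1 : ℝ) ≤ m := by exact_mod_cast hm
  have hk0 : (0 : ℝ) < k := by positivity
  have hm0 : (0 : ℝ) < m := by positivity
  have hl2 : 0 < Real.log 2 := Real.log_pos one_lt_two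
  have hl2' : Real.log 2 ≤ 1 := by linarith [Real.log_two_lt_d9]
  have hlk : 0 ≤ Real.log k := Real.log_nonneg hk1
  have hl3 : 0 ≤ Real.log 3 := Real.log_nonneg (by norm_num)
  have h1 : (2 * (numSamples m k * m : ℕ) + 1 : ℝ) ≤ 3 * m ^ 2 * k ^ 3 := by
    have h2 : numSamples m k * m ≤ m * k ^ 3 * m := Nat.mul_le_mul_right _ (numSamples_le hk)
    have h3 : 1 ≤ m ^ 2 * k ^ 3 := Nat.one_le_iff_ne_zero.2 (by positivity)
    have h4 : 2 * (numSamples m k * m) + 1 ≤ 3 * m ^ 2 * k ^ 3 := by nlinarith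
    exact_mod_cast h4
  have h2 : Real.log (2 * (numSamples m k * m : ℕ) + 1) ≤
      Real.log 3 + 2 * Real.log m + 3 * Real.log k := by
    refine (Real.log_le_log (by positivity) h1).trans (le_of_eq ?_)
    rw [Real.log_mul (by positivity) (by positivity), Real.log_mul (by positivity)
      (by positivity), Real.log_pow, Real.log_pow]
    norm_num
  have h3 : (2 * Real.logb 2 (2 * (numSamples m k * m : ℕ) + 1) + c + slack k) * Real.log 2 =
      2 * Real.log (2 * (numSamples m k * m : ℕ) + 1) + (c + 1) * Real.log 2 + Real.log k := by
    rw [slack, one_div_one_div, Real.logb, Real.logb]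
    field_simp
    ring
  have h4 : Real.log m ≤ m := (Real.log_le_sub_one_of_pos hm0).trans (by linarith)
  have h5 : (m : ℝ) * ((k : ℝ) ^ (0.1 : ℝ) / 4) ≤ numSamples m k / (4 * (k : ℝ) ^ 2) := by
    have e : (m : ℝ) * ((k : ℝ) ^ (0.1 : ℝ) / 4) =
        m * (k : ℝ) ^ (2.1 : ℝ) / (4 * (k : ℝ) ^ 2) := by
      rw [show (2.1 : ℝ) = 0.1 + (2 : ℕ) by norm_num, Real.rpow_add hk0, Real.rpow_natCast]
      field_simp
    rw [e]
    gcongr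
    exact le_numSamples hk
  have h6 : (c + 1) * Real.log 2 ≤ c + 1 := mul_le_of_le_one_right (by linarith) hl2'
  have h7 := mul_le_mul_of_nonneg_left (hc' k hck) hm0.le
  rw [h3]
  have h8 : 2 * Real.log 3 + c + 1 + 1 + 7 * Real.log k ≤
      m * (2 * Real.log 3 + c + 1 + 1 + 7 * Real.log k) :=
    le_mul_of_one_le_left (by linarith) hm1
  linarith

/-- A random coordinate of the output of a solver is close to a sample: a solution is probable for
the solver only if it is nearly as probable for independent samples, which forces most of its
coordinates to be typical. -/
theorem exists_tvDist_coordLaw_le (hU : IsUniversal U) (S : SamplingProblem) (B : PTM)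
    (hB : Solves B noOracle (searchProblem hU S)) :
    ∃ c : ℕ, ∀ (x : List Bool) (k : ℕ), 1 ≤ k → c ≤ k →
      tvDist (coordLaw B S x k) ((S.D x).map some) ≤ 2 / (k : ℝ) := by
  classical
  obtain ⟨c, hc⟩ := exists_kolm_le_logb hU B
  obtain ⟨c', hc'⟩ := exists_loss_le (max c 0) (le_max_right _ _)
  refine ⟨c', fun x k hk hck => ?_⟩
  have hk1 : (1 : ℝ) ≤ k := by exact_mod_cast hk
  have hk0 : (0 : ℝ) < k := by positivity
  have hsub : solFinset U S x k ⊆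
      strings (numSamples (S.len.eval x.length) k * S.len.eval x.length) :=
    Finset.filter_subset _ _
  have hA := one_sub_le_sum_toReal (U := U) (S := S) hk (hB x k hk)
  rw [coordLaw_eq]
  rcases Nat.eq_zero_or_pos (S.len.eval x.length) with hm | hm
  · -- all strings are empty, and only the case that `B` does not halt counts
    have hT := fun T => le_sum_coordOf (B.outLaw noOracle (inst x k)) (S.len.eval x.length)
      (numSamples (S.len.eval x.length) k - 1 + 1) (solFinset U S x k) T
    refine tvDist_map_some_le fun T hT' => ?_
    rw [Finset.sum_sub_distrib]
    have h2k : 1 / (k : ℝ) ≤ 2 / k := by gcongr; norm_num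
    have hT1 : ∑ y ∈ T, S.prob x y ≤ 1 := PMF.sum_toReal_le_one _ _
    rcases T.eq_empty_or_nonempty with rfl | ⟨y, hy⟩
    · simp only [Finset.sum_empty, sub_zero]
      positivity
    · have hnil : ∀ Y i, block (S.len.eval x.length) Y i ∈ T := by
        intro Y i
        have hy0 : y = [] := by simpa [hm] using hT' hy
        have : block (S.len.eval x.length) Y i = [] := by simp [block, hm]
        rwa [this, ← hy0]
      have h := hT T
      simp only [hnil, if_true, Finset.sum_const, Finset.card_range, nsmul_eq_mul, mul_one] at h
      rw [div_self (by positivity)] at h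
      simp only [mul_one] at h
      linarith
  · have hN : 1 ≤ numSamples (S.len.eval x.length) k := by
      have h1 : (0 : ℝ) < numSamples (S.len.eval x.length) k :=
        lt_of_lt_of_le (by positivity) (le_numSamples hk)
      exact_mod_cast h1
    have : NeZero (numSamples (S.len.eval x.length) k) := ⟨by omega⟩
    rw [coordOf_congr (Nat.sub_add_cancel hN)]
    have hN0 : (0 : ℝ) < numSamples (S.len.eval x.length) k := by exact_mod_cast hN
    have hloss := hc' _ k hm hk hck
    set N := numSamples (S.len.eval x.length) k with hNdef
    have hnn : 0 ≤ (N : ℝ) / (4 * (k : ℝ) ^ 2) - 1 := by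
      refine le_trans ?_ hloss
      refine mul_nonneg ?_ (Real.log_nonneg one_le_two)
      refine add_nonneg (add_nonneg (mul_nonneg two_pos.le (Real.logb_nonneg one_lt_two ?_))
        (le_max_right _ _)) ?_
      · linarith [Nat.cast_nonneg (α := ℝ) (N * S.len.eval x.length)]
      · rw [slack, one_div_one_div]
        linarith [Real.logb_nonneg one_lt_two hk1]
    -- this choice of `l` and `κ` balances the three terms of the bound to `2 / k`
    have h := coordOf_close (S := S) (x := x) (N := N) (q := B.outLaw noOracle (inst x k)) hsub
      hnn (show (0 : ℝ) < 1 / (2 * k) by positivity)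
      (by rw [div_le_one (by positivity)]; linarith) hA fun Y hY => by
        refine toReal_outProb_le hc (mem_solFinset.1 hY) (le_trans ?_ hloss)
        rw [mem_strings.1 (hsub hY)]
        exact mul_le_mul_of_nonneg_right (by linarith [le_max_left c 0])
          (Real.log_nonneg one_le_two)
    refine h.trans (le_of_eq ?_)
    field_simp
    ring

/-! ### Running a machine from a configuration -/

theorem pmf_bind_congr {α β : Type} (p : PMF α) (f g : α → PMF β)
    (h : ∀ a ∈ p.support, f a = g a) : p.bind f = p.bind g := by
  ext b
  rw [PMF.bind_apply, PMF.bind_apply]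
  refine tsum_congr fun a => ?_
  by_cases ha : p a = 0
  · simp [ha]
  · rw [h a ((PMF.mem_support_iff _ _).2 ha)]

namespace PTM

/-- The distribution of the configuration `t` steps after the configuration `o`. -/
noncomputable def runFrom (M : PTM) (O : Oracle) : ℕ → Option M.Cfg → PMF (Option M.Cfg)
  | 0, o => PMF.pure o
  | t + 1, o => (M.stepOpt O o).bind (runFrom M O t)

theorem runFrom_succ (M : PTM) (O : Oracle) (t : ℕ) (o : Option M.Cfg) :
    M.runFrom O (t + 1) o = (M.runFrom O t o).bind (M.stepOpt O) := by
  induction t generalizing o with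
  | zero => simp [runFrom]
  | succ t ih =>
    calc (M.stepOpt O o).bind (M.runFrom O (t + 1))
        = (M.stepOpt O o).bind fun o' => (M.runFrom O t o').bind (M.stepOpt O) := by
          rw [funext ih]
      _ = _ := (PMF.bind_bind _ _ _).symm

theorem run_eq_runFrom (M : PTM) (O : Oracle) (w : List Bool) (t : ℕ) :
    M.run O w t = M.runFrom O t (some (M.init w)) := by
  induction t with
  | zero => rfl
  | succ t ih => rw [runFrom_succ, ← ih]; rfl

/-- From the configuration `o`, the machine surely stops (or gets stuck) within `T` steps, and
its result has the law `ν`. -/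
def Yields (M : PTM) (O : Oracle) (o : Option M.Cfg) (T : ℕ) (ν : PMF (Option (List Bool))) :
    Prop :=
  ∀ t, T ≤ t → (∀ c, some c ∈ (M.runFrom O t o).support → c.1 = M.halt) ∧
    (M.runFrom O t o).map M.result = ν

variable {M : PTM} {O : Oracle}

theorem Yields.mono {o : Option M.Cfg} {T T' : ℕ} {ν : PMF (Option (List Bool))}
    (h : Yields M O o T ν) (hT : T ≤ T') : Yields M O o T' ν :=
  fun t ht => h t (hT.trans ht)

theorem Yields.step {o : Option M.Cfg} {T : ℕ} {ν : Option M.Cfg → PMF (Option (List Bool))}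
    (h : ∀ o' ∈ (M.stepOpt O o).support, Yields M O o' T (ν o')) :
    Yields M O o (T + 1) ((M.stepOpt O o).bind ν) := by
  intro t ht
  obtain ⟨t, rfl⟩ : ∃ s, t = s + 1 := ⟨t - 1, by omega⟩
  refine ⟨fun c hc => ?_, ?_⟩
  · rw [runFrom, PMF.mem_support_bind_iff] at hc
    obtain ⟨o', ho', hc⟩ := hc
    exact (h o' ho' t (by omega)).1 c hc
  · rw [runFrom, PMF.map_bind]
    exact pmf_bind_congr _ _ _ fun o' ho' => (h o' ho' t (by omega)).2

theorem yields_none : Yields M O none 0 (PMF.pure none) := by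
  have h : ∀ t, M.runFrom O t none = PMF.pure none := by
    intro t
    induction t with
    | zero => rfl
    | succ t ih => rw [runFrom_succ, ih, PMF.pure_bind]; rfl
  intro t _
  rw [h]
  refine ⟨fun c hc => ?_, ?_⟩
  · simp at hc
  · rw [PMF.pure_map]; rfl

theorem yields_halt {c : M.Cfg} (hc : c.1 = M.halt) :
    Yields M O (some c) 0 (PMF.pure (some (c.2 M.output))) := by
  have h : ∀ t, M.runFrom O t (some c) = PMF.pure (some c) := by
    intro t
    induction t with
    | zero => rfl
    | succ t ih =>
      rw [runFrom_succ, ih, PMF.pure_bind]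
      simp [stepOpt, PTM.step, hc]
  intro t _
  rw [h]
  refine ⟨fun c' hc' => ?_, ?_⟩
  · simp at hc'
    rw [hc', hc]
  · rw [PMF.pure_map]; simp [result, hc]

theorem Yields.outLaw_eq {w : List Bool} {T : ℕ} {ν : PMF (Option (List Bool))}
    (h : Yields M O (some (M.init w)) T ν) : M.outLaw O w = ν := by
  have hs : ∀ y, M.outLaw O w (some y) = ν (some y) := by
    intro y
    change M.outProb O w y = _
    have hm := M.monotone_result O w y
    refine le_antisymm (iSup_le fun t => ?_) ?_
    · refine (hm (le_max_left t T)).trans (le_of_eq ?_)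
      dsimp only
      rw [run_eq_runFrom, (h _ (le_max_right t T)).2]
    · refine le_trans (le_of_eq ?_) (le_iSup _ T)
      rw [run_eq_runFrom, (h _ le_rfl).2]
  have hn : ∀ p : PMF (Option (List Bool)), p none = 1 - ∑' y, p (some y) := by
    intro p
    have h1 := p.tsum_coe
    rw [← (Equiv.optionEquivSumPUnit.{0, 0} (List Bool)).symm.tsum_eq,
      Summable.tsum_sum ENNReal.summable ENNReal.summable, add_comm] at h1
    simp only [Equiv.optionEquivSumPUnit_symm_inl, Equiv.optionEquivSumPUnit_symm_inr,
      tsum_fintype, Finset.univ_unique, Finset.sum_const, Finset.card_singleton, one_smul] at h1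
    refine ENNReal.eq_sub_of_add_eq ?_ h1
    exact ne_top_of_le_ne_top ENNReal.one_ne_top (h1 ▸ le_add_self)
  ext o
  cases o with
  | some y => exact hs y
  | none => rw [hn, hn ν]; simp only [hs]

end PTM

/-! ### A programming language for the machines -/

/-- The contents of the tapes, numbered by all natural numbers. -/
abbrev Store : Type := ℕ → List Bool

/-- Structured programs without oracle calls. The test `p` of a branching or of a loop is applied
to the symbol scanned on the tape `i`. -/
inductive Cmd where
  | act (i : ℕ) (a : TapeAct) : Cmd
  | coin (i : ℕ) : Cmd
  | seq (c d : Cmd) : Cmd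
  | ite (i : ℕ) (p : Option Bool → Bool) (c d : Cmd) : Cmd
  | loop (i : ℕ) (p : Option Bool → Bool) (c : Cmd) : Cmd

namespace Cmd

/-- The control states of a program, without its exit. -/
def St : Cmd → Type
  | act _ _ => Unit
  | coin _ => Unit
  | seq c d => c.St ⊕ d.St
  | ite _ _ c d => Option (c.St ⊕ d.St)
  | loop _ _ c => Option c.St

instance finite_St : (c : Cmd) → Finite c.St
  | act _ _ => inferInstanceAs (Finite Unit)
  | coin _ => inferInstanceAs (Finite Unit)
  | seq c d => by
    have := finite_St c; have := finite_St d
    exact inferInstanceAs (Finite (c.St ⊕ d.St))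
  | ite _ _ c d => by
    have := finite_St c; have := finite_St d
    exact inferInstanceAs (Finite (Option (c.St ⊕ d.St)))
  | loop _ _ c => by
    have := finite_St c
    exact inferInstanceAs (Finite (Option c.St))

/-- The initial state of a program. -/
def entry : (c : Cmd) → c.St
  | act _ _ => ()
  | coin _ => ()
  | seq c _ => Sum.inl c.entry
  | ite _ _ _ _ => none
  | loop _ _ _ => none

/-- All tapes mentioned in the program have numbers below `bound`. -/
def bound : Cmd → ℕ
  | act i _ => i + 1
  | coin i => i + 1
  | seq c d => max c.bound d.bound
  | ite i _ c d => max (i + 1) (max c.bound d.bound)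
  | loop i _ c => max (i + 1) c.bound

/-- One step of a program in the state `s`; the new state `none` is the exit. -/
def trans : (c : Cmd) → c.St → (ℕ → Option Bool) → Bool → Option c.St × (ℕ → TapeAct)
  | act i a, _, _, _ => (none, fun j => if j = i then a else .keep)
  | coin i, _, _, b => (none, fun j => if j = i then .push b else .keep)
  | seq c d, Sum.inl s, h, b =>
    (some ((c.trans s h b).1.elim (Sum.inr d.entry) Sum.inl), (c.trans s h b).2)
  | seq _ d, Sum.inr s, h, b => ((d.trans s h b).1.map Sum.inr, (d.trans s h b).2)
  | ite i p c d, none, h, _ =>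
    (some (some (if p (h i) then Sum.inl c.entry else Sum.inr d.entry)), fun _ => .keep)
  | ite _ _ c _, some (Sum.inl s), h, b =>
    ((c.trans s h b).1.map fun s' => some (Sum.inl s'), (c.trans s h b).2)
  | ite _ _ _ d, some (Sum.inr s), h, b =>
    ((d.trans s h b).1.map fun s' => some (Sum.inr s'), (d.trans s h b).2)
  | loop i p c, none, h, _ => (if p (h i) then some (some c.entry) else none, fun _ => .keep)
  | loop _ _ c, some s, h, b => (some (c.trans s h b).1, (c.trans s h b).2)

end Cmd

/-- The symbols scanned on all tapes, of which only the first `K` exist. -/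
def extend {K : ℕ} (h : Fin K → Option Bool) : ℕ → Option Bool :=
  fun j => if hj : j < K then h ⟨j, hj⟩ else none

/-- The program `c` is a part of the machine `M`: its states are represented in `M` by `e`, and
its exit leads to the state `x`. -/
structure Emb (M : PTM) (c : Cmd) (e : c.St → M.Q) (x : M.Q) : Prop where
  bound_le : c.bound ≤ M.tapes
  ne_halt : ∀ s, e s ≠ M.halt
  ne_ask : ∀ s, e s ≠ M.ask
  δ_eq : ∀ s h b, M.δ (e s) h b =
    ((c.trans s (extend h) b).1.elim x e, fun i : Fin M.tapes => (c.trans s (extend h) b).2 i)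

/-- The configuration of `M` with state `q` and tape contents `σ`. -/
def conf (M : PTM) (q : M.Q) (σ : Store) : Option M.Cfg := some (q, fun i => σ i)

/-- Started in `σ`, the program `c` takes at most `t` steps, for all outcomes of its coins, and
the final tape contents have the law `μ`. (This is stated in terms of what the machine of which
`c` is a part yields.) -/
def Sem (c : Cmd) (σ : Store) (μ : PMF Store) (t : ℕ) : Prop :=
  ∀ (M : PTM) (O : Oracle) (e : c.St → M.Q) (x : M.Q), Emb M c e x →
    ∀ (T : ℕ) (ν : Store → PMF (Option (List Bool))),
      (∀ σ' ∈ μ.support, PTM.Yields M O (conf M x σ') T (ν σ')) →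
        PTM.Yields M O (conf M (e c.entry) σ) (T + t) (μ.bind ν)

/-- The deterministic case of `Sem`. -/
def Runs (c : Cmd) (σ σ' : Store) (t : ℕ) : Prop := Sem c σ (PMF.pure σ') t

theorem Sem.mono {c : Cmd} {σ : Store} {μ : PMF Store} {t t' : ℕ} (h : Sem c σ μ t)
    (ht : t ≤ t') : Sem c σ μ t' :=
  fun M O e x he T ν hν => (h M O e x he T ν hν).mono (by omega)

/-- An ordinary step of a machine. -/
theorem stepOpt_conf {M : PTM} {O : Oracle} {q : M.Q} (h1 : q ≠ M.halt) (h2 : q ≠ M.ask)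
    (σ : Store) : M.stepOpt O (conf M q σ) = (PMF.uniformOfFintype Bool).map fun b =>
      let d := M.δ q (fun i => (σ i).head?) b
      some (d.1, fun i => (d.2 i).apply (σ i)) := by
  simp only [conf, PTM.stepOpt, PTM.step, h1, h2, if_false]

/-- The ordinary step of a machine within a program. -/
theorem Emb.stepOpt {M : PTM} {O : Oracle} {c : Cmd} {e : c.St → M.Q} {x : M.Q}
    (he : Emb M c e x) (s : c.St) (σ : Store) :
    M.stepOpt O (conf M (e s) σ) = (PMF.uniformOfFintype Bool).map fun b =>
      let d := c.trans s (extend fun i : Fin M.tapes => (σ i).head?) b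
      conf M (d.1.elim x e) fun i => (d.2 i).apply (σ i) := by
  rw [stepOpt_conf (he.ne_halt s) (he.ne_ask s)]
  simp only [he.δ_eq, conf]

/-- A step that does not depend on the coin. -/
theorem Emb.yields_det {M : PTM} {O : Oracle} {c : Cmd} {e : c.St → M.Q} {x : M.Q}
    (he : Emb M c e x) (s : c.St) (σ : Store) (q : M.Q) (σ' : Store)
    (h : ∀ b, (c.trans s (extend fun i : Fin M.tapes => (σ i).head?) b).1.elim x e = q ∧
      ∀ i, ((c.trans s (extend fun i : Fin M.tapes => (σ i).head?) b).2 i).apply (σ i) = σ' i)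
    {T : ℕ} {ν : PMF (Option (List Bool))} (hν : PTM.Yields M O (conf M q σ') T ν) :
    PTM.Yields M O (conf M (e s) σ) (T + 1) ν := by
  have h1 : M.stepOpt O (conf M (e s) σ) = PMF.pure (conf M q σ') := by
    rw [he.stepOpt]
    have : ∀ b, (let d := c.trans s (extend fun i : Fin M.tapes => (σ i).head?) b
      conf M (d.1.elim x e) fun i => (d.2 i).apply (σ i)) = conf M q σ' := by
      intro b
      simp only [(h b).1, (h b).2]
    simp only at this
    simp only [this]
    exact PMF.map_const _ _
  have h2 := PTM.Yields.step (M := M) (O := O) (o := conf M (e s) σ) (T := T) (ν := fun _ => ν)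
    (by rw [h1]; intro o' ho'; simp at ho'; rw [ho']; exact hν)
  simpa using h2

theorem extend_head {K : ℕ} (σ : Store) {i : ℕ} (hi : i < K) :
    extend (fun i : Fin K => (σ i).head?) i = (σ i).head? := by
  simp [extend, hi]

theorem runs_act (i : ℕ) (a : TapeAct) (σ : Store) :
    Runs (.act i a) σ (Function.update σ i (a.apply (σ i))) 1 := by
  intro M O e x he T ν hν
  rw [PMF.pure_bind]
  refine he.yields_det _ σ x _ (fun b => ⟨rfl, fun j => ?_⟩) (hν _ (by simp))
  by_cases hj : j = i
  · subst hj; simp [Cmd.trans]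
  · simp [Cmd.trans, hj, TapeAct.apply]

theorem sem_coin (i : ℕ) (σ : Store) :
    Sem (.coin i) σ
      ((PMF.uniformOfFintype Bool).map fun b => Function.update σ i (b :: σ i)) 1 := by
  intro M O e x he T ν hν
  have h1 : M.stepOpt O (conf M (e (Cmd.coin i).entry) σ) =
      ((PMF.uniformOfFintype Bool).map fun b => Function.update σ i (b :: σ i)).map
        (conf M x) := by
    rw [he.stepOpt, PMF.map_comp]
    congr 1
    funext b
    simp only [Cmd.trans, Option.elim_none, Function.comp]
    congr 1
    funext j
    by_cases hj : j = i
    · subst hj; simp [TapeAct.apply]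
    · simp [hj, TapeAct.apply]
  -- the law of the result depends on the configuration only, although `ν` takes a store
  intro t ht
  obtain ⟨t, rfl⟩ : ∃ s, t = s + 1 := ⟨t - 1, by omega⟩
  rw [PTM.runFrom, h1, PMF.bind_map]
  refine ⟨fun c hc => ?_, ?_⟩
  · rw [PMF.mem_support_bind_iff] at hc
    obtain ⟨σ', ho', hc⟩ := hc
    exact (hν σ' ho' t (by omega)).1 c hc
  · rw [PMF.map_bind]
    exact pmf_bind_congr _ _ _ fun o' ho' => (hν o' ho' t (by omega)).2

theorem Sem.seq {c d : Cmd} {σ : Store} {μ : PMF Store} {κ : Store → PMF Store} {s t : ℕ}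
    (hc : Sem c σ μ s) (hd : ∀ σ' ∈ μ.support, Sem d σ' (κ σ') t) :
    Sem (.seq c d) σ (μ.bind κ) (s + t) := by
  intro M O e x he T ν hν
  have h1 : Emb M c (fun s => e (Sum.inl s)) (e (Sum.inr d.entry)) :=
    ⟨(le_max_left _ _).trans he.bound_le, fun _ => he.ne_halt _, fun _ => he.ne_ask _,
      fun s h b => by
        refine (he.δ_eq _ h b).trans ?_
        simp only [Cmd.trans]
        cases (c.trans s (extend h) b).1 <;> rfl⟩
  have h2 : Emb M d (fun s => e (Sum.inr s)) x :=
    ⟨(le_max_right _ _).trans he.bound_le, fun _ => he.ne_halt _, fun _ => he.ne_ask _,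
      fun s h b => by
        refine (he.δ_eq _ h b).trans ?_
        simp only [Cmd.trans]
        cases (d.trans s (extend h) b).1 <;> rfl⟩
  rw [PMF.bind_bind, show T + (s + t) = T + t + s by omega]
  refine hc M O _ _ h1 (T + t) (fun σ' => (κ σ').bind ν) fun σ' hσ' => ?_
  exact hd σ' hσ' M O _ _ h2 T ν fun σ'' hσ'' =>
    hν _ ((PMF.mem_support_bind_iff _ _ _).2 ⟨σ', hσ', hσ''⟩)

theorem Runs.seq {c d : Cmd} {σ σ' σ'' : Store} {s t : ℕ} (hc : Runs c σ σ' s)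
    (hd : Runs d σ' σ'' t) : Runs (.seq c d) σ σ'' (s + t) := by
  have h := Sem.seq (κ := fun _ => PMF.pure σ'') hc
    (fun τ hτ => by simp at hτ; rw [hτ]; exact hd)
  rwa [PMF.pure_bind] at h

theorem Runs.seq_sem {c d : Cmd} {σ σ' : Store} {μ : PMF Store} {s t : ℕ} (hc : Runs c σ σ' s)
    (hd : Sem d σ' μ t) : Sem (.seq c d) σ μ (s + t) := by
  have h := Sem.seq (κ := fun _ => μ) hc (fun τ hτ => by simp at hτ; rw [hτ]; exact hd)
  rwa [PMF.pure_bind] at h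

theorem Sem.ite_true {i : ℕ} {p : Option Bool → Bool} {c d : Cmd} {σ : Store} {μ : PMF Store}
    {t : ℕ} (hp : p (σ i).head? = true) (h : Sem c σ μ t) : Sem (.ite i p c d) σ μ (t + 1) := by
  intro M O e x he T ν hν
  have hb := he.bound_le
  simp only [Cmd.bound, max_le_iff] at hb
  have h1 : Emb M c (fun s => e (some (Sum.inl s))) x :=
    ⟨hb.2.1, fun _ => he.ne_halt _, fun _ => he.ne_ask _,
      fun s h b => by
        refine (he.δ_eq _ h b).trans ?_
        simp only [Cmd.trans]
        cases (c.trans s (extend h) b).1 <;> rfl⟩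
  refine he.yields_det none σ _ σ (fun b => ⟨?_, fun j => rfl⟩) (h M O _ x h1 T ν hν)
  simp only [Cmd.trans]
  rw [extend_head σ hb.1, hp]
  rfl

theorem Sem.ite_false {i : ℕ} {p : Option Bool → Bool} {c d : Cmd} {σ : Store} {μ : PMF Store}
    {t : ℕ} (hp : p (σ i).head? = false) (h : Sem d σ μ t) : Sem (.ite i p c d) σ μ (t + 1) := by
  intro M O e x he T ν hν
  have hb := he.bound_le
  simp only [Cmd.bound, max_le_iff] at hb
  have h1 : Emb M d (fun s => e (some (Sum.inr s))) x :=
    ⟨hb.2.2, fun _ => he.ne_halt _, fun _ => he.ne_ask _,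
      fun s h b => by
        refine (he.δ_eq _ h b).trans ?_
        simp only [Cmd.trans]
        cases (d.trans s (extend h) b).1 <;> rfl⟩
  refine he.yields_det none σ _ σ (fun b => ⟨?_, fun j => rfl⟩) (h M O _ x h1 T ν hν)
  simp only [Cmd.trans]
  rw [extend_head σ hb.1, hp]
  rfl

theorem Runs.loop_exit {i : ℕ} {p : Option Bool → Bool} {c : Cmd} {σ : Store}
    (hp : p (σ i).head? = false) : Runs (.loop i p c) σ σ 1 := by
  intro M O e x he T ν hν
  have hb := he.bound_le
  simp only [Cmd.bound, max_le_iff] at hb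
  rw [PMF.pure_bind]
  refine he.yields_det none σ x σ (fun b => ⟨?_, fun j => rfl⟩) (hν _ (by simp))
  simp only [Cmd.trans]
  rw [extend_head σ hb.1, hp]
  rfl

theorem Sem.loop_step {i : ℕ} {p : Option Bool → Bool} {c : Cmd} {σ : Store} {μ : PMF Store}
    {κ : Store → PMF Store} {s t : ℕ}
    (hp : p (σ i).head? = true) (hc : Sem c σ μ s)
    (hl : ∀ σ' ∈ μ.support, Sem (.loop i p c) σ' (κ σ') t) :
    Sem (.loop i p c) σ (μ.bind κ) (s + t + 1) := by
  intro M O e x he T ν hν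
  have hb := he.bound_le
  simp only [Cmd.bound, max_le_iff] at hb
  have h1 : Emb M c (fun s => e (some s)) (e none) :=
    ⟨hb.2, fun _ => he.ne_halt _, fun _ => he.ne_ask _,
      fun s h b => by
        refine (he.δ_eq _ h b).trans ?_
        simp only [Cmd.trans]
        cases (c.trans s (extend h) b).1 <;> rfl⟩
  rw [PMF.bind_bind, show T + (s + t + 1) = T + t + s + 1 by omega]
  refine he.yields_det none σ _ σ (fun b => ⟨?_, fun j => rfl⟩)
    (hc M O _ _ h1 (T + t) (fun σ' => (κ σ').bind ν) fun σ' hσ' => ?_)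
  · simp only [Cmd.trans]
    rw [extend_head σ hb.1, hp]
    rfl
  · exact hl σ' hσ' M O _ _ he T ν fun σ'' hσ'' =>
      hν _ ((PMF.mem_support_bind_iff _ _ _).2 ⟨σ', hσ', hσ''⟩)

/-- A loop whose number of iterations is determined by the store: `Inv j` holds when `j`
iterations remain. -/
theorem Sem.loop {i : ℕ} {p : Option Bool → Bool} {c : Cmd} {s : ℕ} (Inv : ℕ → Store → Prop)
    (κ : ℕ → Store → PMF Store) (β : Store → PMF Store)
    (hκ0 : ∀ σ, Inv 0 σ → κ 0 σ = PMF.pure σ ∧ p (σ i).head? = false)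
    (hκ : ∀ j σ, Inv (j + 1) σ → κ (j + 1) σ = (β σ).bind (κ j) ∧ p (σ i).head? = true ∧
      Sem c σ (β σ) s ∧ ∀ σ' ∈ (β σ).support, Inv j σ')
    {n : ℕ} {σ : Store} (h : Inv n σ) : Sem (.loop i p c) σ (κ n σ) (n * (s + 1) + 1) := by
  induction n generalizing σ with
  | zero =>
    obtain ⟨h1, h2⟩ := hκ0 σ h
    rw [h1]
    rw [zero_mul, zero_add]
    exact Runs.loop_exit h2
  | succ n ih =>
    obtain ⟨h1, h2, h3, h4⟩ := hκ n σ h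
    rw [h1]
    refine (Sem.loop_step h2 h3 fun σ' hσ' => ih (h4 σ' hσ')).mono (le_of_eq ?_)
    ring

theorem Runs.loop {i : ℕ} {p : Option Bool → Bool} {c : Cmd} {s : ℕ} (f : ℕ → Store) (n : ℕ)
    (h0 : p (f 0 i).head? = false)
    (h : ∀ j < n, p (f (j + 1) i).head? = true ∧ Runs c (f (j + 1)) (f j) s) :
    Runs (.loop i p c) (f n) (f 0) (n * (s + 1) + 1) := by
  induction n with
  | zero => simpa using Runs.loop_exit h0
  | succ n ih =>
    have h1 := Sem.loop_step (κ := fun _ => PMF.pure (f 0)) (h n n.lt_succ_self).1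
      (h n n.lt_succ_self).2 (fun σ' hσ' => by
        simp only [PMF.support_pure, Set.mem_singleton_iff] at hσ'
        rw [hσ']
        exact ih fun j hj => h j (by omega))
    rw [PMF.pure_bind] at h1
    exact h1.mono (by ring_nf; rfl)

/-! ### Basic programs -/

namespace Cmd

/-- Push the bit `b` on the tape `i`. -/
def push (i : ℕ) (b : Bool) : Cmd := act i (.push b)

/-- Remove the scanned symbol of the tape `i`. -/
def pop (i : ℕ) : Cmd := act i .pop

/-- Move the scanned symbol, if there is one, from the tape `i` to the tape `j`. -/
def moveBit (i j : ℕ) : Cmd :=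
  ite i (fun o => o == some true) (seq (push j true) (pop i))
    (ite i Option.isSome (seq (push j false) (pop i)) (act 0 .keep))

/-- `while the tape i is not empty do c`. -/
def whileSome (i : ℕ) (c : Cmd) : Cmd := loop i Option.isSome c

/-- Move all symbols from the tape `i` to the tape `j`; this reverses their order. -/
def moveAll (i j : ℕ) : Cmd := whileSome i (moveBit i j)

end Cmd

open Cmd

theorem Sem.congr {c : Cmd} {σ : Store} {μ μ' : PMF Store} {t t' : ℕ} (h : Sem c σ μ t)
    (hμ : μ = μ') (ht : t ≤ t') : Sem c σ μ' t' := hμ ▸ h.mono ht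

theorem Runs.congr {c : Cmd} {σ τ τ' : Store} {t t' : ℕ} (h : Runs c σ τ t)
    (hτ : τ = τ') (ht : t ≤ t') : Runs c σ τ' t' := hτ ▸ Sem.mono h ht

theorem runs_push (i : ℕ) (b : Bool) (σ : Store) :
    Runs (push i b) σ (Function.update σ i (b :: σ i)) 1 := runs_act i _ σ

theorem runs_pop (i : ℕ) (σ : Store) :
    Runs (pop i) σ (Function.update σ i (σ i).tail) 1 := runs_act i _ σ

theorem runs_moveBit {i j : ℕ} (hij : i ≠ j) {σ : Store} {b : Bool} {l : List Bool}
    (h : σ i = b :: l) :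
    Runs (moveBit i j) σ (Function.update (Function.update σ j (b :: σ j)) i l) 4 := by
  have h1 : ∀ b', Runs (seq (push j b') (pop i)) σ
      (Function.update (Function.update σ j (b' :: σ j)) i l) 2 := fun b' =>
    ((runs_push j b' σ).seq (runs_pop i _)).congr (by simp [hij, h]) le_rfl
  cases b with
  | true => exact (Sem.ite_true (by simp [h]) (h1 true)).mono (by norm_num)
  | false => exact Sem.ite_false (by simp [h]) (Sem.ite_true (by simp [h]) (h1 false))

theorem runs_moveBit_nil {i j : ℕ} {σ : Store} (h : σ i = []) :
    Runs (moveBit i j) σ σ 4 := by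
  have h1 : Runs (act 0 .keep) σ σ 1 :=
    (runs_act 0 .keep σ).congr (by simp [TapeAct.apply]) le_rfl
  exact (Sem.ite_false (by simp [h]) (Sem.ite_false (by simp [h]) h1)).mono (by norm_num)

theorem Runs.loop_step {i : ℕ} {p : Option Bool → Bool} {c : Cmd} {σ σ' σ'' : Store} {s t : ℕ}
    (hp : p (σ i).head? = true) (hc : Runs c σ σ' s) (hl : Runs (.loop i p c) σ' σ'' t) :
    Runs (.loop i p c) σ σ'' (s + t + 1) := by
  have h := Sem.loop_step (κ := fun _ => PMF.pure σ'') hp hc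
    (fun τ hτ => by simp at hτ; rw [hτ]; exact hl)
  rwa [PMF.pure_bind] at h

theorem runs_moveAll {i j : ℕ} (hij : i ≠ j) (σ : Store) :
    Runs (moveAll i j) σ
      (Function.update (Function.update σ j ((σ i).reverse ++ σ j)) i [])
      (5 * (σ i).length + 1) := by
  generalize hl : σ i = l
  induction l generalizing σ with
  | nil =>
    refine (Runs.loop_exit (by simp [hl])).congr ?_ le_rfl
    rw [List.reverse_nil, List.nil_append, Function.update_eq_self, ← hl,
      Function.update_eq_self]
  | cons b l ih =>
    refine (Runs.loop_step (by simp [hl]) (runs_moveBit hij hl)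
      (ih _ (by simp))).congr ?_ (by simp; omega)
    funext r
    by_cases h1 : r = i
    · simp [h1]
    · by_cases h2 : r = j
      · subst h2; simp [h1]
      · simp [h1, h2]

/-! ### Arithmetic in unary -/

/-- Arithmetic expressions. Variables are numbered from the innermost binder; the last bound of
`sum e f` is excluded, that is, `sum e f` stands for `∑ j < e, f j`. -/
inductive Expr where
  | var (v : ℕ) : Expr
  | one : Expr
  | add (e f : Expr) : Expr
  | tsub (e f : Expr) : Expr
  | sum (e f : Expr) : Expr

/-- Make `a` the value of the variable `0`, and shift the other variables. -/
def bindVar {α : Type} (a : α) (v : ℕ → α) : ℕ → α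
  | 0 => a
  | i + 1 => v i

namespace Expr

/-- The value of an expression. -/
def val : Expr → (ℕ → ℕ) → ℕ
  | var i, v => v i
  | one, _ => 1
  | add e f, v => e.val v + f.val v
  | tsub e f, v => e.val v - f.val v
  | sum e f, v => ∑ j ∈ Finset.range (e.val v), f.val (bindVar j v)

/-- A program that writes the value of an expression in unary on the empty tape `b`. The value of
the variable `i` is the length of the tape `ρ i`. All tapes with larger numbers than `b` serve as
work space. In a sum, the loop counter counts down through the values of the bound variable. -/
def eval : Expr → (ℕ → ℕ) → ℕ → Cmd
  | var i, ρ, b =>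
    seq (whileSome (ρ i) (seq (moveBit (ρ i) (b + 1)) (push b false))) (moveAll (b + 1) (ρ i))
  | one, _, b => push b false
  | add e f, ρ, b => seq (e.eval ρ b) (seq (f.eval ρ (b + 1)) (moveAll (b + 1) b))
  | tsub e f, ρ, b =>
    seq (e.eval ρ b) (seq (f.eval ρ (b + 1)) (whileSome (b + 1) (seq (pop (b + 1)) (pop b))))
  | sum e f, ρ, b =>
    seq (e.eval ρ (b + 1)) (whileSome (b + 1)
      (seq (pop (b + 1)) (seq (f.eval (bindVar (b + 1) ρ) (b + 2)) (moveAll (b + 2) b))))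

end Expr

theorem zeros_append (m n : ℕ) : zeros m ++ zeros n = zeros (m + n) := by
  simp [zeros]

theorem length_zeros (n : ℕ) : (zeros n).length = n := by simp [zeros]

theorem reverse_zeros (n : ℕ) : (zeros n).reverse = zeros n := by simp [zeros]

theorem zeros_succ (n : ℕ) : zeros (n + 1) = false :: zeros n := rfl

theorem zeros_zero : zeros 0 = [] := rfl

theorem runs_copy {i b : ℕ} (hi : i < b) (σ : Store) :
    Runs (whileSome i (seq (moveBit i (b + 1)) (push b false))) σ
      (Function.update (Function.update (Function.update σ b (zeros (σ i).length ++ σ b))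
        (b + 1) ((σ i).reverse ++ σ (b + 1))) i []) (6 * (σ i).length + 1) := by
  generalize hl : σ i = l
  induction l generalizing σ with
  | nil =>
    refine (Runs.loop_exit (by simp [hl])).congr ?_ le_rfl
    funext r
    by_cases h1 : r = i
    · simp [h1, hl]
    · simp only [Function.update_apply]; split_ifs <;> simp_all [zeros]
  | cons a l ih =>
    refine (Runs.loop_step (by simp [hl]) ((runs_moveBit (j := b + 1) (by omega) hl).seq
      (runs_push b false _))
      (ih _ (by simp [show i ≠ b by omega]))).congr ?_ (by simp; omega)
    funext r
    have hz : zeros l.length ++ [false] = zeros (l.length + 1) := by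
      rw [← zeros_append]; rfl
    have hz2 : ∀ l', zeros l.length ++ false :: l' = zeros (l.length + 1) ++ l' := by
      intro l'; rw [← hz]; simp
    by_cases h1 : r = i
    · simp [h1]
    · by_cases h2 : r = b
      · subst h2; simp [h1, hz2]
      · by_cases h3 : r = b + 1
        · subst h3; simp [h1, hi.ne']
        · simp [h1, h2, h3]

theorem runs_sub (b : ℕ) (m n : ℕ) (σ : Store) (h1 : σ b = zeros m) (h2 : σ (b + 1) = zeros n) :
    Runs (whileSome (b + 1) (seq (pop (b + 1)) (pop b))) σ
      (Function.update (Function.update σ b (zeros (m - n))) (b + 1) []) (3 * n + 1) := by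
  induction n generalizing σ m with
  | zero =>
    refine (Runs.loop_exit (by simp [h2, zeros])).congr ?_ le_rfl
    funext r
    simp only [Function.update_apply]; split_ifs <;> simp_all [zeros]
  | succ n ih =>
    refine (Runs.loop_step (by simp [h2, zeros]) ((runs_pop _ _).seq (runs_pop _ _))
      (ih (m - 1) _ (by simp [h1, zeros]) (by simp [h2, zeros]))).congr ?_ (by omega)
    funext r
    by_cases h1 : r = b + 1
    · simp [h1]
    · by_cases h2 : r = b
      · simp [h2, show m - 1 - n = m - (n + 1) by omega]
      · simp [h1, h2]

/-- Expressions are evaluated in polynomial time. -/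
theorem Expr.runs_eval (e : Expr) : ∃ p : Polynomial ℕ, ∀ (ρ : ℕ → ℕ) (b : ℕ) (σ : Store) (s : ℕ),
    (∀ i, ρ i < b) → (∀ i, (σ (ρ i)).length ≤ s) → (∀ i, b ≤ i → σ i = []) →
      e.val (fun i => (σ (ρ i)).length) ≤ p.eval s ∧
      Runs (e.eval ρ b) σ
        (Function.update σ b (zeros (e.val fun i => (σ (ρ i)).length))) (p.eval s) := by
  induction e with
  | var i =>
    refine ⟨20 * Polynomial.X + 20, fun ρ b σ s h1 h2 h3 => ⟨?_, ?_⟩⟩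
    · have := h2 i
      simp [val]; omega
    · have hb := h1 i
      have h4 := h2 i
      refine ((runs_copy (h1 i) σ).seq (runs_moveAll (by omega) _)).congr ?_ ?_
      · funext r
        by_cases hr1 : r = ρ i
        · subst hr1
          simp [h3 (b + 1) (by omega), show ρ i ≠ b + 1 by omega, show b + 1 ≠ ρ i by omega,
            hb.ne]
        · by_cases hr2 : r = b
          · subst hr2; simp [hr1, h3 r le_rfl, val]
          · by_cases hr3 : r = b + 1
            · subst hr3; simp [h3]
            · simp [hr1, hr2, hr3]
      · simp [h3 (b + 1) (by omega), show b + 1 ≠ ρ i by omega]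
        omega
  | one =>
    refine ⟨1, fun ρ b σ s h1 h2 h3 => ⟨by simp [val], ?_⟩⟩
    refine (runs_push b false σ).congr ?_ (by simp)
    rw [h3 b le_rfl]; rfl
  | add e f ihe ihf =>
    obtain ⟨p, hp⟩ := ihe
    obtain ⟨q, hq⟩ := ihf
    refine ⟨p + 6 * q + 1, fun ρ b σ s h1 h2 h3 => ?_⟩
    obtain ⟨he, he'⟩ := hp ρ b σ s h1 h2 h3
    set u := e.val fun i => (σ (ρ i)).length with hu
    have hρ : ∀ i, Function.update σ b (zeros u) (ρ i) = σ (ρ i) := fun i => by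
      simp [(h1 i).ne]
    obtain ⟨hf, hf'⟩ := hq ρ (b + 1) (Function.update σ b (zeros u)) s
      (fun i => (h1 i).trans (Nat.lt_succ_self b)) (fun i => by rw [hρ]; exact h2 i)
      (fun i hi => by simp [show i ≠ b by omega, h3 i (by omega)])
    simp only [hρ] at hf hf'
    set w := f.val fun i => (σ (ρ i)).length with hw
    refine ⟨?_, ?_⟩
    · simp only [val, Polynomial.eval_add, Polynomial.eval_mul, Polynomial.eval_ofNat,
        Polynomial.eval_one]
      omega
    · refine (he'.seq (hf'.seq (runs_moveAll (by omega) _))).congr ?_ ?_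
      · funext r
        by_cases hr1 : r = b
        · subst hr1; simp [val, reverse_zeros, zeros_append, ← hu, ← hw, add_comm]
        · by_cases hr2 : r = b + 1
          · subst hr2; simp [h3]
          · simp [hr1, hr2]
      · simp [length_zeros]
        omega
  | tsub e f ihe ihf =>
    obtain ⟨p, hp⟩ := ihe
    obtain ⟨q, hq⟩ := ihf
    refine ⟨p + 6 * q + 1, fun ρ b σ s h1 h2 h3 => ?_⟩
    obtain ⟨he, he'⟩ := hp ρ b σ s h1 h2 h3
    set u := e.val fun i => (σ (ρ i)).length with hu
    have hρ : ∀ i, Function.update σ b (zeros u) (ρ i) = σ (ρ i) := fun i => by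
      simp [(h1 i).ne]
    obtain ⟨hf, hf'⟩ := hq ρ (b + 1) (Function.update σ b (zeros u)) s
      (fun i => (h1 i).trans (Nat.lt_succ_self b)) (fun i => by rw [hρ]; exact h2 i)
      (fun i hi => by simp [show i ≠ b by omega, h3 i (by omega)])
    simp only [hρ] at hf hf'
    set w := f.val fun i => (σ (ρ i)).length with hw
    refine ⟨?_, ?_⟩
    · simp only [val, Polynomial.eval_add, Polynomial.eval_mul, Polynomial.eval_ofNat,
        Polynomial.eval_one]
      omega
    · refine (he'.seq (hf'.seq (runs_sub b u w _ (by simp) (by simp)))).congr ?_ ?_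
      · funext r
        by_cases hr1 : r = b
        · subst hr1; simp [val, ← hu, ← hw]
        · by_cases hr2 : r = b + 1
          · subst hr2; simp [h3]
          · simp [hr1, hr2]
      · simp
        omega
  | sum e f ihe ihf =>
    obtain ⟨p, hp⟩ := ihe
    obtain ⟨q, hq⟩ := ihf
    refine ⟨p + p * (6 * q.comp (Polynomial.X + p) + 3) + 1, fun ρ b σ s h1 h2 h3 => ?_⟩
    obtain ⟨he, he'⟩ := hp ρ (b + 1) σ s (fun i => (h1 i).trans (Nat.lt_succ_self b)) h2
      (fun i hi => h3 i (by omega))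
    set u := e.val fun i => (σ (ρ i)).length with hu
    set F : ℕ → ℕ := fun j => f.val (bindVar j fun i => (σ (ρ i)).length) with hF
    -- the contents of the tapes when `j` values of the bound variable are left
    set g : ℕ → Store := fun j => Function.update
      (Function.update σ b (zeros (∑ a ∈ Finset.Ico j u, F a))) (b + 1) (zeros j) with hg
    have hbody : ∀ j < u, F j ≤ q.eval (s + p.eval s) ∧
        Runs (seq (pop (b + 1)) (seq (f.eval (bindVar (b + 1) ρ) (b + 2)) (moveAll (b + 2) b)))
          (g (j + 1)) (g j) (6 * q.eval (s + p.eval s) + 2) := by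
      intro j hj
      set τ := Function.update (g (j + 1)) (b + 1) (zeros j) with hτ
      have hlen : (fun i => (τ (bindVar (b + 1) ρ i)).length) =
          bindVar j fun i => (σ (ρ i)).length := by
        funext i
        cases i with
        | zero => simp [bindVar, hτ, length_zeros]
        | succ i =>
          have := h1 i
          simp [bindVar, hτ, hg, show ρ i ≠ b + 1 by omega, show ρ i ≠ b by omega]
      obtain ⟨hf, hf'⟩ := hq (bindVar (b + 1) ρ) (b + 2) τ (s + p.eval s)
        (fun i => by
          cases i with
          | zero => simp [bindVar]
          | succ i => have := h1 i; simp only [bindVar]; omega)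
        (fun i => by
          refine (congrFun hlen i).trans_le ?_
          cases i with
          | zero => simp only [bindVar]; omega
          | succ i => exact (h2 i).trans (Nat.le_add_right _ _))
        (fun i hi => by
          simp [hτ, hg, show i ≠ b + 1 by omega, show i ≠ b by omega, h3 i (by omega)])
      rw [hlen] at hf hf'
      have hpop : Runs (pop (b + 1)) (g (j + 1)) τ 1 :=
        (runs_pop (b + 1) _).congr (by rw [hτ]; congr 1; simp [hg, zeros]) le_rfl
      refine ⟨hf, (hpop.seq (hf'.seq (runs_moveAll (by omega) _))).congr ?_ ?_⟩
      · funext r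
        by_cases hr1 : r = b
        · subst hr1
          simp only [hg, hτ, ne_eq, Function.update_self, Function.update_of_ne,
            show r ≠ r + 2 by omega, show r ≠ r + 1 by omega, not_false_eq_true, reverse_zeros,
            zeros_append]
          rw [Finset.sum_eq_sum_Ico_succ_bot hj]
        · by_cases hr2 : r = b + 1
          · subst hr2; simp [hg, hτ]
          · by_cases hr3 : r = b + 2
            · subst hr3; simp [hg, h3]
            · simp [hr1, hr2, hr3, hg, hτ]
      · have : F j ≤ q.eval (s + p.eval s) := hf
        simp only [Function.update_self, length_zeros]
        omega
    have hsum : ∑ j ∈ Finset.range u, F j ≤ u * q.eval (s + p.eval s) := by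
      have := Finset.sum_le_card_nsmul (Finset.range u) F (q.eval (s + p.eval s))
        fun j hj => (hbody j (Finset.mem_range.1 hj)).1
      simpa using this
    have hpq : u * q.eval (s + p.eval s) ≤ p.eval s * q.eval (s + p.eval s) :=
      Nat.mul_le_mul_right _ he
    refine ⟨?_, ?_⟩
    · refine (hsum.trans hpq).trans ?_
      simp only [Polynomial.eval_add, Polynomial.eval_mul, Polynomial.eval_comp,
        Polynomial.eval_ofNat, Polynomial.eval_one, Polynomial.eval_X]
      nlinarith
    · have hg1 : Function.update σ (b + 1) (zeros u) = g u := by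
        simp [hg, zeros_zero, ← h3 b le_rfl]
      rw [hg1] at he'
      refine (he'.seq (Runs.loop g u (by simp [hg, zeros]) fun j hj =>
        ⟨by simp [hg, zeros], (hbody j hj).2⟩)).congr ?_ ?_
      · funext r
        by_cases hr2 : r = b + 1
        · subst hr2; simp [hg, zeros, h3]
        · by_cases hr1 : r = b
          · subst hr1; simp [hg, val, ← hu, hF]
          · simp [hg, hr1, hr2]
      · simp only [Polynomial.eval_add, Polynomial.eval_mul, Polynomial.eval_comp,
          Polynomial.eval_ofNat, Polynomial.eval_one, Polynomial.eval_X]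
        have := Nat.mul_le_mul_right (6 * q.eval (s + p.eval s) + 2 + 1) he
        rw [show 6 * q.eval (s + p.eval s) + 3 = 6 * q.eval (s + p.eval s) + 2 + 1 from rfl]
        omega

/-! ### Machines that call the oracle in a loop -/

/-- The state set of `loopMachine`: the states of the three programs, the test of the loop, and
`halt`, `ask` and `answer`. -/
abbrev LoopSt (A B C : Cmd) : Type := A.St ⊕ B.St ⊕ C.St ⊕ Fin 4

/-- The machine `A; while tape 6 is not empty do (B; ask the oracle; C)`. The tapes `0`, `1`, `2`
and `3` are those for the input, the output, the query and the reply. -/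
noncomputable def loopMachine (A B C : Cmd) : PTM :=
  let K := max 7 (max A.bound (max B.bound C.bound))
  { Q := LoopSt A B C
    finQ := Fintype.ofFinite _
    tapes := K
    start := Sum.inl A.entry
    halt := Sum.inr (Sum.inr (Sum.inr 1))
    ask := Sum.inr (Sum.inr (Sum.inr 2))
    answer := Sum.inr (Sum.inr (Sum.inr 3))
    input := ⟨0, by omega⟩
    output := ⟨1, by omega⟩
    query := ⟨2, by omega⟩
    reply := ⟨3, by omega⟩
    δ := fun q h b =>
      match q with
      | Sum.inl s =>
        ((A.trans s (extend h) b).1.elim (Sum.inr (Sum.inr (Sum.inr 0))) Sum.inl,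
          fun i => (A.trans s (extend h) b).2 i)
      | Sum.inr (Sum.inl s) =>
        ((B.trans s (extend h) b).1.elim (Sum.inr (Sum.inr (Sum.inr 2)))
            fun s => Sum.inr (Sum.inl s),
          fun i => (B.trans s (extend h) b).2 i)
      | Sum.inr (Sum.inr (Sum.inl s)) =>
        ((C.trans s (extend h) b).1.elim (Sum.inr (Sum.inr (Sum.inr 0)))
            fun s => Sum.inr (Sum.inr (Sum.inl s)),
          fun i => (C.trans s (extend h) b).2 i)
      | Sum.inr (Sum.inr (Sum.inr 0)) =>
        (if (h ⟨6, by omega⟩).isSome then Sum.inr (Sum.inl B.entry)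
          else Sum.inr (Sum.inr (Sum.inr 1)), fun _ => .keep)
      | Sum.inr (Sum.inr (Sum.inr _)) =>
        (Sum.inr (Sum.inr (Sum.inl C.entry)), fun _ => .keep) }

variable {A B C : Cmd} {O : Oracle}

theorem emb_fst : Emb (loopMachine A B C) A (fun s => Sum.inl s)
    (Sum.inr (Sum.inr (Sum.inr 0)) : LoopSt A B C) :=
  ⟨by simp only [loopMachine]; omega, fun _ => by simp [loopMachine],
    fun _ => by simp [loopMachine], fun _ _ _ => rfl⟩

theorem emb_snd : Emb (loopMachine A B C) B (fun s => Sum.inr (Sum.inl s))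
    (Sum.inr (Sum.inr (Sum.inr 2)) : LoopSt A B C) :=
  ⟨by simp only [loopMachine]; omega, fun _ => by simp [loopMachine],
    fun _ => by simp [loopMachine], fun _ _ _ => rfl⟩

theorem emb_trd : Emb (loopMachine A B C) C (fun s => Sum.inr (Sum.inr (Sum.inl s)))
    (Sum.inr (Sum.inr (Sum.inr 0)) : LoopSt A B C) :=
  ⟨by simp only [loopMachine]; omega, fun _ => by simp [loopMachine],
    fun _ => by simp [loopMachine], fun _ _ _ => rfl⟩

/-- The state of `loopMachine` in which the condition of the loop is tested. -/
def testSt (A B C : Cmd) : (loopMachine A B C).Q :=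
  (Sum.inr (Sum.inr (Sum.inr 0)) : LoopSt A B C)

theorem yields_det {M : PTM} {q q' : M.Q} {σ : Store} (h1 : q ≠ M.halt) (h2 : q ≠ M.ask)
    (h : ∀ b, M.δ q (fun i => (σ i).head?) b = (q', fun _ => .keep))
    {T : ℕ} {ν : PMF (Option (List Bool))} (hν : PTM.Yields M O (conf M q' σ) T ν) :
    PTM.Yields M O (conf M q σ) (T + 1) ν := by
  have h1 : M.stepOpt O (conf M q σ) = PMF.pure (conf M q' σ) := by
    rw [stepOpt_conf h1 h2]
    simp only [h]
    exact PMF.map_const _ _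
  have h2 := PTM.Yields.step (M := M) (O := O) (o := conf M q σ) (T := T) (ν := fun _ => ν)
    (by rw [h1]; intro o' ho'; simp at ho'; rw [ho']; exact hν)
  simpa using h2

theorem yields_test_nil {σ : Store} (h : σ 6 = []) :
    PTM.Yields (loopMachine A B C) O (conf _ (testSt A B C) σ) 1 (PMF.pure (some (σ 1))) := by
  refine yields_det (q' := (loopMachine A B C).halt) ?_ ?_ (fun b => ?_) (PTM.yields_halt rfl)
  · simp [loopMachine, testSt]
  · simp [loopMachine, testSt]
  · simp [loopMachine, testSt, h]

theorem update_restrict {K n : ℕ} (h : n < K) (σ : Store) (l : List Bool) :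
    Function.update (fun i : Fin K => σ i) ⟨n, h⟩ l =
      fun i : Fin K => Function.update σ n l i := by
  funext i
  simp [Function.update_apply, Fin.ext_iff]

theorem stepOpt_ask (σ : Store) :
    (loopMachine A B C).stepOpt O (conf _ (loopMachine A B C).ask σ) =
      (O (σ 2)).map fun o => o.elim none fun a => conf _ (loopMachine A B C).answer
        (Function.update (Function.update σ 2 []) 3 a) := by
  have hne : (loopMachine A B C).ask ≠ (loopMachine A B C).halt := by simp [loopMachine]
  simp only [conf, PTM.stepOpt, PTM.step, hne, if_false, if_true]
  refine congrArg (fun f => (O (σ 2)).map f) ?_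
  funext o
  cases o with
  | none => rfl
  | some a =>
    refine congrArg some (congrArg (Prod.mk (loopMachine A B C).answer) ?_)
    rw [← update_restrict (by simp only [loopMachine]; omega),
      ← update_restrict (by simp only [loopMachine]; omega)]
    rfl

theorem yields_answer {σ : Store} {T : ℕ} {ν : PMF (Option (List Bool))}
    (h : PTM.Yields (loopMachine A B C) O
      (conf _ (Sum.inr (Sum.inr (Sum.inl C.entry)) : LoopSt A B C) σ) T ν) :
    PTM.Yields (loopMachine A B C) O (conf _ (loopMachine A B C).answer σ) (T + 1) ν := by
  refine yields_det ?_ ?_ (fun b => ?_) h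
  · simp [loopMachine]
  · simp [loopMachine]
  · simp [loopMachine]

/-- One iteration of the loop. -/
theorem yields_test_cons {σ : Store} (h : σ 6 ≠ []) {μ : PMF Store} {tB tC T : ℕ}
    (hB : Sem B σ μ tB) {κ : Store → List Bool → PMF Store}
    (hC : ∀ σ' ∈ μ.support, ∀ a,
      Sem C (Function.update (Function.update σ' 2 []) 3 a) (κ σ' a) tC)
    {ν : Store → PMF (Option (List Bool))}
    (hν : ∀ σ' ∈ μ.support, ∀ a, ∀ σ'' ∈ (κ σ' a).support,
      PTM.Yields (loopMachine A B C) O (conf _ (testSt A B C) σ'') T (ν σ'')) :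
    PTM.Yields (loopMachine A B C) O (conf _ (testSt A B C) σ) (T + (tB + tC + 3))
      (μ.bind fun σ' => (O (σ' 2)).bind fun o =>
        o.elim (PMF.pure none) fun a => (κ σ' a).bind ν) := by
  rw [show T + (tB + tC + 3) = T + tC + 1 + 1 + tB + 1 by omega]
  refine yields_det (q' := (Sum.inr (Sum.inl B.entry) : LoopSt A B C)) ?_ ?_ (fun b => ?_)
    (hB _ O _ _ emb_snd _ _ fun σ' hσ' => ?_)
  · simp [loopMachine, testSt]
  · simp [loopMachine, testSt]
  · simp [loopMachine, testSt, h]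
  have hall : ∀ o : Option (List Bool), PTM.Yields (loopMachine A B C) O
      (o.elim none fun a => conf _ (loopMachine A B C).answer
        (Function.update (Function.update σ' 2 []) 3 a)) (T + tC + 1)
      (o.elim (PMF.pure none) fun a => (κ σ' a).bind ν) := by
    intro o
    cases o with
    | none => exact PTM.yields_none.mono (by omega)
    | some a =>
      exact yields_answer (hC σ' hσ' a _ O _ _ emb_trd _ _ fun σ'' hσ'' => hν σ' hσ' a σ'' hσ'')
  intro t ht
  obtain ⟨t, rfl⟩ : ∃ s, t = s + 1 := ⟨t - 1, by omega⟩
  have hrun : (loopMachine A B C).runFrom O (t + 1) (conf _ (loopMachine A B C).ask σ') =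
      (O (σ' 2)).bind fun o => (loopMachine A B C).runFrom O t (o.elim none fun a =>
        conf _ (loopMachine A B C).answer (Function.update (Function.update σ' 2 []) 3 a)) := by
    rw [PTM.runFrom, stepOpt_ask, PMF.bind_map]
    rfl
  change (∀ c, some c ∈ ((loopMachine A B C).runFrom O (t + 1)
      (conf _ (loopMachine A B C).ask σ')).support → _) ∧
    ((loopMachine A B C).runFrom O (t + 1) (conf _ (loopMachine A B C).ask σ')).map _ = _
  rw [hrun]
  refine ⟨fun c hc => ?_, ?_⟩
  · obtain ⟨o, -, hc⟩ := (PMF.mem_support_bind_iff _ _ _).1 hc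
    exact (hall o t (by omega)).1 c hc
  · rw [PMF.map_bind]
    exact congrArg _ (funext fun o => (hall o t (by omega)).2)

/-- The whole computation, from the tape contents after `A` on. -/
theorem yields_loopMachine {w : List Bool} {μ : PMF Store} {tA T : ℕ}
    (hA : Sem A (Function.update (fun _ => []) 0 w) μ tA)
    {ν : Store → PMF (Option (List Bool))}
    (hν : ∀ σ ∈ μ.support, PTM.Yields (loopMachine A B C) O (conf _ (testSt A B C) σ) T (ν σ)) :
    PTM.Yields (loopMachine A B C) O (some ((loopMachine A B C).init w)) (T + tA)
      (μ.bind ν) := by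
  have h := hA (loopMachine A B C) O _ _ emb_fst T ν hν
  have hi : conf (loopMachine A B C) (Sum.inl A.entry : LoopSt A B C)
      (Function.update (fun _ => []) 0 w) = some ((loopMachine A B C).init w) := by
    refine congrArg some (Prod.ext rfl ?_)
    exact (update_restrict (K := (loopMachine A B C).tapes) (n := 0)
      (by simp only [loopMachine]; omega) (fun _ => []) w).symm
  rwa [hi] at h

theorem runsInTime_of_yields {M : PTM} {T : ℕ → ℕ}
    (h : ∀ x k, 1 ≤ k → ∃ t ν, t ≤ T (x.length + k) ∧
      PTM.Yields M O (some (M.init (inst x k))) t ν) : M.RunsInTime O T := by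
  intro x k hk c hc
  obtain ⟨t, ν, ht, hY⟩ := h x k hk
  rw [PTM.run_eq_runFrom] at hc
  exact (hY _ ht).1 c hc

/-! ### The tapes of the two machines -/

/-- The contents of the tapes `0`, …, `9`; the remaining tapes are empty. `xs` holds `x` in reverse,
`cnt` the number of remaining iterations, `acc` an index of a block, and `s` the counter of a
loop. -/
structure Regs where
  inp : List Bool := []
  out : List Bool := []
  qry : List Bool := []
  rep : List Bool := []
  xs : List Bool := []
  tmp : List Bool := []
  cnt : List Bool := []
  acc : List Bool := []
  coin : List Bool := []
  s : List Bool := []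

namespace Regs

/-- The store with these tape contents. -/
def toStore (r : Regs) : Store
  | 0 => r.inp
  | 1 => r.out
  | 2 => r.qry
  | 3 => r.rep
  | 4 => r.xs
  | 5 => r.tmp
  | 6 => r.cnt
  | 7 => r.acc
  | 8 => r.coin
  | 9 => r.s
  | _ => []

variable (r : Regs) (l : List Bool)

@[simp] theorem toStore_0 : r.toStore 0 = r.inp := rfl
@[simp] theorem toStore_1 : r.toStore 1 = r.out := rfl
@[simp] theorem toStore_2 : r.toStore 2 = r.qry := rfl
@[simp] theorem toStore_3 : r.toStore 3 = r.rep := rfl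
@[simp] theorem toStore_4 : r.toStore 4 = r.xs := rfl
@[simp] theorem toStore_5 : r.toStore 5 = r.tmp := rfl
@[simp] theorem toStore_6 : r.toStore 6 = r.cnt := rfl
@[simp] theorem toStore_7 : r.toStore 7 = r.acc := rfl
@[simp] theorem toStore_8 : r.toStore 8 = r.coin := rfl
@[simp] theorem toStore_9 : r.toStore 9 = r.s := rfl

theorem toStore_of_ge {i : ℕ} (hi : 10 ≤ i) : r.toStore i = [] := by
  obtain ⟨j, rfl⟩ := Nat.exists_eq_add_of_le' hi
  rfl

@[simp] theorem update_0 : Function.update r.toStore 0 l = { r with inp := l }.toStore := by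
  funext j; match j with | 0 | 1 | 2 | 3 | 4 | 5 | 6 | 7 | 8 | 9 | _ + 10 => rfl
@[simp] theorem update_1 : Function.update r.toStore 1 l = { r with out := l }.toStore := by
  funext j; match j with | 0 | 1 | 2 | 3 | 4 | 5 | 6 | 7 | 8 | 9 | _ + 10 => rfl
@[simp] theorem update_2 : Function.update r.toStore 2 l = { r with qry := l }.toStore := by
  funext j; match j with | 0 | 1 | 2 | 3 | 4 | 5 | 6 | 7 | 8 | 9 | _ + 10 => rfl
@[simp] theorem update_3 : Function.update r.toStore 3 l = { r with rep := l }.toStore := by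
  funext j; match j with | 0 | 1 | 2 | 3 | 4 | 5 | 6 | 7 | 8 | 9 | _ + 10 => rfl
@[simp] theorem update_4 : Function.update r.toStore 4 l = { r with xs := l }.toStore := by
  funext j; match j with | 0 | 1 | 2 | 3 | 4 | 5 | 6 | 7 | 8 | 9 | _ + 10 => rfl
@[simp] theorem update_5 : Function.update r.toStore 5 l = { r with tmp := l }.toStore := by
  funext j; match j with | 0 | 1 | 2 | 3 | 4 | 5 | 6 | 7 | 8 | 9 | _ + 10 => rfl
@[simp] theorem update_6 : Function.update r.toStore 6 l = { r with cnt := l }.toStore := by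
  funext j; match j with | 0 | 1 | 2 | 3 | 4 | 5 | 6 | 7 | 8 | 9 | _ + 10 => rfl
@[simp] theorem update_7 : Function.update r.toStore 7 l = { r with acc := l }.toStore := by
  funext j; match j with | 0 | 1 | 2 | 3 | 4 | 5 | 6 | 7 | 8 | 9 | _ + 10 => rfl
@[simp] theorem update_8 : Function.update r.toStore 8 l = { r with coin := l }.toStore := by
  funext j; match j with | 0 | 1 | 2 | 3 | 4 | 5 | 6 | 7 | 8 | 9 | _ + 10 => rfl
@[simp] theorem update_9 : Function.update r.toStore 9 l = { r with s := l }.toStore := by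
  funext j; match j with | 0 | 1 | 2 | 3 | 4 | 5 | 6 | 7 | 8 | 9 | _ + 10 => rfl

/-- The tapes that hold the values of the variables of expressions: `k`, `|x|`, the index of a
block, and a coin. -/
def var : ℕ → ℕ
  | 1 => 4
  | 2 => 7
  | 3 => 8
  | _ => 0

theorem var_lt (i : ℕ) : var i < 9 := by
  unfold var; split <;> norm_num

/-- The values of the variables of expressions. -/
def env (r : Regs) (i : ℕ) : ℕ := (r.toStore (var i)).length

/-- All variables of expressions have values at most `b`. -/
def EnvLe (r : Regs) (b : ℕ) : Prop :=
  r.inp.length ≤ b ∧ r.xs.length ≤ b ∧ r.acc.length ≤ b ∧ r.coin.length ≤ b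

theorem EnvLe.env_le {r : Regs} {b : ℕ} (h : r.EnvLe b) (i : ℕ) : r.env i ≤ b := by
  obtain ⟨h0, h1, h2, h3⟩ := h
  unfold env var
  split <;> assumption

end Regs

open Regs

/-- Evaluation into the tape `9`. -/
theorem Expr.runs_eval_s (e : Expr) : ∃ p : Polynomial ℕ, ∀ (r : Regs) (b : ℕ), r.s = [] →
    r.EnvLe b → e.val r.env ≤ p.eval b ∧
      Runs (e.eval Regs.var 9) r.toStore { r with s := zeros (e.val r.env) }.toStore
        (p.eval b) := by
  obtain ⟨p, hp⟩ := e.runs_eval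
  refine ⟨p, fun r b hs hb => ?_⟩
  have := hp Regs.var 9 r.toStore b Regs.var_lt (fun i => hb.env_le i) (fun i hi => ?_)
  · rw [Regs.update_9] at this
    exact this
  · rcases Nat.lt_or_ge i 10 with h | h
    · obtain rfl : i = 9 := by omega
      exact hs
    · exact r.toStore_of_ge h

/-- Replace the contents of the tape `7` by the value of an expression. -/
def assign (e : Expr) : Cmd :=
  seq (e.eval Regs.var 10) (seq (whileSome 7 (pop 7)) (moveAll 10 7))

theorem runs_clear (i : ℕ) (σ : Store) :
    Runs (whileSome i (pop i)) σ (Function.update σ i []) (2 * (σ i).length + 1) := by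
  generalize hl : σ i = l
  induction l generalizing σ with
  | nil => exact (Runs.loop_exit (by simp [hl])).congr (by simp [← hl]) le_rfl
  | cons b l ih =>
    refine (Runs.loop_step (by simp [hl]) (runs_pop i σ) (ih _ (by simp [hl]))).congr
      (by simp) (by simp; omega)

theorem runs_assign (e : Expr) : ∃ p : Polynomial ℕ, ∀ (r : Regs) (b : ℕ), r.EnvLe b →
    Runs (assign e) r.toStore { r with acc := zeros (e.val r.env) }.toStore (p.eval b) := by
  obtain ⟨p, hp⟩ := e.runs_eval
  refine ⟨p + 2 * Polynomial.X + 5 * p + 2, fun r b hb => ?_⟩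
  obtain ⟨h1, h2⟩ := hp Regs.var 10 r.toStore b (fun i => (Regs.var_lt i).trans (by norm_num))
    (fun i => hb.env_le i) (fun i hi => r.toStore_of_ge hi)
  refine (h2.seq ((runs_clear 7 _).seq (runs_moveAll (by norm_num) _))).congr ?_ ?_
  · funext j
    match j with
    | 7 => simp [reverse_zeros]; rfl
    | 0 | 1 | 2 | 3 | 4 | 5 | 6 | 8 | 9 => simp
    | j + 10 =>
      rw [Regs.toStore_of_ge _ (by omega)]
      by_cases hj : j = 0
      · simp [hj]
      · simp [hj, r.toStore_of_ge]
  · have := hb.2.2.1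
    simp [length_zeros]
    omega

/-- Read the input `⟨x, 0 ^ k⟩`. -/
def parse : Cmd := seq (loop 0 (fun o => o == some true) (seq (pop 0) (moveBit 0 4))) (pop 0)

theorem runs_parse (x : List Bool) (k : ℕ) :
    Runs parse ({ inp := inst x k } : Regs).toStore
      ({ inp := zeros k, xs := x.reverse } : Regs).toStore (6 * x.length + 2) := by
  have h : ∀ (x y : List Bool), Runs (loop 0 (fun o => o == some true) (seq (pop 0) (moveBit 0 4)))
      ({ inp := inst x k, xs := y } : Regs).toStore
      ({ inp := false :: zeros k, xs := x.reverse ++ y } : Regs).toStore (6 * x.length + 1) := by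
    intro x
    induction x with
    | nil =>
      intro y
      exact Runs.loop_exit (by simp [inst, pair])
    | cons b x ih =>
      intro y
      have h1 : inst (b :: x) k = true :: b :: inst x k := by simp [inst, pair]
      refine (Runs.loop_step (by simp [h1]) ((runs_pop _ _).seq
        ((runs_moveBit (b := b) (l := inst x k) (by norm_num) (by simp [h1])).congr (by
          simp) le_rfl)) (ih (b :: y))).congr (by simp) (by simp; omega)
  refine ((h x []).seq (runs_pop _ _)).congr (by simp) (by omega)

/-- Put `x`, with flags, on top of the query, without destroying `x`. -/
def emitX : Cmd :=
  seq (whileSome 4 (seq (ite 4 (fun o => o == some true) (push 2 true) (push 2 false))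
    (seq (moveBit 4 5) (push 2 true)))) (moveAll 5 4)

theorem runs_emitX (r : Regs) (x : List Bool) (hx : r.xs = x.reverse) (ht : r.tmp = []) :
    Runs emitX r.toStore
      { r with qry := x.flatMap (fun b => [true, b]) ++ r.qry }.toStore
      (13 * x.length + 2) := by
  have h : ∀ (y : List Bool) (r : Regs), r.xs = y →
      Runs (whileSome 4 (seq (ite 4 (fun o => o == some true) (push 2 true) (push 2 false))
        (seq (moveBit 4 5) (push 2 true)))) r.toStore
        { r with
          qry := y.reverse.flatMap (fun b => [true, b]) ++ r.qry
          tmp := y.reverse ++ r.tmp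
          xs := [] }.toStore (8 * y.length + 1) := by
    intro y
    induction y with
    | nil =>
      intro r hr
      exact (Runs.loop_exit (by simp [hr])).congr (by cases r; simp_all) le_rfl
    | cons b y ih =>
      intro r hr
      have h1 : Runs (ite 4 (fun o => o == some true) (push 2 true) (push 2 false)) r.toStore
          { r with qry := b :: r.qry }.toStore 2 := by
        cases b
        · exact Sem.ite_false (by simp [hr]) ((runs_push _ _ _).congr (by simp) le_rfl)
        · exact Sem.ite_true (by simp [hr]) ((runs_push _ _ _).congr (by simp) le_rfl)
      refine (Runs.loop_step (by simp [hr]) (h1.seq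
        (((runs_moveBit (b := b) (l := y) (by norm_num) (by simp [hr])).congr (by
          simp; rfl) le_rfl).seq ((runs_push _ _ _).congr (by simp; rfl) le_rfl))) (ih _ rfl)).congr
            ?_ (by simp; omega)
      simp
  refine ((h _ r hx).seq ((runs_moveAll (by norm_num) _))).congr ?_ ?_
  · cases r; simp_all
  · simp [ht]; omega

/-- Move the first bits of the reply to the output; their number is the contents of tape `9`. -/
def emitReply : Cmd := seq (whileSome 9 (seq (pop 9) (moveBit 3 5))) (moveAll 5 1)

theorem runs_emitReply (r : Regs) (m : ℕ) (hs : r.s = zeros m) (ht : r.tmp = []) :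
    Runs emitReply r.toStore
      { r with s := [], rep := r.rep.drop m, out := r.rep.take m ++ r.out }.toStore
      (11 * m + 2) := by
  have h : ∀ (m : ℕ) (r : Regs), r.s = zeros m →
      Runs (whileSome 9 (seq (pop 9) (moveBit 3 5))) r.toStore
        { r with s := [], rep := r.rep.drop m, tmp := (r.rep.take m).reverse ++ r.tmp }.toStore
        (6 * m + 1) := by
    intro m
    induction m with
    | zero =>
      intro r hr
      refine (Runs.loop_exit (by simp [hr, zeros])).congr ?_ le_rfl
      cases r; simp_all [zeros]
    | succ m ih =>
      intro r hr
      cases hrep : r.rep with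
      | nil =>
        refine (Runs.loop_step (by simp [hr, zeros]) (((runs_pop _ _).congr (by
          simp [hr, zeros_succ]; rfl) le_rfl).seq (runs_moveBit_nil (by simp [hrep])))
            (ih _ (by rfl))).congr ?_ (by omega)
        simp [hrep]
      | cons b l =>
        refine (Runs.loop_step (by simp [hr, zeros]) (((runs_pop _ _).congr (by
          simp [hr, zeros_succ]; rfl) le_rfl).seq
            ((runs_moveBit (b := b) (l := l) (by norm_num) (by simp [hrep])).congr (by
            simp; rfl) le_rfl)) (ih _ (by rfl))).congr ?_ (by omega)
        simp
  refine ((h m r hs).seq (runs_moveAll (by norm_num) _)).congr ?_ ?_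
  · simp [ht]
  · simp [ht]
    omega

/-- Discard the first bits of the reply; their number is the contents of tape `9`. -/
def dropReply : Cmd := whileSome 9 (seq (pop 9) (pop 3))

theorem runs_dropReply (r : Regs) (m : ℕ) (hs : r.s = zeros m) :
    Runs dropReply r.toStore { r with s := [], rep := r.rep.drop m }.toStore (3 * m + 1) := by
  induction m generalizing r with
  | zero =>
    refine (Runs.loop_exit (by simp [hs, zeros])).congr ?_ le_rfl
    cases r; simp_all [zeros]
  | succ m ih =>
    refine (Runs.loop_step (by simp [hs, zeros]) (((runs_pop _ _).congr (by
          simp [hs, zeros_succ]; rfl) le_rfl).seq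
            ((runs_pop _ _).congr (by simp; rfl) le_rfl)) (ih _ (by rfl))).congr ?_ (by omega)
    simp

/-- Put a string of zeros, with or without flags, on top of the query; its length is the contents
of tape `9`. -/
def emitZeros (flags : Bool) : Cmd :=
  whileSome 9 (seq (pop 9) (if flags then seq (push 2 false) (push 2 true) else push 2 false))

theorem runs_emitZeros (flags : Bool) (r : Regs) (m : ℕ) (hs : r.s = zeros m) :
    Runs (emitZeros flags) r.toStore
      { r with
        s := []
        qry := (if flags then (zeros m).flatMap (fun b => [true, b]) else zeros m) ++
          r.qry }.toStore
      (4 * m + 1) := by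
  induction m generalizing r with
  | zero =>
    refine (Runs.loop_exit (by simp [hs, zeros])).congr ?_ le_rfl
    cases r; cases flags <;> simp_all [zeros]
  | succ m ih =>
    have hz : zeros (m + 1) = zeros m ++ [false] := by rw [← zeros_append]; rfl
    have h1 : Runs (if flags then seq (push 2 false) (push 2 true) else push 2 false)
        { r with s := zeros m }.toStore
        { r with
          s := zeros m
          qry := (if flags then [true, false] else [false]) ++ r.qry }.toStore 2 := by
      cases flags
      · exact (runs_push _ _ _).congr (by simp) (by norm_num)
      · exact ((runs_push _ _ _).seq (runs_push _ _ _)).congr (by simp) (by norm_num)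
    refine (Runs.loop_step (by simp [hs, zeros]) (((runs_pop _ _).congr (by
          simp [hs, zeros_succ]) le_rfl).seq h1) (ih _ (by rfl))).congr ?_ (by omega)
    cases flags <;> simp [hz]

/-! ### Functions given by expressions -/

namespace Expr

/-- Rename the variables. -/
def rename : Expr → (ℕ → ℕ) → Expr
  | var i, g => var (g i)
  | one, _ => one
  | add e f, g => add (e.rename g) (f.rename g)
  | tsub e f, g => tsub (e.rename g) (f.rename g)
  | sum e f, g => sum (e.rename g) (f.rename (bindVar 0 fun i => g i + 1))

theorem val_rename (e : Expr) (g : ℕ → ℕ) (v : ℕ → ℕ) :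
    (e.rename g).val v = e.val fun i => v (g i) := by
  induction e generalizing g v with
  | var i => rfl
  | one => rfl
  | add e f ihe ihf => simp only [rename, val, ihe, ihf]
  | tsub e f ihe ihf => simp only [rename, val, ihe, ihf]
  | sum e f ihe ihf =>
    simp only [rename, val, ihe, ihf]
    refine Finset.sum_congr rfl fun j _ => congrArg _ (funext fun i => ?_)
    cases i <;> rfl

end Expr

/-- `f`, a function of the values of the variables, is the value of an expression. -/
def Rep (f : (ℕ → ℕ) → ℕ) : Prop := ∃ e : Expr, ∀ v, e.val v = f v

namespace Rep

variable {f g : (ℕ → ℕ) → ℕ}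

theorem var (i : ℕ) : Rep fun v => v i := ⟨.var i, fun _ => rfl⟩

theorem one : Rep fun _ => 1 := ⟨.one, fun _ => rfl⟩

theorem add (hf : Rep f) (hg : Rep g) : Rep fun v => f v + g v := by
  obtain ⟨e, he⟩ := hf; obtain ⟨e', he'⟩ := hg
  exact ⟨.add e e', fun v => by simp only [Expr.val, he, he']⟩

theorem tsub (hf : Rep f) (hg : Rep g) : Rep fun v => f v - g v := by
  obtain ⟨e, he⟩ := hf; obtain ⟨e', he'⟩ := hg
  exact ⟨.tsub e e', fun v => by simp only [Expr.val, he, he']⟩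

theorem sum (hf : Rep f) (hg : Rep g) :
    Rep fun v => ∑ j ∈ Finset.range (f v), g (bindVar j v) := by
  obtain ⟨e, he⟩ := hf; obtain ⟨e', he'⟩ := hg
  exact ⟨.sum e e', fun v => by simp only [Expr.val, he, he']⟩

theorem shift (hf : Rep f) : Rep fun v => f fun i => v (i + 1) := by
  obtain ⟨e, he⟩ := hf
  exact ⟨e.rename (· + 1), fun v => by rw [Expr.val_rename, he]⟩

theorem mul (hf : Rep f) (hg : Rep g) : Rep fun v => f v * g v := by
  have h := hf.sum hg.shift
  simpa [bindVar] using h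

theorem zero : Rep fun _ => 0 := by simpa using one.tsub one

theorem const (n : ℕ) : Rep fun _ => n := by
  induction n with
  | zero => exact zero
  | succ n ih => exact ih.add one

theorem pow (hf : Rep f) (n : ℕ) : Rep fun v => f v ^ n := by
  induction n with
  | zero => simpa using one
  | succ n ih => simpa [pow_succ] using ih.mul hf

theorem poly (p : Polynomial ℕ) (hf : Rep f) : Rep fun v => p.eval (f v) := by
  induction p using Polynomial.induction_on' with
  | add p q hp hq => simpa using hp.add hq
  | monomial n a => simpa using (const a).mul (hf.pow n)

end Rep

/-- `numSamples`, computed without roots: `j < m * k ^ 2.1` if and only if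
`j ^ 10 < m ^ 10 * k ^ 21`, and the sum counts these `j`. (With truncated subtraction,
`1 - (1 - a)` is `1` if `a` is positive, and `0` otherwise.) -/
def countSamples (m k : ℕ) : ℕ :=
  ∑ j ∈ Finset.range (m ^ 10 * k ^ 21), (1 - (1 - (m ^ 10 * k ^ 21 - j ^ 10)))

theorem lt_numSamples {m k : ℕ} (hk : 1 ≤ k) (j : ℕ) :
    j < numSamples m k ↔ j ^ 10 < m ^ 10 * k ^ 21 := by
  have hk0 : (0 : ℝ) < k := by exact_mod_cast hk
  have h1 : (m : ℝ) / (1 / (k : ℝ)) ^ (2.1 : ℝ) = m * (k : ℝ) ^ (2.1 : ℝ) := by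
    rw [one_div, Real.inv_rpow hk0.le, div_inv_eq_mul]
  have h2 : ((m : ℝ) * (k : ℝ) ^ (2.1 : ℝ)) ^ 10 = (m : ℝ) ^ 10 * (k : ℝ) ^ 21 := by
    rw [mul_pow, ← Real.rpow_natCast ((k : ℝ) ^ (2.1 : ℝ)), ← Real.rpow_mul hk0.le,
      ← Real.rpow_natCast (k : ℝ) 21]
    norm_num
  rw [numSamples, Nat.lt_ceil, h1, ← pow_lt_pow_iff_left₀ (by positivity) (by positivity)
    (show (10 : ℕ) ≠ 0 by norm_num), h2]
  exact_mod_cast Iff.rfl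

theorem countSamples_eq {m k : ℕ} (hk : 1 ≤ k) : countSamples m k = numSamples m k := by
  have h1 : ∀ j, 1 - (1 - (m ^ 10 * k ^ 21 - j ^ 10)) =
      if j < numSamples m k then 1 else 0 := by
    intro j
    have := lt_numSamples (m := m) hk j
    split_ifs <;> omega
  have h2 : numSamples m k ≤ m ^ 10 * k ^ 21 := by
    by_contra! h
    have := (lt_numSamples hk _).1 h
    exact absurd (Nat.le_self_pow (by norm_num) _) (not_le.2 this)
  simp only [countSamples, h1]
  rw [Finset.sum_ite, Finset.sum_const_zero, add_zero, Finset.sum_const, smul_eq_mul, mul_one]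
  have : {j ∈ Finset.range (m ^ 10 * k ^ 21) | j < numSamples m k} =
      Finset.range (numSamples m k) := by
    ext j
    simp only [Finset.mem_filter, Finset.mem_range]
    omega
  rw [this, Finset.card_range]

theorem rep_countSamples {f g : (ℕ → ℕ) → ℕ} (hf : Rep f) (hg : Rep g) :
    Rep fun v => countSamples (f v) (g v) := by
  have hP : Rep fun v => f v ^ 10 * g v ^ 21 := (hf.pow 10).mul (hg.pow 21)
  have hj : Rep fun v => v 0 ^ 10 := (Rep.var 0).pow 10
  exact hP.sum (Rep.one.tsub (Rep.one.tsub (hP.shift.tsub hj)))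

/-! ### Uniformly random strings -/

/-- Push `n` random bits on the stack `l`. -/
noncomputable def pushCoins : ℕ → List Bool → PMF (List Bool)
  | 0, l => PMF.pure l
  | n + 1, l => (PMF.uniformOfFintype Bool).bind fun b => pushCoins n (b :: l)

theorem uniform_prod {α β : Type} [Fintype α] [Fintype β] [Nonempty α] [Nonempty β] :
    PMF.uniformOfFintype (α × β) =
      (PMF.uniformOfFintype α).bind fun a => (PMF.uniformOfFintype β).map (Prod.mk a) := by
  classical
  ext ⟨a, b⟩
  rw [PMF.bind_apply, tsum_eq_single a]
  · rw [PMF.map_apply, tsum_eq_single b]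
    · simp only [PMF.uniformOfFintype_apply, Fintype.card_prod, Nat.cast_mul, if_true]
      rw [ENNReal.mul_inv] <;> simp
    · intro b' hb'
      simp [Ne.symm hb']
  · intro a' ha'
    rw [PMF.map_apply]
    simp [Ne.symm ha']

theorem uniform_map_equiv {α β : Type} [Fintype α] [Fintype β] [Nonempty α] [Nonempty β]
    (e : α ≃ β) : (PMF.uniformOfFintype α).map e = PMF.uniformOfFintype β := by
  classical
  ext b
  rw [PMF.map_apply, tsum_eq_single (e.symm b)]
  · simp [Fintype.card_congr e]
  · intro a ha
    rw [if_neg]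
    rintro rfl
    simp at ha

theorem pushCoins_eq (n : ℕ) (l : List Bool) :
    pushCoins n l = (PMF.uniformOfFintype (Fin n → Bool)).map fun r => List.ofFn r ++ l := by
  induction n generalizing l with
  | zero =>
    simp only [pushCoins, List.ofFn_zero, List.nil_append]
    exact (PMF.map_const _ _).symm
  | succ n ih =>
    rw [← uniform_map_equiv (Fin.snocEquiv fun _ : Fin (n + 1) => Bool), uniform_prod, PMF.map_comp,
      PMF.map_bind, pushCoins]
    congr 1
    funext b
    rw [ih, PMF.map_comp]
    congr 1
    funext r
    simp only [Function.comp, Fin.snocEquiv_apply, List.ofFn_succ', Fin.snoc_castSucc,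
      Fin.snoc_last]
    simp

theorem sem_pushCoins {i j : ℕ} (hij : i ≠ j) (n : ℕ) (σ : Store) (h : σ i = zeros n) :
    Sem (whileSome i (seq (pop i) (coin j))) σ
      ((pushCoins n (σ j)).map fun l => Function.update (Function.update σ j l) i [])
      (3 * n + 1) := by
  induction n generalizing σ with
  | zero =>
    refine Sem.congr (Runs.loop_exit (by simp [h, zeros])) ?_ le_rfl
    rw [pushCoins, PMF.pure_map, Function.update_eq_self, ← zeros_zero, ← h,
      Function.update_eq_self]
  | succ n ih =>
    refine (Sem.loop_step (by simp [h, zeros]) ((runs_pop i σ).seq_sem (sem_coin j _))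
      (κ := fun σ => (pushCoins n (σ j)).map fun l =>
        Function.update (Function.update σ j l) i []) (t := 3 * n + 1)
      fun σ' hσ' => ih σ' ?_).congr ?_ (by omega)
    · rw [PMF.mem_support_map_iff] at hσ'
      obtain ⟨b, -, rfl⟩ := hσ'
      simp [hij, h, zeros_succ]
    · rw [PMF.bind_map, pushCoins, PMF.map_bind]
      congr 1
      funext b
      simp only [Function.comp, Function.update_self, ne_eq, hij.symm, not_false_eq_true,
        Function.update_of_ne]
      congr 1
      funext l
      funext a
      simp only [Function.update_apply]
      split_ifs <;> rfl

/-! ### The two machines -/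

/-- Prepend to `out`, `j` times, the first `m` bits of a fresh sample from `L`. -/
noncomputable def iterLaw (m : ℕ) (L : PMF (Option (List Bool))) :
    ℕ → List Bool → PMF (Option (List Bool))
  | 0, out => PMF.pure (some out)
  | j + 1, out => L.bind fun o => o.elim (PMF.pure none) fun a => iterLaw m L j (a.take m ++ out)

/-- The values of the variables when the index of a block and the coin are `0`. -/
def baseEnv (n k : ℕ) : ℕ → ℕ
  | 1 => n
  | 2 => 0
  | 3 => 0
  | _ => k

theorem env_base (r : Regs) (x : List Bool) (k : ℕ) (h1 : r.inp = zeros k) (h2 : r.xs = x.reverse)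
    (h3 : r.acc = []) (h4 : r.coin = []) : r.env = baseEnv x.length k := by
  funext i
  unfold env var baseEnv
  split <;> simp_all [length_zeros]

/-- Write the query `⟨x, 0 ^ k', r⟩`, where `r` is random, and where the length of `r` and `k'` are
given by expressions. -/
def askSample (eR eK : Expr) : Cmd :=
  seq (eR.eval Regs.var 9) (seq (whileSome 9 (seq (pop 9) (coin 2))) (seq (push 2 false)
    (seq (eK.eval Regs.var 9) (seq (emitZeros true) (seq (push 2 false) emitX)))))

theorem sem_askSample (eR eK : Expr) : ∃ p : Polynomial ℕ, ∀ (r : Regs) (x : List Bool) (k : ℕ),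
    r.inp = zeros k → r.xs = x.reverse → r.acc = [] → r.coin = [] → r.s = [] → r.tmp = [] →
    r.qry = [] →
      Sem (askSample eR eK) r.toStore
        ((PMF.uniformOfFintype (Fin (eR.val (baseEnv x.length k)) → Bool)).map fun u =>
          { r with qry := instR x (eK.val (baseEnv x.length k)) (List.ofFn u) }.toStore)
        (p.eval (x.length + k)) := by
  obtain ⟨p, hp⟩ := eR.runs_eval_s
  obtain ⟨q, hq⟩ := eK.runs_eval_s
  refine ⟨p + (3 * p + 1) + 1 + q + (4 * q + 1) + 1 + (13 * Polynomial.X + 2),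
    fun r x k h1 h2 h3 h4 h5 h6 h7 => ?_⟩
  set R := eR.val (baseEnv x.length k) with hR
  set K := eK.val (baseEnv x.length k) with hK
  obtain ⟨hp1, hp2⟩ := hp r (x.length + k) h5
    ⟨by simp [h1, length_zeros], by simp [h2], by simp [h3], by simp [h4]⟩
  rw [env_base r x k h1 h2 h3 h4, ← hR] at hp1 hp2
  have hcoins := sem_pushCoins (i := 9) (j := 2) (by norm_num) R
    ({ r with s := zeros R } : Regs).toStore rfl
  have hrest : ∀ l : List Bool, Runs (seq (push 2 false)
      (seq (eK.eval Regs.var 9) (seq (emitZeros true) (seq (push 2 false) emitX))))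
      ({ r with qry := l, s := [] } : Regs).toStore
      ({ r with qry := instR x K l } : Regs).toStore
      (1 + (q.eval (x.length + k) + ((4 * K + 1) + (1 + (13 * x.length + 2))))) := by
    intro l
    obtain ⟨hq1, hq2⟩ := hq { r with qry := false :: l } (x.length + k) h5
      ⟨by simp [h1, length_zeros], by simp [h2], by simp [h3], by simp [h4]⟩
    rw [env_base { r with qry := false :: l } x k h1 h2 h3 h4, ← hK] at hq1 hq2
    have e1 : Runs (push 2 false) ({ r with qry := l, s := [] } : Regs).toStore
        ({ r with qry := false :: l } : Regs).toStore 1 :=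
      (runs_push 2 false _).congr (by simp [h5]) le_rfl
    have e2 : Runs (emitZeros true) ({ r with qry := false :: l, s := zeros K } : Regs).toStore
        ({ r with qry := pair (zeros K) l } : Regs).toStore (4 * K + 1) :=
      (runs_emitZeros true _ K rfl).congr (by simp [pair, h5]) le_rfl
    have e3 : Runs (push 2 false) ({ r with qry := pair (zeros K) l } : Regs).toStore
        ({ r with qry := false :: pair (zeros K) l } : Regs).toStore 1 :=
      (runs_push 2 false _).congr (by simp) le_rfl
    have e4 : Runs emitX ({ r with qry := false :: pair (zeros K) l } : Regs).toStore
        ({ r with qry := instR x K l } : Regs).toStore (13 * x.length + 2) :=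
      runs_emitX _ x h2 h6
    exact e1.seq (hq2.seq (e2.seq (e3.seq e4)))
  obtain ⟨hq1, -⟩ := hq r (x.length + k) h5
    ⟨by simp [h1, length_zeros], by simp [h2], by simp [h3], by simp [h4]⟩
  rw [env_base r x k h1 h2 h3 h4, ← hK] at hq1
  refine (hp2.seq_sem (hcoins.seq (κ := fun σ => PMF.pure
    ({ r with qry := instR x K (σ 2) } : Regs).toStore)
    (t := 1 + (q.eval (x.length + k) + ((4 * K + 1) + (1 + (13 * x.length + 2)))))
    fun σ' hσ' => ?_)).congr ?_ ?_
  · obtain ⟨l, -, rfl⟩ := (PMF.mem_support_map_iff _ _ _).1 hσ'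
    simp only [update_2, update_9]
    exact hrest l
  · rw [pushCoins_eq, PMF.map_comp, PMF.bind_map, PMF.map]
    congr 1
    funext u
    simp [h7]
  · simp only [Polynomial.eval_add, Polynomial.eval_mul, Polynomial.eval_ofNat,
      Polynomial.eval_one, Polynomial.eval_X]
    omega

/-- Prepend the first bits of the reply to the output; their number is given by an expression. -/
def takeReply (eM : Expr) : Cmd := seq (pop 6) (seq (eM.eval Regs.var 9) emitReply)

theorem runs_takeReply (eM : Expr) : ∃ p : Polynomial ℕ, ∀ (r : Regs) (x : List Bool) (k : ℕ),
    r.inp = zeros k → r.xs = x.reverse → r.acc = [] → r.coin = [] → r.s = [] → r.tmp = [] →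
      Runs (takeReply eM) r.toStore
        { r with
          cnt := r.cnt.tail
          out := r.rep.take (eM.val (baseEnv x.length k)) ++ r.out
          rep := r.rep.drop (eM.val (baseEnv x.length k)) }.toStore
        (p.eval (x.length + k)) := by
  obtain ⟨p, hp⟩ := eM.runs_eval_s
  refine ⟨1 + p + (11 * p + 2), fun r x k h1 h2 h3 h4 h5 h6 => ?_⟩
  obtain ⟨hp1, hp2⟩ := hp { r with cnt := r.cnt.tail } (x.length + k) h5
    ⟨by simp [h1, length_zeros], by simp [h2], by simp [h3], by simp [h4]⟩
  rw [env_base { r with cnt := r.cnt.tail } x k h1 h2 h3 h4] at hp1 hp2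
  refine (Runs.seq ((runs_pop 6 _).congr (by simp) le_rfl)
    (hp2.seq (runs_emitReply _ _ rfl h6))).congr ?_ ?_
  · simp [h5]
  · simp only [Polynomial.eval_add, Polynomial.eval_mul, Polynomial.eval_ofNat,
      Polynomial.eval_one]
    omega

theorem Rep.exists_expr {f : ℕ → ℕ → ℕ} (hf : Rep fun v => f (v 1) (v 0)) :
    ∃ e : Expr, ∀ n k, e.val (baseEnv n k) = f n k := by
  obtain ⟨e, he⟩ := hf
  exact ⟨e, fun n k => he _⟩

/-- A polynomial-time machine that, on input `⟨x, 0 ^ k⟩`, asks `N` queries `⟨x, 0 ^ k', r⟩`, with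
fresh random strings `r` of length `R`, and outputs the first `m` bits of each answer. Here `N`,
`k'`, `R` and `m` are functions of `|x|` (the variable `1`) and `k` (the variable `0`). -/
theorem exists_sampling_machine {N K R m : ℕ → ℕ → ℕ} (hN : Rep fun v => N (v 1) (v 0))
    (hK : Rep fun v => K (v 1) (v 0)) (hR : Rep fun v => R (v 1) (v 0))
    (hm : Rep fun v => m (v 1) (v 0)) :
    ∃ (M : PTM) (T : Polynomial ℕ), ∀ O : Oracle, M.RunsInTime O (fun n => T.eval n) ∧
      ∀ (x : List Bool) (k : ℕ), M.outLaw O (inst x k) =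
        iterLaw (m x.length k)
          ((PMF.uniformOfFintype (Fin (R x.length k) → Bool)).bind fun r =>
            O (instR x (K x.length k) (List.ofFn r))) (N x.length k) [] := by
  obtain ⟨eN, hN⟩ := hN.exists_expr
  obtain ⟨eK, hK⟩ := hK.exists_expr
  obtain ⟨eR, hR⟩ := hR.exists_expr
  obtain ⟨eM, hm⟩ := hm.exists_expr
  obtain ⟨pB, hB⟩ := sem_askSample eR eK
  obtain ⟨pC, hC⟩ := runs_takeReply eM
  obtain ⟨pN, hpN⟩ := eN.runs_eval_s
  set A : Cmd := seq parse (seq (eN.eval Regs.var 9) (moveAll 9 6)) with hA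
  set M := loopMachine A (askSample eR eK) (takeReply eM) with hM
  have key : ∀ (O : Oracle) (x : List Bool) (k : ℕ), PTM.Yields M O (some (M.init (inst x k)))
      ((pN * (pB + pC + 3) + 1 + ((6 * Polynomial.X + 2) + (pN + (5 * pN + 1)))).eval
        (x.length + k))
      (iterLaw (m x.length k)
          ((PMF.uniformOfFintype (Fin (R x.length k) → Bool)).bind fun r =>
            O (instR x (K x.length k) (List.ofFn r))) (N x.length k) []) := by
    intro O x k
    set L := (PMF.uniformOfFintype (Fin (R x.length k) → Bool)).bind fun r =>
            O (instR x (K x.length k) (List.ofFn r)) with hL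
    obtain ⟨hN1, hN2⟩ := hpN { inp := zeros k, xs := x.reverse } (x.length + k) rfl
      ⟨by simp [length_zeros], by simp, by simp, by simp⟩
    rw [env_base { inp := zeros k, xs := x.reverse } x k rfl rfl rfl rfl, hN] at hN1 hN2
    have hArun : Runs A ({ inp := inst x k } : Regs).toStore
        ({ inp := zeros k, xs := x.reverse, cnt := zeros (N x.length k) } : Regs).toStore
        ((6 * x.length + 2) + (pN.eval (x.length + k) + (5 * N x.length k + 1))) := by
      refine ((runs_parse x k).seq (hN2.seq (runs_moveAll (by norm_num) _))).congr ?_ ?_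
      · simp [reverse_zeros]
      · simp [length_zeros]
    have hloop : ∀ (j : ℕ) (out rep : List Bool), PTM.Yields M O (conf _ (testSt _ _ _)
        ({ inp := zeros k, xs := x.reverse, cnt := zeros j, out := out, rep := rep } :
          Regs).toStore)
        (j * (pB.eval (x.length + k) + pC.eval (x.length + k) + 3) + 1)
        (iterLaw (m x.length k) L j out) := by
      intro j
      induction j with
      | zero =>
        intro out rep
        rw [zero_mul, zero_add]
        exact yields_test_nil rfl
      | succ j ih =>
        intro out rep
        have h := yields_test_cons (O := O) (A := A) (by simp [zeros])
          (hB { inp := zeros k, xs := x.reverse, cnt := zeros (j + 1), out := out, rep := rep }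
            x k rfl rfl rfl rfl rfl rfl rfl)
          (κ := fun _ a => PMF.pure ({
            inp := zeros k
            xs := x.reverse
            cnt := zeros j
            out := a.take (m x.length k) ++ out
            rep := a.drop (m x.length k) } : Regs).toStore)
          (tC := pC.eval (x.length + k))
          (T := j * (pB.eval (x.length + k) + pC.eval (x.length + k) + 3) + 1)
          (ν := fun σ => iterLaw (m x.length k) L j (σ 1)) (C := takeReply eM) ?_ ?_
        · refine PTM.Yields.mono ?_ (le_of_eq (?_ : j * (pB.eval (x.length + k) +
            pC.eval (x.length + k) + 3) + 1 + (pB.eval (x.length + k) +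
            pC.eval (x.length + k) + 3) = _))
          · convert h using 1
            rw [iterLaw, hL, hR, hK, PMF.bind_map, PMF.bind_bind]
            congr 1
            funext u
            refine congrArg (PMF.bind _) ?_
            funext o
            cases o <;> simp
          · ring
        · intro σ' hσ' a
          obtain ⟨u, -, rfl⟩ := (PMF.mem_support_map_iff _ _ _).1 hσ'
          have := hC { inp := zeros k, xs := x.reverse, cnt := zeros (j + 1), out := out, rep := a }
            x k rfl rfl rfl rfl rfl rfl
          simp only [update_2, update_3]
          rw [hm] at this
          exact this
        · intro σ' hσ' a σ'' hσ''
          simp only [PMF.support_pure, Set.mem_singleton_iff] at hσ''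
          subst hσ''
          exact ih _ _
    have h := yields_loopMachine (O := O) (w := inst x k) (B := askSample eR eK)
      (C := takeReply eM) (A := A) (μ := PMF.pure
        ({ inp := zeros k, xs := x.reverse, cnt := zeros (N x.length k) } : Regs).toStore)
      (tA := (6 * x.length + 2) + (pN.eval (x.length + k) + (5 * N x.length k + 1)))
      (ν := fun _ => iterLaw (m x.length k) L (N x.length k) [])
      (T := N x.length k * (pB.eval (x.length + k) + pC.eval (x.length + k) + 3) + 1)
      (by
        have : Function.update (fun _ => []) 0 (inst x k) =
            ({ inp := inst x k } : Regs).toStore := by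
          rw [← update_0 { }]
          congr 1
          funext j
          match j with | 0 | 1 | 2 | 3 | 4 | 5 | 6 | 7 | 8 | 9 | _ + 10 => rfl
        rw [this]
        exact hArun)
      (fun σ hσ => by
        simp only [PMF.support_pure, Set.mem_singleton_iff] at hσ
        subst hσ
        exact hloop _ _ _)
    rw [PMF.pure_bind] at h
    refine h.mono ?_
    simp only [Polynomial.eval_add, Polynomial.eval_mul, Polynomial.eval_ofNat,
      Polynomial.eval_one, Polynomial.eval_X]
    have := Nat.mul_le_mul_right (pB.eval (x.length + k) + pC.eval (x.length + k) + 3) hN1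
    omega
  refine ⟨M, _, fun O => ⟨runsInTime_of_yields fun x k _ => ⟨_, _, le_rfl, key O x k⟩,
    fun x k => (key O x k).outLaw_eq⟩⟩

/-- Read `L` random bits, most significant bit first, and reduce modulo `N`, starting from `a`. -/
noncomputable def accLaw (N : ℕ) : ℕ → ℕ → PMF ℕ
  | 0, a => PMF.pure a
  | L + 1, a => (PMF.uniformOfFintype Bool).bind fun b => accLaw N L ((2 * a + b.toNat) % N)

theorem accLaw_eq (N L a : ℕ) (ha : a < N) :
    accLaw N L a =
      (PMF.uniformOfFintype (Fin (2 ^ L))).map fun v : Fin (2 ^ L) => (2 ^ L * a + v) % N := by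
  induction L generalizing a with
  | zero =>
    have : (fun v : Fin (2 ^ 0) => (2 ^ 0 * a + v) % N) = fun _ => a := by
      funext v
      have := v.2
      rw [show (v : ℕ) = 0 by omega, pow_zero, one_mul, add_zero, Nat.mod_eq_of_lt ha]
    rw [this]
    exact (PMF.map_const _ _).symm
  | succ L ih =>
    let e : Bool × Fin (2 ^ L) ≃ Fin (2 ^ (L + 1)) :=
      ((finTwoEquiv.symm.prodCongr (Equiv.refl _)).trans finProdFinEquiv).trans
        (finCongr (by ring))
    have he : ∀ b v, (e (b, v) : ℕ) = v + 2 ^ L * b.toNat := by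
      intro b v
      cases b <;> simp [e, finTwoEquiv, finProdFinEquiv]
    rw [← uniform_map_equiv e, uniform_prod, PMF.map_comp, PMF.map_bind, accLaw]
    congr 1
    funext b
    rw [ih _ (Nat.mod_lt _ (by omega)), PMF.map_comp]
    congr 1
    funext v
    simp only [Function.comp, he]
    rw [Nat.add_mod, Nat.mul_mod, Nat.mod_mod, ← Nat.mul_mod, ← Nat.add_mod]
    congr 1
    ring

theorem runs_skip (σ : Store) : Runs (act 0 .keep) σ σ 1 :=
  (runs_act 0 .keep σ).congr (by simp [TapeAct.apply]) le_rfl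

/-- Double the number on tape `7`, add a random bit, and reduce; `e` describes the reduction. -/
def randomStep (e : Expr) : Cmd :=
  seq (pop 9) (seq (coin 8) (seq (ite 8 (fun o => o == some true) (act 0 .keep) (pop 8))
    (seq (assign e) (pop 8))))

theorem sem_randomStep (e : Expr) : ∃ p : Polynomial ℕ, ∀ (r : Regs) (N a b : ℕ), a < N →
    (∀ c : Bool, e.val { r with coin := zeros c.toNat }.env = (2 * a + c.toNat) % N) →
    r.inp.length ≤ b → r.xs.length ≤ b → r.acc = zeros a → r.coin = [] →
      Sem (randomStep e) r.toStore
        ((PMF.uniformOfFintype Bool).map fun c =>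
          { r with acc := zeros ((2 * a + c.toNat) % N), s := r.s.tail }.toStore)
        (p.eval (b + N)) := by
  obtain ⟨p, hp⟩ := runs_assign e
  refine ⟨p + 5, fun r N a b ha he h1 h2 h3 h4 => ?_⟩
  have hcoin : Sem (coin 8) { r with s := r.s.tail }.toStore
      ((PMF.uniformOfFintype Bool).map fun c => { r with s := r.s.tail, coin := [c] }.toStore) 1 :=
    (sem_coin 8 _).congr (by simp [h4]) le_rfl
  have hrest : ∀ c : Bool, Runs (seq (ite 8 (fun o => o == some true) (act 0 .keep) (pop 8))
      (seq (assign e) (pop 8))) { r with s := r.s.tail, coin := [c] }.toStore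
      { r with acc := zeros ((2 * a + c.toNat) % N), s := r.s.tail }.toStore
      (2 + (p.eval (b + N) + 1)) := by
    intro c
    have hx : ∀ l : List Bool, l.length = c.toNat →
        Runs (seq (assign e) (pop 8)) { r with s := r.s.tail, coin := l }.toStore
          { r with acc := zeros ((2 * a + c.toNat) % N), s := r.s.tail }.toStore
          (p.eval (b + N) + 1) := by
      intro l hl
      have hc1 : c.toNat ≤ 1 := by cases c <;> simp
      have henv : ({ r with s := r.s.tail, coin := l } : Regs).env =
          { r with coin := zeros c.toNat }.env := by
        funext i
        unfold env var
        split <;> simp [hl, length_zeros]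
      have h5 := hp { r with s := r.s.tail, coin := l } (b + N)
        ⟨by simpa using h1.trans (Nat.le_add_right _ _),
          by simpa using h2.trans (Nat.le_add_right _ _), by simp [h3, length_zeros]; omega,
          by simp [hl]; omega⟩
      rw [henv, he] at h5
      have hl2 : l.tail = [] := by
        rw [← List.length_eq_zero_iff, List.length_tail]; omega
      refine (h5.seq (runs_pop 8 _)).congr ?_ le_rfl
      simp [hl2, h4]
    cases c with
    | true => exact Runs.seq (Sem.ite_true (by simp) (runs_skip _)) (hx [true] rfl)
    | false =>
      exact Runs.seq (Sem.ite_false (by simp) ((runs_pop _ _).congr (by simp) le_rfl))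
        (hx [] rfl)
  have hpop : Runs (pop 9) r.toStore { r with s := r.s.tail }.toStore 1 :=
    (runs_pop 9 _).congr (by simp) le_rfl
  refine (hpop.seq_sem (hcoin.seq (κ := fun σ => PMF.pure
    { r with acc := zeros ((2 * a + ((σ 8).headD false).toNat) % N), s := r.s.tail }.toStore)
    (t := 2 + (p.eval (b + N) + 1)) fun σ' hσ' => ?_)).congr ?_ ?_
  · obtain ⟨c, -, rfl⟩ := (PMF.mem_support_map_iff _ _ _).1 hσ'
    exact hrest c
  · rw [PMF.bind_map, PMF.map]
    congr 1
  · simp only [Polynomial.eval_add, Polynomial.eval_ofNat]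
    omega

/-- A random number below `N`, on the tape `7`. -/
theorem sem_randomLoop {e : Expr} {N : ℕ → ℕ → ℕ} (hN : ∀ n k, 0 < N n k)
    (he : ∀ v, e.val v = if 2 * v 2 + v 3 < N (v 1) (v 0) then 2 * v 2 + v 3
      else 2 * v 2 + v 3 - N (v 1) (v 0)) :
    ∃ p : Polynomial ℕ, ∀ (x : List Bool) (k L : ℕ),
      Sem (whileSome 9 (randomStep e))
        ({ inp := zeros k, xs := x.reverse, s := zeros L } : Regs).toStore
        ((accLaw (N x.length k) L 0).map fun a =>
          ({ inp := zeros k, xs := x.reverse, acc := zeros a } : Regs).toStore)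
        (L * (p.eval (x.length + k + N x.length k) + 1) + 1) := by
  obtain ⟨p, hp⟩ := sem_randomStep e
  refine ⟨p, fun x k L => ?_⟩
  have h := Sem.loop (i := 9) (p := Option.isSome) (c := randomStep e)
    (s := p.eval (x.length + k + N x.length k))
    (fun j σ => ∃ a < N x.length k,
      σ = ({ inp := zeros k, xs := x.reverse, acc := zeros a, s := zeros j } : Regs).toStore)
    (fun j σ => (accLaw (N x.length k) j (σ 7).length).map fun a =>
      ({ inp := zeros k, xs := x.reverse, acc := zeros a } : Regs).toStore)
    (fun σ => (PMF.uniformOfFintype Bool).map fun c =>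
      ({
        inp := zeros k
        xs := x.reverse
        acc := zeros ((2 * (σ 7).length + c.toNat) % N x.length k)
        s := (σ 9).tail } : Regs).toStore) ?_ ?_ (n := L)
    (σ := ({ inp := zeros k, xs := x.reverse, s := zeros L } : Regs).toStore)
    ⟨0, hN _ _, rfl⟩
  · exact h
  · rintro σ ⟨a, ha, rfl⟩
    simp [accLaw, PMF.pure_map, zeros]
  · rintro j σ ⟨a, ha, rfl⟩
    refine ⟨?_, by simp [zeros], ?_, ?_⟩
    · simp only [toStore_7, length_zeros]
      rw [accLaw, PMF.map_bind, PMF.bind_map]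
      congr 1
      funext c
      simp [length_zeros]
    · simp only [toStore_7, toStore_9, length_zeros]
      refine hp _ (N x.length k) a (x.length + k) ha (fun c => ?_) ?_ ?_ rfl rfl
      · rw [he]
        simp only [env, var, toStore_7, toStore_8, toStore_4, toStore_0, length_zeros,
          List.length_reverse]
        have hc1 : c.toNat ≤ 1 := by cases c <;> simp
        split_ifs with hlt
        · rw [Nat.mod_eq_of_lt hlt]
        · rw [Nat.mod_eq_sub_mod (by omega), Nat.mod_eq_of_lt (by omega)]
      · simp [length_zeros]
      · simp
    · intro σ' hσ'
      obtain ⟨c, -, rfl⟩ := (PMF.mem_support_map_iff _ _ _).1 hσ'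
      refine ⟨(2 * a + c.toNat) % N x.length k, Nat.mod_lt _ (hN x.length k), ?_⟩
      simp [zeros_succ, length_zeros]

/-- Write the query `⟨x, 0 ^ k'⟩`, where `k'` is given by an expression. -/
def askInst (eK : Expr) : Cmd :=
  seq (eK.eval Regs.var 9) (seq (emitZeros false) (seq (push 2 false) emitX))

theorem runs_askInst (eK : Expr) : ∃ p : Polynomial ℕ, ∀ (r : Regs) (x : List Bool) (b K : ℕ),
    r.EnvLe b → r.xs = x.reverse → r.s = [] → r.tmp = [] → r.qry = [] → eK.val r.env = K →
      Runs (askInst eK) r.toStore { r with qry := inst x K }.toStore (p.eval b) := by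
  obtain ⟨p, hp⟩ := eK.runs_eval_s
  refine ⟨p + (4 * p + 1) + 1 + (13 * Polynomial.X + 2), fun r x b K hb h1 h2 h3 h4 h5 => ?_⟩
  obtain ⟨hp1, hp2⟩ := hp r b h2 hb
  rw [h5] at hp1 hp2
  have e2 : Runs (emitZeros false) { r with s := zeros K }.toStore
      { r with qry := zeros K }.toStore (4 * K + 1) :=
    (runs_emitZeros false _ K rfl).congr (by simp [h2, h4]) le_rfl
  have e3 : Runs (push 2 false) { r with qry := zeros K }.toStore
      { r with qry := false :: zeros K }.toStore 1 :=
    (runs_push 2 false _).congr (by simp) le_rfl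
  have e4 : Runs emitX { r with qry := false :: zeros K }.toStore
      { r with qry := inst x K }.toStore (13 * x.length + 2) :=
    runs_emitX _ x h1 h3
  refine (hp2.seq (e2.seq (e3.seq e4))).congr rfl ?_
  have := hb.2.1
  simp only [h1, List.length_reverse] at this
  simp only [Polynomial.eval_add, Polynomial.eval_mul, Polynomial.eval_ofNat,
    Polynomial.eval_one, Polynomial.eval_X]
  omega

/-- Output the bits of the reply at the positions `d`, …, `d + m - 1`, where `d` and `m` are given
by expressions. -/
def sliceReply (eD eM : Expr) : Cmd :=
  seq (pop 6) (seq (eD.eval Regs.var 9) (seq dropReply (seq (eM.eval Regs.var 9) emitReply)))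

theorem runs_sliceReply (eD eM : Expr) : ∃ p : Polynomial ℕ, ∀ (r : Regs) (b d m : ℕ),
    r.EnvLe b → r.s = [] → r.tmp = [] → eD.val r.env = d → eM.val r.env = m →
      Runs (sliceReply eD eM) r.toStore
        { r with
          cnt := r.cnt.tail
          out := (r.rep.drop d).take m ++ r.out
          rep := (r.rep.drop d).drop m }.toStore (p.eval b) := by
  obtain ⟨p, hp⟩ := eD.runs_eval_s
  obtain ⟨q, hq⟩ := eM.runs_eval_s
  refine ⟨1 + p + (3 * p + 1) + q + (11 * q + 2), fun r b d m hb h1 h2 h3 h4 => ?_⟩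
  obtain ⟨hp1, hp2⟩ := hp { r with cnt := r.cnt.tail } b h1 hb
  obtain ⟨hq1, hq2⟩ := hq { r with cnt := r.cnt.tail, rep := r.rep.drop d } b h1 hb
  have env_eq : ∀ c rep, ({ r with cnt := c, rep := rep } : Regs).env = r.env := by
    intro c rep
    funext i
    unfold env var
    split <;> rfl
  rw [env_eq r.cnt.tail r.rep, h3] at hp1 hp2
  rw [env_eq, h4] at hq1 hq2
  have e1 : Runs (pop 6) r.toStore { r with cnt := r.cnt.tail }.toStore 1 :=
    (runs_pop 6 _).congr (by simp) le_rfl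
  have e2 : Runs dropReply { r with cnt := r.cnt.tail, s := zeros d }.toStore
      { r with cnt := r.cnt.tail, rep := r.rep.drop d }.toStore (3 * d + 1) :=
    (runs_dropReply _ d rfl).congr (by simp [h1]) le_rfl
  have e3 : Runs emitReply { r with cnt := r.cnt.tail, rep := r.rep.drop d, s := zeros m }.toStore
      { r with
          cnt := r.cnt.tail
          out := (r.rep.drop d).take m ++ r.out
          rep := (r.rep.drop d).drop m }.toStore (11 * m + 2) :=
    (runs_emitReply { r with cnt := r.cnt.tail, rep := r.rep.drop d, s := zeros m } m rfl
      h2).congr (by simp [h1]) le_rfl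
  refine (e1.seq (hp2.seq (e2.seq (hq2.seq e3)))).congr rfl ?_
  simp only [Polynomial.eval_add, Polynomial.eval_mul, Polynomial.eval_ofNat,
    Polynomial.eval_one]
  omega

/-- A polynomial-time machine that, on input `⟨x, 0 ^ k⟩`, asks the query `⟨x, 0 ^ k'⟩` and outputs
a block of length `m` of the answer, whose index is a random number with `L` bits, reduced
modulo `N`. Here `k'`, `m`, `L` and `N` are functions of `|x|` (the variable `1`) and `k` (the
variable `0`). -/
theorem exists_block_machine {N K L m : ℕ → ℕ → ℕ} (hN0 : ∀ n k, 0 < N n k)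
    (hN : Rep fun v => N (v 1) (v 0)) (hK : Rep fun v => K (v 1) (v 0))
    (hL : Rep fun v => L (v 1) (v 0)) (hm : Rep fun v => m (v 1) (v 0)) :
    ∃ (M : PTM) (T : Polynomial ℕ), ∀ O : Oracle, M.RunsInTime O (fun n => T.eval n) ∧
      ∀ (x : List Bool) (k : ℕ), M.outLaw O (inst x k) =
        (PMF.uniformOfFintype (Fin (2 ^ L x.length k))).bind fun v =>
          (O (inst x (K x.length k))).map
            (Option.map fun Y => block (m x.length k) Y (v % N x.length k)) := by
  have hT : Rep fun v => 2 * v 2 + v 3 := ((Rep.const 2).mul (.var 2)).add (.var 3)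
  -- since `2 * a + c < 2 * N` for `a < N`, a reduction subtracts `N` at most once
  obtain ⟨eS, hS⟩ := hT.tsub (hN.mul (Rep.one.tsub (hN.tsub hT)))
  obtain ⟨eD, hD⟩ := (Rep.var 2).mul hm
  obtain ⟨eN, hN⟩ := hN
  obtain ⟨eK, hK⟩ := hK
  obtain ⟨eL, hL⟩ := hL
  obtain ⟨eM, hm⟩ := hm
  beta_reduce at hS hD hN hK hL hm
  obtain ⟨pL, hpL⟩ := eL.runs_eval_s
  obtain ⟨pN, hpN⟩ := eN.runs_eval_s
  obtain ⟨pR, hpR⟩ := sem_randomLoop (e := eS) hN0 fun v => by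
    rw [hS]
    split_ifs with h
    · rw [show 1 - (N (v 1) (v 0) - (2 * v 2 + v 3)) = 0 by omega, mul_zero, Nat.sub_zero]
    · rw [show 1 - (N (v 1) (v 0) - (2 * v 2 + v 3)) = 1 by omega, mul_one]
  obtain ⟨pB, hpB⟩ := runs_askInst eK
  obtain ⟨pC, hpC⟩ := runs_sliceReply eD eM
  set A : Cmd := seq parse (seq (eL.eval Regs.var 9)
    (seq (whileSome 9 (randomStep eS)) (push 6 false))) with hA
  set M := loopMachine A (askInst eK) (sliceReply eD eM) with hM
  have key : ∀ (O : Oracle) (x : List Bool) (k : ℕ), PTM.Yields M O (some (M.init (inst x k)))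
      ((1 + ((pB + pC).comp (Polynomial.X + pN) + 3) + ((6 * Polynomial.X + 2) + (pL +
        ((pL * (pR.comp (Polynomial.X + pN) + 1) + 1) + 1)))).eval (x.length + k))
      ((PMF.uniformOfFintype (Fin (2 ^ L x.length k))).bind fun v =>
          (O (inst x (K x.length k))).map
            (Option.map fun Y => block (m x.length k) Y (v % N x.length k))) := by
    intro O x k
    have hE : ({ inp := zeros k, xs := x.reverse } : Regs).EnvLe (x.length + k) :=
      ⟨by simp [length_zeros], by simp, by simp, by simp⟩
    have env1 : ∀ r : Regs, r.inp = zeros k → r.xs = x.reverse →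
        r.env 0 = k ∧ r.env 1 = x.length := by
      intro r h1 h2
      simp [env, var, h1, h2, length_zeros]
    obtain ⟨hL1, hL2⟩ := hpL _ _ rfl hE
    obtain ⟨hN1, -⟩ := hpN _ _ rfl hE
    obtain ⟨h0, h1⟩ := env1 { inp := zeros k, xs := x.reverse } rfl rfl
    rw [hL, h0, h1] at hL1 hL2
    rw [hN, h0, h1] at hN1
    have hArun : Sem A ({ inp := inst x k } : Regs).toStore
        ((accLaw (N x.length k) (L x.length k) 0).map fun a => ({
          inp := zeros k
          xs := x.reverse
          cnt := [false]
          acc := zeros a } : Regs).toStore)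
        ((6 * x.length + 2) + (pL.eval (x.length + k) + ((L x.length k *
          (pR.eval (x.length + k + N x.length k) + 1) + 1) + 1))) := by
      refine (runs_parse x k).seq_sem (hL2.seq_sem (((hpR x k (L x.length k)).seq
        (κ := fun σ => PMF.pure (Function.update σ 6 (false :: σ 6)))
        fun σ' _ => runs_push 6 false σ').congr ?_ le_rfl))
      rw [PMF.bind_map, PMF.map]
      congr 1
      funext a
      simp
    have hloop : ∀ a < N x.length k, PTM.Yields M O (conf _ (testSt _ _ _)
        ({ inp := zeros k, xs := x.reverse, cnt := [false], acc := zeros a } : Regs).toStore)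
        (1 + (pB.eval (x.length + k + N x.length k) + pC.eval (x.length + k + N x.length k) + 3))
        ((O (inst x (K x.length k))).map (Option.map fun Y => block (m x.length k) Y a)) := by
      intro a ha
      have hE' : ∀ rep, ({
          inp := zeros k
          xs := x.reverse
          cnt := [false]
          acc := zeros a
          rep := rep } : Regs).EnvLe (x.length + k + N x.length k) := by
        intro rep
        refine ⟨?_, ?_, ?_, ?_⟩
        · simp only [length_zeros]; omega
        · simp only [List.length_reverse]; omega
        · simp only [length_zeros]; omega
        · simp
      have h := yields_test_cons (O := O) (A := A) (B := askInst eK) (C := sliceReply eD eM)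
        (by simp)
        (hpB { inp := zeros k, xs := x.reverse, cnt := [false], acc := zeros a } x _
          (K x.length k) (hE' _) rfl rfl rfl rfl (by
            obtain ⟨h0, h1⟩ := env1
              { inp := zeros k, xs := x.reverse, cnt := [false], acc := zeros a } rfl rfl
            rw [hK, h0, h1]))
        (κ := fun _ Y => PMF.pure ({
          inp := zeros k
          xs := x.reverse
          acc := zeros a
          out := block (m x.length k) Y a
          rep := (Y.drop (a * m x.length k)).drop (m x.length k) } : Regs).toStore)
        (tC := pC.eval (x.length + k + N x.length k))
        (T := 1) (ν := fun σ => PMF.pure (some (σ 1))) ?_ ?_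
      · convert h using 1
        rw [PMF.pure_bind, PMF.map]
        congr 1
        funext o
        cases o <;> simp
      · intro σ' hσ' Y
        simp only [PMF.support_pure, Set.mem_singleton_iff] at hσ'
        subst hσ'
        obtain ⟨h0, h1⟩ := env1
          { inp := zeros k, xs := x.reverse, cnt := [false], acc := zeros a, rep := Y } rfl rfl
        have := hpC { inp := zeros k, xs := x.reverse, cnt := [false], acc := zeros a, rep := Y }
          (x.length + k + N x.length k) (a * m x.length k) (m x.length k) (hE' _) rfl rfl
          (by rw [hD, h0, h1]; simp [env, var, length_zeros])
          (by rw [hm, h0, h1])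
        simp only [List.append_nil, List.tail_cons] at this
        simp only [update_2, update_3]
        exact this
      · intro σ' hσ' Y σ'' hσ''
        simp only [PMF.support_pure, Set.mem_singleton_iff] at hσ''
        subst hσ''
        exact yields_test_nil rfl
    have h := yields_loopMachine (O := O) (w := inst x k) (B := askInst eK)
      (C := sliceReply eD eM) (A := A)
      (ν := fun σ => (O (inst x (K x.length k))).map
        (Option.map fun Y => block (m x.length k) Y (σ 7).length))
      (T := 1 + (pB.eval (x.length + k + N x.length k) +
        pC.eval (x.length + k + N x.length k) + 3))
      (by
        have : Function.update (fun _ => []) 0 (inst x k) =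
            ({ inp := inst x k } : Regs).toStore := by
          rw [← update_0 { }]
          congr 1
          funext j
          match j with | 0 | 1 | 2 | 3 | 4 | 5 | 6 | 7 | 8 | 9 | _ + 10 => rfl
        rw [this]
        exact hArun)
      (fun σ hσ => by
        rw [accLaw_eq _ _ _ (hN0 _ _), PMF.map_comp] at hσ
        obtain ⟨v, -, rfl⟩ := (PMF.mem_support_map_iff _ _ _).1 hσ
        simp only [Function.comp, toStore_7, length_zeros]
        exact hloop _ (Nat.mod_lt _ (hN0 _ _)))
    rw [accLaw_eq _ _ _ (hN0 _ _), PMF.map_comp, PMF.bind_map] at h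
    simp only [Function.comp_def, toStore_7, length_zeros, mul_zero, zero_add] at h
    refine h.mono ?_
    simp only [Polynomial.eval_add, Polynomial.eval_mul, Polynomial.eval_ofNat,
      Polynomial.eval_one, Polynomial.eval_X, Polynomial.eval_comp]
    have hs : x.length + k + N x.length k ≤ x.length + k + pN.eval (x.length + k) := by omega
    have hb1 := eval_poly_mono pB hs
    have hb2 := eval_poly_mono pC hs
    have hb3 := eval_poly_mono pR hs
    have hb4 := Nat.mul_le_mul hL1 (Nat.succ_le_succ hb3)
    simp only [Nat.succ_eq_add_one] at hb1 hb2 hb3 hb4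
    omega
  refine ⟨M, _, fun O => ⟨runsInTime_of_yields fun x k _ => ⟨_, _, le_rfl, key O x k⟩,
    fun x k => (key O x k).outLaw_eq⟩⟩

/-! ### Searching with a sampler -/

/-- In general this is not an equality, since answers that are longer than `m` are truncated. -/
theorem prod_le_iterLaw (m : ℕ) (L : PMF (Option (List Bool))) (j : ℕ) (out Y : List Bool)
    (hY : Y ∈ strings (j * m)) :
    ∏ i ∈ Finset.range j, L (some (block m Y i)) ≤ iterLaw m L j out (some (Y ++ out)) := by
  induction j generalizing out Y with
  | zero =>
    have : Y = [] := by simpa using hY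
    simp [this, iterLaw]
  | succ j ih =>
    rw [mem_strings] at hY
    obtain ⟨Y, y, rfl, hY1, hy⟩ : ∃ Y' y, Y = Y' ++ y ∧ Y'.length = j * m ∧ y.length = m := by
      refine ⟨Y.take (j * m), Y.drop (j * m), (List.take_append_drop _ _).symm, ?_, ?_⟩ <;>
        simp [hY, Nat.succ_mul]
    rw [prod_block_append hY1 hy fun y => L (some y), mul_comm, iterLaw, PMF.bind_apply]
    refine le_trans ?_ (ENNReal.le_tsum (some y))
    have h := ih (y ++ out) Y (mem_strings.2 hY1)
    rw [Option.elim_some, ← hy, List.take_length, hy, List.append_assoc]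
    exact mul_le_mul_right h _

variable {U : List Bool → List Bool →. List Bool} {S : SamplingProblem}

/-- Independent samples from a law close to `D x` form a solution with high probability. -/
theorem one_sub_le_sum_prod (hU : IsUniversal U) (x : List Bool) {k : ℕ} (hk : 1 ≤ k)
    {L : PMF (Option (List Bool))} {ε : ℝ} (hε1 : ε ≤ 1)
    (hL : tvDist L ((S.D x).map some) ≤ ε)
    (hε : numSamples (S.len.eval x.length) k * ε ≤ 1 / (2 * k)) :
    1 - 1 / (k : ℝ) ≤ ∑ Y ∈ solFinset U S x k,
      ∏ i ∈ Finset.range (numSamples (S.len.eval x.length) k),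
        (L (some (block (S.len.eval x.length) Y i))).toReal := by
  classical
  have hsol := one_sub_le_sum_solSet hU S x hk
  have hall := SamplingProblem.sum_tupleProb (S := S) x (numSamples (S.len.eval x.length) k)
  set m := S.len.eval x.length
  set N := numSamples m k
  -- the common part of the two laws
  let g : List Bool → ℝ := fun y => min (S.prob x y) (L (some y)).toReal
  have hg0 : ∀ y, 0 ≤ g y := fun y =>
    le_min (SamplingProblem.prob_nonneg _ _) ENNReal.toReal_nonneg
  have hg : 1 - ε ≤ ∑ y ∈ strings m, g y := by
    have h1 := sum_le_hasSum ((strings m).map Function.Embedding.some)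
      (fun _ _ => le_max_right _ _) (hasSum_max_tvDist L ((S.D x).map some))
    rw [Finset.sum_map] at h1
    simp only [Function.Embedding.some_apply, S.map_some_apply] at h1
    have h2 : ∀ y, g y = S.prob x y - max (S.prob x y - (L (some y)).toReal) 0 := by
      intro y
      simp only [g]
      rcases le_total (S.prob x y) (L (some y)).toReal with h | h
      · rw [min_eq_left h, max_eq_right (by linarith), sub_zero]
      · rw [min_eq_right h, max_eq_left (by linarith), sub_sub_cancel]
    rw [Finset.sum_congr rfl fun y _ => h2 y, Finset.sum_sub_distrib, SamplingProblem.sum_prob]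
    have h3 : ∑ y ∈ strings m, max (S.prob x y - (L (some y)).toReal) 0 ≤ tvDist L
      ((S.D x).map some) := h1
    linarith
  have hpow : 1 - 1 / (2 * k) ≤ ∑ Y ∈ strings (N * m), ∏ i ∈ Finset.range N, g (block m Y i) := by
    rw [sum_prod_block]
    have h1 := one_add_mul_le_pow (show -2 ≤ -ε by linarith) N
    have h2 := pow_le_pow_left₀ (by linarith) hg N
    rw [← sub_eq_add_neg] at h1
    linarith
  rw [← Finset.sum_filter_add_sum_filter_not _ fun Y => Y ∈ solSet U S x k] at hall hpow
  have h1 : ∑ Y ∈ strings (N * m) with Y ∉ solSet U S x k,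
      ∏ i ∈ Finset.range N, g (block m Y i) ≤
      ∑ Y ∈ strings (N * m) with Y ∉ solSet U S x k, S.tupleProb x N Y :=
    Finset.sum_le_sum fun Y _ => Finset.prod_le_prod (fun _ _ => hg0 _) fun _ _ => min_le_left _ _
  have h2 : ∑ Y ∈ strings (N * m) with Y ∈ solSet U S x k,
      ∏ i ∈ Finset.range N, g (block m Y i) ≤
      ∑ Y ∈ strings (N * m) with Y ∈ solSet U S x k,
        ∏ i ∈ Finset.range N, (L (some (block m Y i))).toReal :=
    Finset.sum_le_sum fun Y _ => Finset.prod_le_prod (fun _ _ => hg0 _) fun _ _ => min_le_right _ _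
  have h3 : 1 / (k : ℝ) = 1 / (2 * k) + 1 / (2 * k) := by
    have hk0 : (0 : ℝ) < k := by exact_mod_cast hk
    field_simp
    norm_num
  change 1 - 1 / (k : ℝ) ≤ ∑ Y ∈ strings (N * m) with Y ∈ solSet U S x k,
        ∏ i ∈ Finset.range N, (L (some (block m Y i))).toReal
  linarith

/-- The machine asks for `N` samples, each with an error of at most `1 / (2 * (N + 1) * k)`. -/
theorem inFBPP_of_samplesFrom (hU : IsUniversal U) (S : SamplingProblem) {O : Oracle}
    (hO : SamplesFrom O S) : InFBPP O (searchProblem hU S) := by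
  obtain ⟨ρ, hρ⟩ := hO
  have hm : Rep fun v => S.len.eval (v 1) := Rep.poly _ (Rep.var 1)
  have hN : Rep fun v => countSamples (S.len.eval (v 1)) (v 0) := rep_countSamples hm (Rep.var 0)
  have hK : Rep fun v => 2 * (countSamples (S.len.eval (v 1)) (v 0) + 1) * v 0 :=
    ((Rep.const 2).mul (hN.add Rep.one)).mul (Rep.var 0)
  have hR : Rep fun v =>
      ρ.eval (v 1 + 2 * (countSamples (S.len.eval (v 1)) (v 0) + 1) * v 0) :=
    Rep.poly _ ((Rep.var 1).add hK)
  obtain ⟨M, T, hMT⟩ := exists_sampling_machine (N := fun n k => countSamples (S.len.eval n) k)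
    (K := fun n k => 2 * (countSamples (S.len.eval n) k + 1) * k)
    (R := fun n k => ρ.eval (n + 2 * (countSamples (S.len.eval n) k + 1) * k))
    (m := fun n _ => S.len.eval n) hN hK hR hm
  refine ⟨M, T, (hMT O).1, fun x k hk => ?_⟩
  rw [(hMT O).2 x k]
  generalize hc : countSamples (S.len.eval x.length) k = N
  obtain rfl := hc.symm.trans (countSamples_eq hk)
  have hk1 : (1 : ℝ) ≤ k := by exact_mod_cast hk
  have hK1 : 1 ≤ 2 * (numSamples (S.len.eval x.length) k + 1) * k := Nat.one_le_iff_ne_zero.2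
    (Nat.mul_ne_zero (by omega) (by omega))
  have hL := hρ x _ hK1
  set L := (PMF.uniformOfFintype (Fin (ρ.eval (x.length +
    2 * (numSamples (S.len.eval x.length) k + 1) * k)) → Bool)).bind fun r =>
      O (instR x (2 * (numSamples (S.len.eval x.length) k + 1) * k) (List.ofFn r))
  have h := one_sub_le_sum_prod (U := U) (S := S) hU x hk (L := L)
    ((div_le_one (by positivity)).2 (by exact_mod_cast hK1)) hL (by
      push_cast
      rw [mul_one_div, div_le_div_iff₀ (by positivity) (by positivity)]
      nlinarith [Nat.cast_nonneg (α := ℝ) (numSamples (S.len.eval x.length) k)])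
  change _ ≤ (iterLaw _ L _ []).toOuterMeasure (some '' solSet U S x k)
  rw [toOuterMeasure_solSet]
  have h2 : ∑ Y ∈ solFinset U S x k,
      ∏ i ∈ Finset.range (numSamples (S.len.eval x.length) k),
        L (some (block (S.len.eval x.length) Y i)) ≤
      ∑ Y ∈ solFinset U S x k, iterLaw (S.len.eval x.length) L
        (numSamples (S.len.eval x.length) k) [] (some Y) :=
    Finset.sum_le_sum fun Y hY => by
      have := prod_le_iterLaw (S.len.eval x.length) L _ [] Y
        (mem_solSet.1 (mem_solFinset.1 hY)).1
      rwa [List.append_nil] at this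
  refine le_trans ?_ h2
  have hne : ∀ Y, ∏ i ∈ Finset.range (numSamples (S.len.eval x.length) k),
        L (some (block (S.len.eval x.length) Y i)) ≠ ⊤ :=
    fun Y => ENNReal.prod_ne_top fun i _ => PMF.apply_ne_top _ _
  rw [← ENNReal.ofReal_toReal (ENNReal.sum_ne_top.2 fun Y _ => hne Y),
    ENNReal.toReal_sum fun Y _ => hne Y]
  simp only [ENNReal.toReal_prod]
  refine le_trans (le_of_eq ?_) (ENNReal.ofReal_le_ofReal h)
  rw [ENNReal.ofReal_sub _ (by positivity), one_div, ENNReal.ofReal_inv_of_pos (by positivity),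
    ENNReal.ofReal_one, ENNReal.ofReal_natCast]

/-! ### Sampling with a searcher -/

/-- Reduction modulo `N` of a uniform number below `M` is almost uniform. -/
theorem uniform_le_uniform_mod (N M : ℕ) [NeZero N] [NeZero M] (i : ℕ) :
    (PMF.uniformOfFintype (Fin N)).map (fun j : Fin N => (j : ℕ)) i ≤
      (PMF.uniformOfFintype (Fin M)).map (fun v : Fin M => (v : ℕ) % N) i + (M : ℝ≥0∞)⁻¹ := by
  classical
  have hM : (M : ℝ≥0∞) ≠ 0 := by simp [NeZero.ne M]
  have hN : (N : ℝ≥0∞) ≠ 0 := by simp [NeZero.ne N]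
  rcases lt_or_ge i N with hi | hi
  · have h1 : (PMF.uniformOfFintype (Fin N)).map (fun j : Fin N => (j : ℕ)) i =
        (N : ℝ≥0∞)⁻¹ := by
      rw [PMF.map_apply, tsum_eq_single (⟨i, hi⟩ : Fin N) fun j hj => by
        rw [if_neg fun h => hj (Fin.ext h.symm)]]
      simp
    have h2 : (PMF.uniformOfFintype (Fin M)).map (fun v : Fin M => (v : ℕ) % N) i =
        (Nat.count (· ≡ i [MOD N]) M : ℝ≥0∞) * (M : ℝ≥0∞)⁻¹ := by
      rw [PMF.map_apply, tsum_fintype]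
      simp only [PMF.uniformOfFintype_apply, Fintype.card_fin]
      rw [← Finset.sum_range fun v => if i = v % N then (M : ℝ≥0∞)⁻¹ else 0, ← Finset.sum_filter,
        Finset.sum_const, nsmul_eq_mul, Nat.count_eq_card_filter_range]
      congr 3
      ext v
      simp only [Finset.mem_filter, Nat.ModEq, Nat.mod_eq_of_lt hi, eq_comm]
    rw [h1, h2, ← add_one_mul, ← div_eq_mul_inv,
      ENNReal.le_div_iff_mul_le (Or.inl hM) (Or.inl (ENNReal.natCast_ne_top _)), mul_comm,
      ← div_eq_mul_inv, ENNReal.div_le_iff_le_mul (Or.inl hN) (Or.inl (ENNReal.natCast_ne_top _))]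
    have h3 : M ≤ (Nat.count (· ≡ i [MOD N]) M + 1) * N := by
      rw [Nat.count_modEq_card M (Nat.pos_of_ne_zero (NeZero.ne N)) i]
      have h4 := Nat.div_add_mod M N
      have h5 := Nat.mod_lt M (Nat.pos_of_ne_zero (NeZero.ne N))
      nlinarith [Nat.zero_le (if i % N < M % N then 1 else 0)]
    exact_mod_cast h3
  · have h1 : (PMF.uniformOfFintype (Fin N)).map (fun j : Fin N => (j : ℕ)) i = 0 := by
      rw [PMF.map_apply, ENNReal.tsum_eq_zero]
      intro j
      rw [if_neg (by have := j.2; omega)]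
    rw [h1]
    exact zero_le

/-- If a coordinate is chosen by reducing a uniform number below `M`, the law of the coordinate
changes by `n / M` at most. -/
theorem coordOf_apply_le (q : PMF (Option (List Bool))) (m n M : ℕ) [NeZero n] [NeZero M]
    (a : Option (List Bool)) :
    coordOf q m n a ≤
      ((PMF.uniformOfFintype (Fin M)).bind fun v =>
        q.map (Option.map fun Y => block m Y (v % n))) a + n * (M : ℝ≥0∞)⁻¹ * coordOf q m n a := by
  have h1 : coordOf q m n = ((PMF.uniformOfFintype (Fin n)).map fun j : Fin n => (j : ℕ)).bind
      fun i => q.map (Option.map fun Y => block m Y i) := by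
    rw [PMF.bind_map, coordOf]
    exact PMF.bind_comm q (PMF.uniformOfFintype (Fin n))
      fun o i => PMF.pure (o.map fun Y => block m Y i)
  have h2 : ((PMF.uniformOfFintype (Fin M)).bind fun v =>
        q.map (Option.map fun Y => block m Y (v % n))) =
      ((PMF.uniformOfFintype (Fin M)).map fun v : Fin M => (v : ℕ) % n).bind
      fun i => q.map (Option.map fun Y => block m Y i) := by
    rw [PMF.bind_map]
    rfl
  have hn : (n : ℝ≥0∞) ≠ 0 := by simp [NeZero.ne n]
  rw [h1, h2, PMF.bind_apply, PMF.bind_apply, ← ENNReal.tsum_mul_left, ← ENNReal.tsum_add]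
  refine ENNReal.tsum_le_tsum fun i => ?_
  rw [← mul_assoc, ← add_mul]
  refine mul_le_mul_left ?_ _
  by_cases h0 : (PMF.uniformOfFintype (Fin n)).map (fun j : Fin n => (j : ℕ)) i = 0
  · rw [h0]
    exact zero_le
  · refine (uniform_le_uniform_mod n M i).trans (add_le_add_right ?_ _)
    have h3 : (PMF.uniformOfFintype (Fin n)).map (fun j : Fin n => (j : ℕ)) i =
        (n : ℝ≥0∞)⁻¹ := by
      obtain ⟨j, -, rfl⟩ := (PMF.mem_support_map_iff _ _ _).1 ((PMF.mem_support_iff _ _).2 h0)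
      classical
      rw [PMF.map_apply, tsum_eq_single j fun j' hj => by
        rw [if_neg fun h => hj (Fin.ext h.symm)]]
      simp
    rw [h3, mul_right_comm, ENNReal.mul_inv_cancel hn (ENNReal.natCast_ne_top n), one_mul]

/-- The machine asks `B` for a solution with a smaller error parameter, which exceeds the constant
of `exists_tvDist_coordLaw_le`, and outputs a coordinate. Its index is drawn with `N + 2 * k` coins,
so that it is uniform up to an error of at most `1 / (2 * k)`. -/
theorem inSampP_of_solves {U : List Bool → List Bool →. List Bool} (hU : IsUniversal U)
    (S : SamplingProblem) {B : PTM} (hB : Solves B noOracle (searchProblem hU S)) :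
    InSampP (oracleOf B) S := by
  obtain ⟨c, hc⟩ := exists_tvDist_coordLaw_le hU S B hB
  have hm : Rep fun v => S.len.eval (v 1) := Rep.poly _ (Rep.var 1)
  have hK : Rep fun v => 4 * v 0 * (c + 1) := ((Rep.const 4).mul (Rep.var 0)).mul (Rep.const _)
  have hN : Rep fun v => countSamples (S.len.eval (v 1)) (4 * v 0 * (c + 1)) - 1 + 1 :=
    ((rep_countSamples hm hK).tsub Rep.one).add Rep.one
  have hL : Rep fun v => countSamples (S.len.eval (v 1)) (4 * v 0 * (c + 1)) - 1 + 1 + 2 * v 0 :=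
    hN.add ((Rep.const 2).mul (Rep.var 0))
  obtain ⟨M, T, hMT⟩ := exists_block_machine
    (N := fun n k => countSamples (S.len.eval n) (4 * k * (c + 1)) - 1 + 1)
    (K := fun _ k => 4 * k * (c + 1))
    (L := fun n k => countSamples (S.len.eval n) (4 * k * (c + 1)) - 1 + 1 + 2 * k)
    (m := fun n _ => S.len.eval n) (fun _ _ => Nat.succ_pos _) hN hK hL hm
  refine ⟨M, T, (hMT _).1, fun x k hk => ?_⟩
  rw [(hMT _).2 x k]
  have hk1 : (1 : ℝ) ≤ k := by exact_mod_cast hk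
  have hk0 : (0 : ℝ) < k := by positivity
  have hK1 : 1 ≤ 4 * k * (c + 1) := Nat.one_le_iff_ne_zero.2
    (Nat.mul_ne_zero (by omega) (by omega))
  have hcK : c ≤ 4 * k * (c + 1) := by nlinarith
  have h := hc x _ hK1 hcK
  rw [coordLaw_eq] at h
  generalize hn : countSamples (S.len.eval x.length) (4 * k * (c + 1)) = N
  obtain rfl := hn.symm.trans (countSamples_eq hK1)
  rw [oracleOf]
  set q := B.outLaw noOracle (inst x (4 * k * (c + 1)))
  set n := numSamples (S.len.eval x.length) (4 * k * (c + 1)) - 1 + 1 with hnn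
  refine tvDist_map_some_le fun A _ => ?_
  have hle := fun y => coordOf_apply_le q (S.len.eval x.length) n (2 ^ (n + 2 * k)) (some y)
  set p := (PMF.uniformOfFintype (Fin (2 ^ (n + 2 * k)))).bind fun v =>
        q.map (Option.map fun Y => block (S.len.eval x.length) Y (v % n))
  have hle' : ∀ y, (coordOf q (S.len.eval x.length) n (some y)).toReal - (p (some y)).toReal ≤
      n * (2 ^ (n + 2 * k))⁻¹ * (coordOf q (S.len.eval x.length) n (some y)).toReal := by
    intro y
    have hne : (n : ℝ≥0∞) * ((2 ^ (n + 2 * k) : ℕ) : ℝ≥0∞)⁻¹ *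
        coordOf q (S.len.eval x.length) n (some y) ≠ ⊤ :=
      ENNReal.mul_ne_top (ENNReal.mul_ne_top (ENNReal.natCast_ne_top _) (by simp))
        (PMF.apply_ne_top _ _)
    have h1 := ENNReal.toReal_mono (ENNReal.add_ne_top.2 ⟨PMF.apply_ne_top _ _, hne⟩) (hle y)
    rw [ENNReal.toReal_add (PMF.apply_ne_top _ _) hne, ENNReal.toReal_mul, ENNReal.toReal_mul,
      ENNReal.toReal_inv, ENNReal.toReal_natCast, ENNReal.toReal_natCast] at h1
    push_cast at h1
    linarith
  have hratio : (n : ℝ) * (2 ^ (n + 2 * k))⁻¹ ≤ 1 / (2 * k) := by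
    rw [← div_eq_mul_inv, div_le_div_iff₀ (by positivity) (by positivity), pow_add, one_mul]
    have h1 : n ≤ 2 ^ n := Nat.lt_two_pow_self.le
    have h2 : 2 * k ≤ 2 ^ (2 * k) := Nat.lt_two_pow_self.le
    exact_mod_cast Nat.mul_le_mul h1 h2
  have h1 : ∑ y ∈ A, (S.prob x y - (coordOf q (S.len.eval x.length) n (some y)).toReal) ≤
      2 / ((4 * k * (c + 1) : ℕ) : ℝ) := by
    refine le_trans (Finset.sum_le_sum fun y _ => le_max_left _ 0) (le_trans ?_ h)
    have h2 := sum_le_hasSum (A.map Function.Embedding.some) (fun _ _ => le_max_right _ _)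
      (hasSum_max_tvDist (coordOf q (S.len.eval x.length) n) ((S.D x).map some))
    rw [Finset.sum_map] at h2
    simp only [Function.Embedding.some_apply, S.map_some_apply] at h2
    exact h2
  have h2 : ∑ y ∈ A, ((coordOf q (S.len.eval x.length) n (some y)).toReal - (p (some y)).toReal) ≤
      1 / (2 * k) := by
    refine (Finset.sum_le_sum fun y _ => hle' y).trans ?_
    rw [← Finset.mul_sum]
    have h3 := PMF.sum_toReal_le_one (coordOf q (S.len.eval x.length) n)
      (A.map Function.Embedding.some)
    rw [Finset.sum_map] at h3
    exact (mul_le_of_le_one_right (by positivity) h3).trans hratio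
  have h3 : 2 / ((4 * k * (c + 1) : ℕ) : ℝ) ≤ 1 / (2 * k) := by
    push_cast
    rw [div_le_div_iff₀ (by positivity) (by positivity)]
    nlinarith [mul_nonneg hk0.le (Nat.cast_nonneg (α := ℝ) c)]
  have h4 : 1 / (k : ℝ) = 1 / (2 * k) + 1 / (2 * k) := by
    field_simp
    norm_num
  rw [Finset.sum_sub_distrib] at h1 h2 ⊢
  linarith

end SampSearch

theorem mainTheorem1 (U : List Bool → List Bool →. List Bool) (hU : IsUniversal U)
    (S : SamplingProblem) :
    ∃ R : SearchProblem,
      (∀ (x : List Bool) (k : ℕ), 1 ≤ k → R.sol x k = solSet U S x k) ∧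
      (∀ O : Oracle, SamplesFrom O S → InFBPP O R) ∧
      (∀ B : PTM, Solves B noOracle R →
        (∃ c : ℕ, ∀ (x : List Bool) (k : ℕ), 1 ≤ k → c ≤ k →
          tvDist (coordLaw B S x k) ((S.D x).map some) ≤ 2 / (k : ℝ)) ∧
        InSampP (oracleOf B) S) := by
  exact ⟨searchProblem hU S, fun _ _ _ => rfl, fun _ hO => inFBPP_of_samplesFrom hU S hO,
    fun _ hB => ⟨exists_tvDist_coordLaw_le hU S _ hB, inSampP_of_solves hU S hB⟩⟩
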